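/- Let $\Gamma:\mathbb R\to\mathbb R^3$ be a smooth closed curve: $\Gamma$ is $C^\infty$, $T$-periodic for some $T>0$, and $v:=\dot\Gamma$ never vanishes. For $\ell>0$ the $\ell$-bicycle monodromy $M_\ell:S^2\to S^2$ is the map $r(0)\mapsto r(T)$ defined by the solutions of $\ell\dot r=-v+(v\cdot r)r$, $|r|=1$. At a fixed point $x$, the tangent plane $T_xS^2$ is regarded as a complex line in which $i$ acts by $\xi\mapsto x\times\xi$, and the derivative $M_\ell'(x)$ is a complex number; the fixed point is called unstable if $|M_\ell'(x)|>1$. (1) There is $\ell_0>0$ such that for $0<\ell<\ell_0$ the map $M_\ell$ has exactly one unstable fixed point; let $\lambda(\ell)$ be the derivative there. After decreasing $\ell_0$ if necessary, $\ell\ln\lambda(\ell)$, for a suitable branch of the logarithm, extends from $(0,\ell_0)$ to an infinitely differentiable function on $[0,\ell_0)$. Let $$I_n=\frac1{n!}\,\partial_\ell^n\Big|_{\ell=0}\big[\ell\ln\lambda(\ell)\big],\qquad n\ge 0.$$ These numbers depend only on $\Gamma$, except that $I_1$ depends on the branch of the logarithm and is determined by $\Gamma$ only modulo $2\pi i\,\mathbb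 Z$. (2) The $I_n$ are invariants of the bicycle correspondence. That is, let $\Gamma_1,\Gamma_2$ be two smooth closed curves with a common period $T$ such that, for some $d>0$ and all $t$, $|\Gamma_1(t)-\Gamma_2(t)|=d$ and the velocity of the midpoint $(\Gamma_1(t)+\Gamma_2(t))/2$ is a multiple of $\Gamma_1(t)-\Gamma_2(t)$. Then $I_n(\Gamma_1)=I_n(\Gamma_2)$ for all $n\neq 1$, and $I_1(\Gamma_1)\equiv I_1(\Gamma_2)$ modulo $2\pi i\,\mathbb Z$. (3) The $I_n$ are determined recursively as integrals along $\Gamma$ of polynomials in $\kappa,\tau$ and their derivatives. Precisely, define polynomials $Z_n$ with complex coefficients in the symbols $\kappa,\dot\kappa,\ddot\kappa,\dots,\tau,\dot\tau,\ddot\tau,\dots$ by $Z_0=0$ and $$Z_{n+1}=\dot Z_n+i\tau Z_n+\frac{\kappa}{2}\Big(\delta_{n0}+\sum_{j=0}^{n}Z_jZ_{n-j}\Big),\qquad n\ge 0.$$ If $\Gamma$ has a smooth $T$-periodic Frenet frame with curvature $\kappa$ and torsion $\tau$ (for example, if the curvature of $\Gamma$ vanishes nowhere), then, for a suitable branch of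 the logarithm, $$I_0=\int_\Gamma 1\,ds,\qquad I_1=-i\int_\Gamma\tau\,ds,\qquad I_n=-\int_\Gamma\kappa Z_{n-1}\,ds\quad(n\ge 2),$$ where $s$ is the arc length, the integrals are over one period, and the dots denote derivatives with respect to $s$. -/

import Mathlib

open Set Function
open scoped ContDiff RealInnerProductSpace

noncomputable section

namespace Bicycle

/-- Euclidean three-space. -/
abbrev E3 := EuclideanSpace ℝ (Fin 3)

/-- The vector product of Euclidean three-space. -/
def cross (x y : E3) : E3 := WithLp.toLp 2 (crossProduct (WithLp.ofLp x) (WithLp.ofLp y))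

/-- `Γ` is a smooth, regularly parametrized closed curve with period `T`. The parameter need not
be arc length, and `T` need not be the least period. -/
structure IsClosedSmoothCurve (Γ : ℝ → E3) (T : ℝ) : Prop where
  period_pos : 0 < T
  smooth : ContDiff ℝ ∞ Γ
  periodic : Periodic Γ T
  regular : ∀ t, deriv Γ t ≠ 0

/-! ### The bicycle equation and its monodromy -/

/-- `r` is a unit direction field (pointing from the front wheel to the rear wheel) of a bicycle of
length `ℓ` with front track `Γ`: it solves the bicycle equation `ℓ r' = -v + (v ⬝ r) r`,
`v = Γ'`. -/
def IsBicycleMotion (Γ : ℝ → E3) (ℓ : ℝ) (r : ℝ → E3) : Prop :=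
  ∀ t, ‖r t‖ = 1 ∧
    HasDerivAt r (ℓ⁻¹ • (-(deriv Γ t) + ⟪deriv Γ t, r t⟫ • r t)) t

/-- The monodromy `M_ℓ : S² → S²` of the front track `Γ` over `[0, T]`: it sends `r 0` to `r T` for
every solution `r` of the bicycle equation. (Only its values on the unit sphere matter.) -/
def monodromy (Γ : ℝ → E3) (T ℓ : ℝ) (x : E3) : E3 :=
  Classical.epsilon fun y => ∃ r : ℝ → E3, IsBicycleMotion Γ ℓ r ∧ r 0 = x ∧ r T = y

/-- The map `M` of the unit sphere, with fixed point `x`, has the complex derivative `μ` at `x`: its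
differential `T_x S² → T_x S²` is the multiplication by `μ`, where `T_x S²` is a complex line in
which `i` acts as the rotation by 90 degrees `ξ ↦ x × ξ`. (Up to scaling, this is the complex
structure of the coordinate `(r₂ + i r₃) / (1 + r₁)` on the sphere.) -/
def HasSphereDeriv (M : E3 → E3) (x : E3) (μ : ℂ) : Prop :=
  ∃ A : E3 →L[ℝ] E3, HasFDerivWithinAt M A (Metric.sphere 0 1) x ∧
    ∀ ξ : E3, ⟪x, ξ⟫ = 0 → A ξ = μ.re • ξ + μ.im • cross x ξ

/-- `x` is an unstable fixed point of the `ℓ`-monodromy of `Γ`, and `μ`, of modulus greater than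
one, is the derivative there. -/
def IsUnstableFixedPoint (Γ : ℝ → E3) (T ℓ : ℝ) (x : E3) (μ : ℂ) : Prop :=
  ‖x‖ = 1 ∧ monodromy Γ T ℓ x = x ∧ HasSphereDeriv (monodromy Γ T ℓ) x μ ∧ 1 < ‖μ‖

/-- `F` is smooth on `[0, ℓ₀)`, and `F ℓ = ℓ ln λ(ℓ)` on `(0, ℓ₀)` for a branch of the logarithm of
the derivative `λ(ℓ)` of the `ℓ`-monodromy of `Γ` at an unstable fixed point. -/
structure IsSmoothLog (Γ : ℝ → E3) (T ℓ₀ : ℝ) (F : ℝ → ℂ) : Prop where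
  pos : 0 < ℓ₀
  smooth : ContDiffOn ℝ ∞ F (Ico 0 ℓ₀)
  exp_eq : ∀ ℓ ∈ Ioo 0 ℓ₀, ∃ x : E3, IsUnstableFixedPoint Γ T ℓ x (Complex.exp (F ℓ / (ℓ : ℂ)))

/-- The `n`-th Taylor coefficient at the left end point of a function on `[0, ℓ₀)`. -/
def taylorCoeff (ℓ₀ : ℝ) (F : ℝ → ℂ) (n : ℕ) : ℂ :=
  iteratedDerivWithin n F (Ico 0 ℓ₀) 0 / (n.factorial : ℂ)

/-- The two functions have the same Taylor coefficients at `0`, except that those of index `1` are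
only equal modulo `2πi` (another branch of `ln λ` changes `ℓ ln λ` by `2πi k ℓ`). -/
def SameTaylor (ℓ₁ : ℝ) (F₁ : ℝ → ℂ) (ℓ₂ : ℝ) (F₂ : ℝ → ℂ) : Prop :=
  (∀ n : ℕ, n ≠ 1 → taylorCoeff ℓ₁ F₁ n = taylorCoeff ℓ₂ F₂ n) ∧
    ∃ k : ℤ, taylorCoeff ℓ₁ F₁ 1 = taylorCoeff ℓ₂ F₂ 1 + 2 * Real.pi * Complex.I * k

/-- `Γ₁` and `Γ₂` are in `ℓ`-bicycle correspondence: the segment from `Γ₁ t` to `Γ₂ t` has the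
constant length `ℓ`, and the midpoint moves along this segment. -/
def BicycleCorrespondence (ℓ : ℝ) (Γ₁ Γ₂ : ℝ → E3) : Prop :=
  ∀ t, dist (Γ₁ t) (Γ₂ t) = ℓ ∧
    ∃ c : ℝ, deriv (fun s => midpoint ℝ (Γ₁ s) (Γ₂ s)) t = c • (Γ₁ t - Γ₂ t)

/-! ### Curvature, torsion, and differential polynomials in them -/

/-- The unit tangent vector. -/
def unitTangent (Γ : ℝ → E3) (t : ℝ) : E3 := ‖deriv Γ t‖⁻¹ • deriv Γ t

/-- The derivative with respect to the arc length of `Γ`. -/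
def arcDeriv (Γ : ℝ → E3) (f : ℝ → ℝ) (t : ℝ) : ℝ := ‖deriv Γ t‖⁻¹ * deriv f t

/-- `(v, n, b)` is a smooth Frenet frame along the closed curve `Γ`, with curvature `κ` and torsion
`τ`: the Frenet equations hold with respect to arc length. A curve without inflection points has
such a frame, with `κ` positive; points with `κ = 0` are not excluded. -/
structure IsFrenetFrame (Γ : ℝ → E3) (T : ℝ) (n b : ℝ → E3) (κ τ : ℝ → ℝ) : Prop where
  smooth_n : ContDiff ℝ ∞ n
  smooth_κ : ContDiff ℝ ∞ κ
  smooth_τ : ContDiff ℝ ∞ τ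
  periodic_n : Periodic n T
  norm_n : ∀ t, ‖n t‖ = 1
  orthogonal : ∀ t, ⟪unitTangent Γ t, n t⟫ = 0
  b_eq : ∀ t, b t = cross (unitTangent Γ t) (n t)
  deriv_v : ∀ t, deriv (unitTangent Γ) t = ‖deriv Γ t‖ • (κ t • n t)
  deriv_n : ∀ t, deriv n t = ‖deriv Γ t‖ • (-(κ t) • unitTangent Γ t + τ t • b t)
  deriv_b : ∀ t, deriv b t = ‖deriv Γ t‖ • (-(τ t) • n t)

/-- Polynomials over `ℂ` in the symbols `κ, κ', κ'', …` (left) and `τ, τ', τ'', …` (right). -/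
abbrev DiffPoly := MvPolynomial (ℕ ⊕ ℕ) ℂ

/-- The symbol of the `j`-th derivative of `κ`. -/
def symK (j : ℕ) : DiffPoly := MvPolynomial.X (Sum.inl j)

/-- The symbol of the `j`-th derivative of `τ`. -/
def symT (j : ℕ) : DiffPoly := MvPolynomial.X (Sum.inr j)

/-- The total derivative of a differential polynomial. -/
def totalDeriv : Derivation ℂ DiffPoly DiffPoly :=
  MvPolynomial.mkDerivation ℂ (Sum.elim (fun j => symK (j + 1)) (fun j => symT (j + 1)))

/-- The auxiliary differential polynomials: `Z₀ = 0` and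
`Zₙ₊₁ = Zₙ' + i τ Zₙ + (κ / 2) (δₙ₀ + ∑_{j ≤ n} Zⱼ Zₙ₋ⱼ)`. -/
def zPoly : ℕ → DiffPoly
  | 0 => 0
  | n + 1 =>
    totalDeriv (zPoly n) + MvPolynomial.C Complex.I * symT 0 * zPoly n +
      MvPolynomial.C (1 / 2) * symK 0 *
        ((if n = 0 then 1 else 0) + ∑ j : Fin (n + 1), zPoly j * zPoly (n - j))

/-- The densities of the monodromy integrals: `1`, `-i τ`, and `-κ Zₙ₋₁` for `n ≥ 2`. -/
def density : ℕ → DiffPoly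
  | 0 => 1
  | 1 => -(MvPolynomial.C Complex.I * symT 0)
  | n + 2 => -(symK 0 * zPoly (n + 1))

/-- The value at `t` of a differential polynomial in functions `κ`, `τ` along `Γ`, derivatives being
taken with respect to arc length. -/
def evalAlong (Γ : ℝ → E3) (κ τ : ℝ → ℝ) (P : DiffPoly) (t : ℝ) : ℂ :=
  MvPolynomial.aeval
    (Sum.elim (fun j => (((arcDeriv Γ)^[j] κ t : ℝ) : ℂ))
      (fun j => (((arcDeriv Γ)^[j] τ t : ℝ) : ℂ))) P

/-- The integral along the closed curve `Γ`, with respect to arc length. -/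
def integralAlong (Γ : ℝ → E3) (T : ℝ) (f : ℝ → ℂ) : ℂ :=
  ∫ t in (0 : ℝ)..T, (‖deriv Γ t‖ : ℂ) * f t

end Bicycle

end

/-!
The bicycle equation on the sphere is the projectivization of a linear equation for a spinor
`(a, b) ∈ ℂ²` (the Hopf map sends solutions to solutions), so the monodromy is a Möbius
transformation. A spinor that is multiplied by `m` after one period gives a fixed point, and, since
the linear equation is trace free, the derivative there is `m⁻²`; the fixed point is unstable
precisely if `|m| < 1`. Two such spinors are proportional, because their determinant is constant in
time while it is multiplied by a number of modulus less than one: there is at most one unstable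
fixed point (`IsUnstableFixedPoint.unique`).

*Bicycle correspondence.* If `Γ` and `Γ'` are in correspondence, an explicit Darboux transformation,
invertible for `2ℓ < d` and with coefficients that are periodic, maps the spinors of `Γ` to those of
`Γ'` and preserves the factor `m`
(`IsUnstableFixedPoint.exists_of_bicycleCorrespondence`).

*Existence.* Every closed curve has a smooth periodic moving frame adapted to the tangent
(`IsClosedSmoothCurve.exists_isMovingFrame`: project to the normal planes a constant vector outside
the cone of tangents, which has measure zero). In the stereographic coordinate given by the frame,
the bicycle equation is a Riccati equation
`z' = η p z - c₀ - c₁ z - c₂ z²`, with `η = ℓ⁻¹` and `p = |Γ'|`. If the real part of `η` is large, a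
contraction argument yields a periodic solution of modulus at most `1`; it depends holomorphically
on `η`. A periodic solution yields a fixed point of the monodromy, with derivative
`exp ∫ (η p - c₁ - 2 c₂ z)` (`IsMovingFrame.exists_isFloquet`), which is of modulus greater than
one.

*Smoothness.* The Riccati equation has a formal solution `∑ Zₙ ℓⁿ`, obtained recursively; for the
Frenet frame the recursion is that of the polynomials `zPoly`. Substituting a truncation leaves a
small remainder, and the maximum principle for periodic solutions of linear equations
(`norm_le_of_periodic`) shows that the formal solution is an asymptotic expansion of `z`, uniformly
in the sector `|η| ≤ 2 Re η` (`RiccatiData.IsFormalSol.exists_norm_sub_le`). So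
`ℓ ln λ(ℓ) = ∫ p - ℓ ∫ (c₁ + 2 c₂ z)` is holomorphic in a sector and has an asymptotic power series
there; by Cauchy's estimates the series may be differentiated term by term, which gives smoothness
up to `ℓ = 0` and identifies the Taylor coefficients (`contDiffOn_of_asymptotic`). Finally, two
smooth branches for the same multipliers differ by a multiple of `2πi ℓ`, by continuity
(`sameTaylor_of_exp_eq`).
-/

namespace Bicycle

/-! ### Linear differential equations -/

section LinearODE

variable {E : Type*} [NormedAddCommGroup E] [NormedSpace ℝ E]

/-- The terms of the Dyson series of the linear equation `y' = A y`, `y 0 = x`: the iterated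
integrals of the coefficient `A`. -/
noncomputable def dysonTerm (A : ℝ → E →L[ℝ] E) (x : E) : ℕ → ℝ → E
  | 0 => fun _ => x
  | n + 1 => fun t => ∫ s in (0 : ℝ)..t, A s (dysonTerm A x n s)

theorem continuous_dysonTerm [CompleteSpace E] {A : ℝ → E →L[ℝ] E} (hA : Continuous A) (x : E) :
    ∀ n, Continuous (dysonTerm A x n)
  | 0 => continuous_const
  | n + 1 => by
    have hc : Continuous fun s => A s (dysonTerm A x n s) :=
      hA.clm_apply (continuous_dysonTerm hA x n)
    exact intervalIntegral.continuous_primitive (fun a b => hc.intervalIntegrable a b) 0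

theorem hasDerivAt_dysonTerm_succ [CompleteSpace E] {A : ℝ → E →L[ℝ] E} (hA : Continuous A)
    (x : E) (n : ℕ) (t : ℝ) :
    HasDerivAt (dysonTerm A x (n + 1)) (A t (dysonTerm A x n t)) t := by
  have hc : Continuous fun s => A s (dysonTerm A x n s) :=
    hA.clm_apply (continuous_dysonTerm hA x n)
  exact intervalIntegral.integral_hasDerivAt_right (hc.intervalIntegrable _ _)
    (hc.stronglyMeasurableAtFilter _ _) hc.continuousAt

theorem norm_dysonTerm_le {A : ℝ → E →L[ℝ] E} {R M : ℝ}
    (hM : ∀ t ∈ Icc (-R) R, ‖A t‖ ≤ M) (hM0 : 0 ≤ M) (x : E) (n : ℕ) :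
    ∀ t ∈ Icc (-R) R, ‖dysonTerm A x n t‖ ≤ ‖x‖ * (M ^ n * |t| ^ n / n.factorial) := by
  induction n with
  | zero => intro t _; simp [dysonTerm]
  | succ n ih =>
    intro t ht
    have hsub : Set.uIoc (0 : ℝ) t ⊆ Icc (-R) R := by
      intro s hs
      rw [mem_uIoc] at hs
      constructor <;> rcases hs with hs | hs <;> linarith [ht.1, ht.2, hs.1, hs.2]
    have hint : IntervalIntegrable
        (fun s => M * (‖x‖ * (M ^ n * |s - 0| ^ n / n.factorial))) MeasureTheory.volume 0 t := by
      apply Continuous.intervalIntegrable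
      fun_prop
    have h1 := intervalIntegral.norm_integral_le_abs_of_norm_le (a := (0 : ℝ)) (b := t)
      (f := fun s => A s (dysonTerm A x n s))
      (g := fun s => M * (‖x‖ * (M ^ n * |s - 0| ^ n / n.factorial)))
      (μ := MeasureTheory.volume) ?_ hint
    · refine h1.trans (le_of_eq ?_)
      rw [intervalIntegral.abs_integral_eq_abs_integral_uIoc]
      have h2 : ∀ s : ℝ, M * (‖x‖ * (M ^ n * |s - 0| ^ n / n.factorial)) =
          (M * ‖x‖ * M ^ n / n.factorial) * |s - 0| ^ n := fun s => by ring
      simp_rw [h2]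
      rw [MeasureTheory.integral_const_mul, integral_pow_abs_sub_uIoc, abs_of_nonneg (by positivity),
        Nat.factorial_succ]
      push_cast
      have : (n.factorial : ℝ) ≠ 0 := by positivity
      field_simp
      simp [pow_succ, mul_comm, mul_left_comm]
      ring
    · refine (MeasureTheory.ae_restrict_iff' measurableSet_uIoc).2 (Filter.Eventually.of_forall ?_)
      intro s hs
      refine ((A s).le_opNorm _).trans ?_
      simpa using mul_le_mul (hM s (hsub hs)) (ih s (hsub hs)) (norm_nonneg _) hM0

/-- A linear differential equation with continuous coefficients has global solutions. -/
theorem exists_hasDerivAt_linear [CompleteSpace E] {A : ℝ → E →L[ℝ] E} (hA : Continuous A)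
    (x : E) : ∃ y : ℝ → E, y 0 = x ∧ ∀ t, HasDerivAt y (A t (y t)) t := by
  -- uniform bounds for the terms on a bounded interval
  have hbound : ∀ R : ℝ, 0 < R → ∃ u : ℕ → ℝ, Summable u ∧
      ∀ n, ∀ t ∈ Icc (-R) R, ‖dysonTerm A x n t‖ ≤ u n := by
    intro R hR
    obtain ⟨M, hM⟩ := isCompact_Icc.exists_bound_of_continuousOn (s := Icc (-R) R)
      hA.continuousOn
    have hM0 : 0 ≤ M := (norm_nonneg _).trans (hM 0 ⟨by linarith, by linarith⟩)
    refine ⟨fun n => ‖x‖ * ((M * R) ^ n / n.factorial),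
      (Real.summable_pow_div_factorial _).mul_left _, fun n t ht => ?_⟩
    refine (norm_dysonTerm_le hM hM0 x n t ht).trans ?_
    have : |t| ≤ R := abs_le.2 ht
    calc ‖x‖ * (M ^ n * |t| ^ n / n.factorial) ≤ ‖x‖ * (M ^ n * R ^ n / n.factorial) := by gcongr
      _ = ‖x‖ * ((M * R) ^ n / n.factorial) := by rw [mul_pow]
  have hsum : ∀ t, Summable fun n => dysonTerm A x n t := by
    intro t
    obtain ⟨u, hu, hb⟩ := hbound (|t| + 1) (by positivity)
    exact Summable.of_norm_bounded hu fun n => hb n t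
      ⟨by linarith [neg_abs_le t], by linarith [le_abs_self t]⟩
  refine ⟨fun t => ∑' n, dysonTerm A x n t, ?_, fun t => ?_⟩
  · change ∑' n, dysonTerm A x n 0 = x
    rw [tsum_eq_single 0]
    · rfl
    · intro n hn
      obtain ⟨k, rfl⟩ := Nat.exists_eq_succ_of_ne_zero hn
      simp [dysonTerm]
  · set R := |t| + 1 with hR
    have hR0 : 0 < R := by positivity
    obtain ⟨u, hu, hb⟩ := hbound R hR0
    obtain ⟨M, hM⟩ := isCompact_Icc.exists_bound_of_continuousOn (s := Icc (-R) R)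
      hA.continuousOn
    have htm : t ∈ Ioo (-R) R := by
      constructor <;> rw [hR] <;> linarith [neg_abs_le t, le_abs_self t]
    have hd := hasDerivAt_tsum_of_isPreconnected (u := fun n => M * u n)
      (g := fun n => dysonTerm A x (n + 1)) (g' := fun n s => A s (dysonTerm A x n s))
      (hu.mul_left M) (isOpen_Ioo (a := -R) (b := R)) isPreconnected_Ioo
      (fun n s _ => hasDerivAt_dysonTerm_succ hA x n s)
      (fun n s hs => ((A s).le_opNorm _).trans
        (mul_le_mul (hM s (Ioo_subset_Icc_self hs)) (hb n s (Ioo_subset_Icc_self hs))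
          (norm_nonneg _) ((norm_nonneg _).trans (hM s (Ioo_subset_Icc_self hs))))) htm
      ((summable_nat_add_iff 1).2 (hsum t)) htm
    have h1 : (fun s => ∑' n, dysonTerm A x n s) =
        fun s => x + ∑' n, dysonTerm A x (n + 1) s := by
      funext s
      rw [(hsum s).tsum_eq_zero_add]
      rfl
    rw [h1]
    have h2 : A t (x + ∑' n, dysonTerm A x (n + 1) t) = ∑' n, A t (dysonTerm A x n t) := by
      rw [← (A t).map_tsum (hsum t), (hsum t).tsum_eq_zero_add]
      rfl
    rw [h2]
    exact hd.const_add x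

/-- The solutions of a scalar homogeneous linear equation. -/
theorem eq_mul_exp_of_hasDerivAt {q y : ℝ → ℂ} (hq : Continuous q)
    (hy : ∀ t, HasDerivAt y (q t * y t) t) (t : ℝ) :
    y t = y 0 * Complex.exp (∫ s in (0 : ℝ)..t, q s) := by
  have hQ : ∀ t, HasDerivAt (fun t => ∫ s in (0 : ℝ)..t, q s) (q t) t := fun t =>
    intervalIntegral.integral_hasDerivAt_right (hq.intervalIntegrable _ _)
      (hq.stronglyMeasurableAtFilter _ _) hq.continuousAt
  have hd : ∀ t, HasDerivAt (fun t => y t * Complex.exp (-∫ s in (0 : ℝ)..t, q s)) 0 t := by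
    intro t
    refine ((hy t).mul (hQ t).neg.cexp).congr_deriv ?_
    ring
  have hconst := is_const_of_deriv_eq_zero (fun t => (hd t).differentiableAt)
    (fun t => (hd t).deriv) t 0
  simp only [intervalIntegral.integral_same, neg_zero, Complex.exp_zero, mul_one] at hconst
  rw [← hconst, mul_assoc, ← Complex.exp_add]
  simp

end LinearODE

/-! ### Spinors and the sphere -/

theorem inner_eq (x y : E3) : ⟪x, y⟫ = x 0 * y 0 + x 1 * y 1 + x 2 * y 2 := by
  simp [PiLp.inner_apply, Fin.sum_univ_three]
  ring

theorem cross_zero (x y : E3) : cross x y 0 = x 1 * y 2 - x 2 * y 1 := by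
  simp [cross, cross_apply]

theorem cross_one (x y : E3) : cross x y 1 = x 2 * y 0 - x 0 * y 2 := by
  simp [cross, cross_apply]

theorem cross_two (x y : E3) : cross x y 2 = x 0 * y 1 - x 1 * y 0 := by
  simp [cross, cross_apply]

theorem ext3 {x y : E3} (h0 : x 0 = y 0) (h1 : x 1 = y 1) (h2 : x 2 = y 2) : x = y := by
  ext i
  fin_cases i
  exacts [h0, h1, h2]

theorem hasDerivAt_iff_coord {f : ℝ → E3} {f' : E3} {t : ℝ} :
    HasDerivAt f f' t ↔ ∀ i, HasDerivAt (fun s => f s i) (f' i) t := by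
  simp only [hasDerivAt_iff_hasFDerivAt, ← hasFDerivWithinAt_univ]
  rw [hasFDerivWithinAt_euclidean]
  refine forall_congr' fun i => iff_of_eq ?_
  congr 1

theorem hasDerivAt_coord {f : ℝ → E3} {f' : E3} {t : ℝ} (h : HasDerivAt f f' t) (i : Fin 3) :
    HasDerivAt (fun s => f s i) (f' i) t := hasDerivAt_iff_coord.1 h i

theorem hasDerivAt_re {f : ℝ → ℂ} {f' : ℂ} {t : ℝ} (h : HasDerivAt f f' t) :
    HasDerivAt (fun s => (f s).re) f'.re t :=
  Complex.reCLM.hasFDerivAt.comp_hasDerivAt t h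

theorem hasDerivAt_im {f : ℝ → ℂ} {f' : ℂ} {t : ℝ} (h : HasDerivAt f f' t) :
    HasDerivAt (fun s => (f s).im) f'.im t :=
  Complex.imCLM.hasFDerivAt.comp_hasDerivAt t h

/-- First component of the product of the Pauli matrix `x₁ σ₁ + x₂ σ₂ + x₃ σ₃` and the spinor
`(a, b)`. -/
def pauliFst (x : E3) (a b : ℂ) : ℂ := x 2 * a + (x 0 - Complex.I * x 1) * b

/-- Second component of the product of the Pauli matrix `x₁ σ₁ + x₂ σ₂ + x₃ σ₃` and the spinor
`(a, b)`. -/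
def pauliSnd (x : E3) (a b : ℂ) : ℂ := (x 0 + Complex.I * x 1) * a - x 2 * b

/-- The determinant of two spinors. -/
def spinorDet (a b a' b' : ℂ) : ℂ := a * b' - b * a'

/-- The square of the norm of a spinor. -/
def spinorNormSq (a b : ℂ) : ℝ := a.re ^ 2 + a.im ^ 2 + (b.re ^ 2 + b.im ^ 2)

/-- The Hopf map: the point of the unit sphere given by a nonzero spinor, that is, the unit vector
`x` for which `(a, b)` is an eigenvector of the Pauli matrix of `x` with eigenvalue `1`. -/
noncomputable def hopf (a b : ℂ) : E3 :=
  !₂[2 * (a.re * b.re + a.im * b.im) / spinorNormSq a b,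
    2 * (a.re * b.im - a.im * b.re) / spinorNormSq a b,
    (a.re ^ 2 + a.im ^ 2 - (b.re ^ 2 + b.im ^ 2)) / spinorNormSq a b]

/-- The tangent vectors of the sphere at `hopf a b`, parametrized complex linearly by `w`: up to the
factor `2 / ‖(a, b)‖ ^ 4`, the image under the differential of the Hopf map of a spinor whose
determinant with `(a, b)` is `w`. -/
def hopfTangent (a b w : ℂ) : E3 :=
  !₂[(w * (starRingEnd ℂ a) ^ 2 - (starRingEnd ℂ w) * b ^ 2).re,
    (w * (starRingEnd ℂ a) ^ 2 - (starRingEnd ℂ w) * b ^ 2).im,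
    -2 * (w * starRingEnd ℂ a * starRingEnd ℂ b).re]

theorem spinorNormSq_pos {a b : ℂ} (h : a ≠ 0 ∨ b ≠ 0) : 0 < spinorNormSq a b := by
  have e : spinorNormSq a b = Complex.normSq a + Complex.normSq b := by
    simp [spinorNormSq, Complex.normSq_apply]; ring
  rw [e]
  rcases h with h | h
  · have := Complex.normSq_pos.2 h
    have := Complex.normSq_nonneg b
    linarith
  · have := Complex.normSq_pos.2 h
    have := Complex.normSq_nonneg a
    linarith

theorem hasDerivAt_hopf {a b : ℝ → ℂ} {a' b' : ℂ} {t : ℝ} (ha : HasDerivAt a a' t)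
    (hb : HasDerivAt b b' t) (h0 : a t ≠ 0 ∨ b t ≠ 0) :
    HasDerivAt (fun s => hopf (a s) (b s))
      ((2 / spinorNormSq (a t) (b t) ^ 2) •
        hopfTangent (a t) (b t) (spinorDet (a t) (b t) a' b')) t := by
  have hn : HasDerivAt (fun s => spinorNormSq (a s) (b s)) _ t :=
    (((hasDerivAt_re ha).pow 2).add ((hasDerivAt_im ha).pow 2)).add
      (((hasDerivAt_re hb).pow 2).add ((hasDerivAt_im hb).pow 2))
  have hne : spinorNormSq (a t) (b t) ≠ 0 := (spinorNormSq_pos h0).ne'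
  rw [hasDerivAt_iff_coord]
  intro i
  fin_cases i
  · refine ((((hasDerivAt_re ha).mul (hasDerivAt_re hb)).add
      ((hasDerivAt_im ha).mul (hasDerivAt_im hb))).const_mul 2 |>.div hn hne).congr_deriv ?_
    simp [hopfTangent, spinorDet, pow_two]
    field_simp
    simp only [spinorNormSq]
    ring
  · refine ((((hasDerivAt_re ha).mul (hasDerivAt_im hb)).sub
      ((hasDerivAt_im ha).mul (hasDerivAt_re hb))).const_mul 2 |>.div hn hne).congr_deriv ?_
    simp [hopfTangent, spinorDet, pow_two]
    field_simp
    simp only [spinorNormSq]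
    ring
  · refine ((((hasDerivAt_re ha).pow 2).add ((hasDerivAt_im ha).pow 2)).sub
      (((hasDerivAt_re hb).pow 2).add ((hasDerivAt_im hb).pow 2)) |>.div hn hne).congr_deriv ?_
    simp [hopfTangent, spinorDet, pow_two]
    field_simp
    simp only [spinorNormSq]
    ring

theorem hopfTangent_pauli {a b : ℂ} (h0 : a ≠ 0 ∨ b ≠ 0) (x : E3) :
    hopfTangent a b (spinorDet a b (pauliFst x a b) (pauliSnd x a b)) =
      spinorNormSq a b ^ 2 • (x - ⟪x, hopf a b⟫ • hopf a b) := by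
  have hne : spinorNormSq a b ≠ 0 := (spinorNormSq_pos h0).ne'
  rw [inner_eq]
  apply ext3 <;>
  · simp [hopfTangent, spinorDet, pauliFst, pauliSnd, hopf, pow_two]
    field_simp
    simp only [spinorNormSq]
    ring

theorem hopfTangent_mul (a b w m : ℂ) :
    hopfTangent (m * a) (m * b) w = hopfTangent a b ((starRingEnd ℂ m) ^ 2 * w) := by
  apply ext3 <;> simp [hopfTangent, pow_two] <;> ring

theorem hopfTangent_ofReal_mul (a b w : ℂ) (c : ℝ) :
    hopfTangent a b (c * w) = c • hopfTangent a b w := by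
  apply ext3 <;> simp [hopfTangent, pow_two] <;> ring

theorem hopfTangent_add (a b w w' : ℂ) :
    hopfTangent a b (w + w') = hopfTangent a b w + hopfTangent a b w' := by
  apply ext3 <;> simp [hopfTangent, pow_two] <;> ring

theorem cross_hopfTangent {a b : ℂ} (h0 : a ≠ 0 ∨ b ≠ 0) (w : ℂ) :
    cross (hopf a b) (hopfTangent a b w) = hopfTangent a b (Complex.I * w) := by
  have hne : spinorNormSq a b ≠ 0 := (spinorNormSq_pos h0).ne'
  apply ext3 <;>
  · simp [cross_zero, cross_one, cross_two, hopfTangent, hopf, pow_two]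
    field_simp
    simp only [spinorNormSq]
    ring

theorem norm_hopf {a b : ℂ} (h0 : a ≠ 0 ∨ b ≠ 0) : ‖hopf a b‖ = 1 := by
  have hne : spinorNormSq a b ≠ 0 := (spinorNormSq_pos h0).ne'
  have : ‖hopf a b‖ ^ 2 = 1 := by
    rw [← real_inner_self_eq_norm_sq, inner_eq]
    simp [hopf]
    field_simp
    simp only [spinorNormSq]
    ring
  exact (pow_eq_one_iff_of_nonneg (norm_nonneg _) two_ne_zero).1 this

theorem hopf_mul {m a b : ℂ} (hm : m ≠ 0) : hopf (m * a) (m * b) = hopf a b := by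
  have hm' : m.re ^ 2 + m.im ^ 2 ≠ 0 := by
    have := Complex.normSq_pos.2 hm
    rw [Complex.normSq_apply] at this
    nlinarith
  have e : spinorNormSq (m * a) (m * b) = (m.re ^ 2 + m.im ^ 2) * spinorNormSq a b := by
    simp [spinorNormSq]; ring
  apply ext3 <;>
  · simp only [hopf, e]
    simp
    rw [← mul_div_mul_left _ (spinorNormSq a b) hm']
    congr 1
    ring

/-- `(a, b)` is a spinor of the unit vector `x`: a nonzero eigenvector of the Pauli matrix of `x`
with eigenvalue `1`. -/
structure IsSpinorOf (x : E3) (a b : ℂ) : Prop where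
  ne_zero : a ≠ 0 ∨ b ≠ 0
  fst : pauliFst x a b = a
  snd : pauliSnd x a b = b

theorem IsSpinorOf.hopf_eq {x : E3} {a b : ℂ} (h : IsSpinorOf x a b) : hopf a b = x := by
  have hne : spinorNormSq a b ≠ 0 := (spinorNormSq_pos h.ne_zero).ne'
  have h1 := congrArg Complex.re h.fst
  have h2 := congrArg Complex.im h.fst
  have h3 := congrArg Complex.re h.snd
  have h4 := congrArg Complex.im h.snd
  simp [pauliFst, pauliSnd] at h1 h2 h3 h4
  apply ext3
  · simp [hopf]
    rw [div_eq_iff hne]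
    simp only [spinorNormSq]
    linear_combination -b.re * h1 - b.im * h2 - a.re * h3 - a.im * h4
  · simp [hopf]
    rw [div_eq_iff hne]
    simp only [spinorNormSq]
    linear_combination -b.im * h1 + b.re * h2 + a.im * h3 - a.re * h4
  · simp [hopf]
    rw [div_eq_iff hne]
    simp only [spinorNormSq]
    linear_combination -a.re * h1 - a.im * h2 + b.re * h3 + b.im * h4

theorem isSpinorOf_hopf {a b : ℂ} (h0 : a ≠ 0 ∨ b ≠ 0) : IsSpinorOf (hopf a b) a b := by
  have hne : spinorNormSq a b ≠ 0 := (spinorNormSq_pos h0).ne'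
  refine ⟨h0, ?_, ?_⟩ <;>
  · apply Complex.ext <;>
    · simp [pauliFst, pauliSnd, hopf, -Complex.ofReal_pow]
      field_simp
      simp only [spinorNormSq]
      ring

theorem sq_coord_of_norm_eq_one {x : E3} (h : ‖x‖ = 1) : x 0 ^ 2 + x 1 ^ 2 + x 2 ^ 2 = 1 := by
  have := real_inner_self_eq_norm_sq x
  rw [inner_eq, h] at this
  linarith

/-- The matrix `1 + x ⬝ σ` projects spinors to spinors of the unit vector `x`. -/
theorem isSpinorOf_add_pauli {x : E3} (hx : ‖x‖ = 1) {a b : ℂ}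
    (h : a + pauliFst x a b ≠ 0 ∨ b + pauliSnd x a b ≠ 0) :
    IsSpinorOf x (a + pauliFst x a b) (b + pauliSnd x a b) := by
  have h1 : (x 0 : ℂ) ^ 2 + (x 1 : ℂ) ^ 2 + (x 2 : ℂ) ^ 2 = 1 := by
    have := congrArg (fun r : ℝ => (r : ℂ)) (sq_coord_of_norm_eq_one hx)
    simpa using this
  refine ⟨h, ?_, ?_⟩
  · simp only [pauliFst, pauliSnd]
    linear_combination a * h1 - a * (x 1) ^ 2 * Complex.I_sq
  · simp only [pauliFst, pauliSnd]
    linear_combination b * h1 - b * (x 1) ^ 2 * Complex.I_sq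

theorem exists_isSpinorOf {x : E3} (hx : ‖x‖ = 1) : ∃ a b, IsSpinorOf x a b := by
  by_cases h : (1 : ℂ) + pauliFst x 1 0 ≠ 0 ∨ (0 : ℂ) + pauliSnd x 1 0 ≠ 0
  · exact ⟨_, _, isSpinorOf_add_pauli hx h⟩
  · refine ⟨_, _, isSpinorOf_add_pauli hx (a := 0) (b := 1) (Or.inr ?_)⟩
    push Not at h
    have h1 := h.1
    simp only [pauliFst, pauliSnd] at h1 ⊢
    intro h2
    have : (2 : ℂ) = 0 := by linear_combination h1 + h2
    norm_num at this

theorem spinorDet_eq_zero_of_isSpinorOf {x : E3} (hx : ‖x‖ = 1) {a b a' b' : ℂ}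
    (h : IsSpinorOf x a b) (h' : IsSpinorOf x a' b') : spinorDet a b a' b' = 0 := by
  have h1 : (x 0 : ℂ) ^ 2 + (x 1 : ℂ) ^ 2 + (x 2 : ℂ) ^ 2 = 1 := by
    have := congrArg (fun r : ℝ => (r : ℂ)) (sq_coord_of_norm_eq_one hx)
    simpa using this
  have h2 : spinorDet (pauliFst x a b) (pauliSnd x a b) (pauliFst x a' b') (pauliSnd x a' b') =
      -spinorDet a b a' b' := by
    simp only [spinorDet, pauliFst, pauliSnd]
    linear_combination (-(a * b' - b * a')) * h1 + (a * b' - b * a') * (x 1) ^ 2 * Complex.I_sq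
  rw [h.fst, h.snd, h'.fst, h'.snd] at h2
  linear_combination h2 / 2

theorem exists_mul_of_spinorDet_eq_zero {a b a' b' : ℂ} (h : a ≠ 0 ∨ b ≠ 0)
    (hW : spinorDet a b a' b' = 0) : ∃ m, a' = m * a ∧ b' = m * b := by
  simp only [spinorDet] at hW
  rcases h with h | h
  · refine ⟨a' / a, by field_simp, ?_⟩
    field_simp
    linear_combination hW
  · refine ⟨b' / b, ?_, by field_simp⟩
    field_simp
    linear_combination -hW

theorem hopf_eq_of_spinorDet_eq_zero {a b a' b' : ℂ} (h : a ≠ 0 ∨ b ≠ 0) (h' : a' ≠ 0 ∨ b' ≠ 0)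
    (hW : spinorDet a b a' b' = 0) : hopf a' b' = hopf a b := by
  obtain ⟨m, rfl, rfl⟩ := exists_mul_of_spinorDet_eq_zero h hW
  refine hopf_mul ?_
  rintro rfl
  simp at h'

/-! ### The spinor form of the bicycle equation -/

/-- The spinor `(a, b)` solves the linear equation `ψ' = -(2ℓ)⁻¹ (v ⬝ σ) ψ` with `v = Γ'`, which the
Hopf map takes to the bicycle equation. -/
def IsSpinorMotion (Γ : ℝ → E3) (ℓ : ℝ) (a b : ℝ → ℂ) : Prop :=
  ∀ t, HasDerivAt a (-(2 * ℓ : ℂ)⁻¹ * pauliFst (deriv Γ t) (a t) (b t)) t ∧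
    HasDerivAt b (-(2 * ℓ : ℂ)⁻¹ * pauliSnd (deriv Γ t) (a t) (b t)) t

/-- The Pauli matrix of `x`, as a continuous real linear map, depends continuously and linearly
on `x`. -/
noncomputable def pauliCLM (x : E3) : (ℂ × ℂ) →L[ℝ] (ℂ × ℂ) :=
  LinearMap.toContinuousLinearMap
    { toFun := fun p => (pauliFst x p.1 p.2, pauliSnd x p.1 p.2)
      map_add' := fun p q => by
        ext <;> simp only [pauliFst, pauliSnd, Prod.fst_add, Prod.snd_add] <;> ring
      map_smul' := fun c p => by
        ext <;> simp only [pauliFst, pauliSnd, Prod.smul_fst, Prod.smul_snd, RingHom.id_apply,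
          Complex.real_smul] <;> ring }

theorem pauliCLM_apply (x : E3) (p : ℂ × ℂ) :
    pauliCLM x p = (pauliFst x p.1 p.2, pauliSnd x p.1 p.2) := rfl

theorem continuous_pauliCLM : Continuous pauliCLM := by
  refine continuous_clm_apply.2 fun p => ?_
  have h : ∀ i : Fin 3, Continuous fun x : E3 => ((x i : ℝ) : ℂ) := fun i =>
    Complex.continuous_ofReal.comp (EuclideanSpace.proj (𝕜 := ℝ) i).continuous
  simp only [pauliCLM_apply, pauliFst, pauliSnd]
  have h0 := h 0
  have h1 := h 1
  have h2 := h 2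
  fun_prop

variable {Γ : ℝ → E3} {T ℓ : ℝ}

theorem IsClosedSmoothCurve.contDiff_deriv (hΓ : IsClosedSmoothCurve Γ T) :
    ContDiff ℝ ∞ (deriv Γ) :=
  (contDiff_infty_iff_deriv.1 hΓ.smooth).2

theorem IsClosedSmoothCurve.hasDerivAt (hΓ : IsClosedSmoothCurve Γ T) (t : ℝ) :
    HasDerivAt Γ (deriv Γ t) t :=
  ((contDiff_infty_iff_deriv.1 hΓ.smooth).1 t).hasDerivAt

theorem IsClosedSmoothCurve.deriv_periodic (hΓ : IsClosedSmoothCurve Γ T) :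
    Periodic (deriv Γ) T := fun t => by
  rw [← deriv_comp_add_const]
  congr 1
  exact funext hΓ.periodic

theorem exists_isSpinorMotion (hv : Continuous (deriv Γ)) (ℓ : ℝ) (a₀ b₀ : ℂ) :
    ∃ a b, IsSpinorMotion Γ ℓ a b ∧ a 0 = a₀ ∧ b 0 = b₀ := by
  obtain ⟨y, hy0, hy⟩ := exists_hasDerivAt_linear
    (A := fun t => (-(2 * ℓ)⁻¹ : ℝ) • pauliCLM (deriv Γ t))
    (by have := continuous_pauliCLM.comp hv; exact this.const_smul (-(2 * ℓ)⁻¹ : ℝ)) (a₀, b₀)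
  refine ⟨fun t => (y t).1, fun t => (y t).2, fun t => ⟨?_, ?_⟩, by simp [hy0], by simp [hy0]⟩
  · refine ((ContinuousLinearMap.fst ℝ ℂ ℂ).hasFDerivAt.comp_hasDerivAt t (hy t)).congr_deriv ?_
    simp [pauliCLM_apply]
  · refine ((ContinuousLinearMap.snd ℝ ℂ ℂ).hasFDerivAt.comp_hasDerivAt t (hy t)).congr_deriv ?_
    simp [pauliCLM_apply]

/-- The Wronskian of two spinor motions is constant, as Pauli matrices have trace zero. -/
theorem IsSpinorMotion.spinorDet_eq {a b a' b' : ℝ → ℂ} (h : IsSpinorMotion Γ ℓ a b)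
    (h' : IsSpinorMotion Γ ℓ a' b') (t : ℝ) :
    spinorDet (a t) (b t) (a' t) (b' t) = spinorDet (a 0) (b 0) (a' 0) (b' 0) := by
  have hd : ∀ t, HasDerivAt (fun t => spinorDet (a t) (b t) (a' t) (b' t)) 0 t := by
    intro t
    refine (((h t).1.mul (h' t).2).sub ((h t).2.mul (h' t).1)).congr_deriv ?_
    simp only [pauliFst, pauliSnd]
    ring
  exact is_const_of_deriv_eq_zero (fun t => (hd t).differentiableAt) (fun t => (hd t).deriv) t 0

theorem IsSpinorMotion.ne_zero (hv : Continuous (deriv Γ)) {a b : ℝ → ℂ}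
    (h : IsSpinorMotion Γ ℓ a b) (h0 : a 0 ≠ 0 ∨ b 0 ≠ 0) (t : ℝ) : a t ≠ 0 ∨ b t ≠ 0 := by
  by_contra! hc
  obtain ⟨a₁, b₁, h₁, e₁, e₁'⟩ := exists_isSpinorMotion hv ℓ 1 0
  obtain ⟨a₂, b₂, h₂, e₂, e₂'⟩ := exists_isSpinorMotion hv ℓ 0 1
  have w₁ := h.spinorDet_eq h₁ t
  have w₂ := h.spinorDet_eq h₂ t
  simp [spinorDet, hc.1, hc.2, e₁, e₁', e₂, e₂'] at w₁ w₂
  rcases h0 with h0 | h0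
  · exact h0 w₂.symm
  · exact h0 w₁

/-- The direction field of a spinor motion is a bicycle motion. -/
theorem IsSpinorMotion.isBicycleMotion (hv : Continuous (deriv Γ)) {a b : ℝ → ℂ}
    (h : IsSpinorMotion Γ ℓ a b) (h0 : a 0 ≠ 0 ∨ b 0 ≠ 0) :
    IsBicycleMotion Γ ℓ fun t => hopf (a t) (b t) := by
  intro t
  have hne := h.ne_zero hv h0 t
  refine ⟨norm_hopf hne, (hasDerivAt_hopf (h t).1 (h t).2 hne).congr_deriv ?_⟩
  have e : spinorDet (a t) (b t) (-(2 * ℓ : ℂ)⁻¹ * pauliFst (deriv Γ t) (a t) (b t))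
      (-(2 * ℓ : ℂ)⁻¹ * pauliSnd (deriv Γ t) (a t) (b t)) =
      ((-(2 * ℓ)⁻¹ : ℝ) : ℂ) * spinorDet (a t) (b t) (pauliFst (deriv Γ t) (a t) (b t))
        (pauliSnd (deriv Γ t) (a t) (b t)) := by
    simp only [spinorDet]; push_cast; ring
  have hn := (spinorNormSq_pos hne).ne'
  rw [e, hopfTangent_ofReal_mul, hopfTangent_pauli hne, smul_smul, smul_smul]
  have e2 : 2 / spinorNormSq (a t) (b t) ^ 2 * (-(2 * ℓ)⁻¹ * spinorNormSq (a t) (b t) ^ 2) =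
      -ℓ⁻¹ := by
    rw [mul_inv]
    field_simp
  rw [mul_assoc, e2]
  module

/-- Bicycle motions are determined by their initial direction: for two of them,
`1 - r ⬝ r'` satisfies a homogeneous linear equation. -/
theorem IsBicycleMotion.eq_of_eq (hv : Continuous (deriv Γ)) {r r' : ℝ → E3}
    (h : IsBicycleMotion Γ ℓ r) (h' : IsBicycleMotion Γ ℓ r') (h0 : r 0 = r' 0) : r = r' := by
  have hr : Continuous r := continuous_iff_continuousAt.2 fun t => (h t).2.continuousAt
  have hr' : Continuous r' := continuous_iff_continuousAt.2 fun t => (h' t).2.continuousAt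
  have hd : ∀ t, HasDerivAt (fun t => ((1 - ⟪r t, r' t⟫ : ℝ) : ℂ))
      (((ℓ⁻¹ * ⟪deriv Γ t, r t + r' t⟫ : ℝ) : ℂ) * ((1 - ⟪r t, r' t⟫ : ℝ) : ℂ)) t := by
    intro t
    refine (((h t).2.inner ℝ (h' t).2).const_sub 1).ofReal_comp.congr_deriv ?_
    rw [← Complex.ofReal_mul]
    congr 1
    simp only [inner_smul_left, inner_smul_right, inner_add_left, inner_add_right, inner_neg_left,
      inner_neg_right, RCLike.conj_to_real, real_inner_comm (deriv Γ t)]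
    ring
  have hq : Continuous fun t => ((ℓ⁻¹ * ⟪deriv Γ t, r t + r' t⟫ : ℝ) : ℂ) := by
    fun_prop
  funext t
  have h1 := eq_mul_exp_of_hasDerivAt hq hd t
  have h2 : ⟪r 0, r' 0⟫ = 1 := by
    rw [← h0, real_inner_self_eq_norm_sq, (h 0).1, one_pow]
  rw [h2] at h1
  simp only [sub_self, Complex.ofReal_zero, zero_mul, Complex.ofReal_eq_zero] at h1
  exact (inner_eq_one_iff_of_norm_eq_one (𝕜 := ℝ) (h t).1 (h' t).1).1 (by linarith)

theorem monodromy_eq (hv : Continuous (deriv Γ)) {r : ℝ → E3} (h : IsBicycleMotion Γ ℓ r) :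
    monodromy Γ T ℓ (r 0) = r T := by
  have hex : ∃ y, ∃ r' : ℝ → E3, IsBicycleMotion Γ ℓ r' ∧ r' 0 = r 0 ∧ r' T = y :=
    ⟨_, r, h, rfl, rfl⟩
  obtain ⟨r', hr', h0, hT⟩ := Classical.epsilon_spec hex
  have e := h.eq_of_eq hv hr' h0.symm
  subst e
  exact hT.symm

theorem monodromy_eq_hopf (hv : Continuous (deriv Γ)) {x : E3} {a b : ℝ → ℂ}
    (h : IsSpinorMotion Γ ℓ a b) (hx : IsSpinorOf x (a 0) (b 0)) :
    monodromy Γ T ℓ x = hopf (a T) (b T) := by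
  have := monodromy_eq (T := T) hv (h.isBicycleMotion hv hx.ne_zero)
  simpa only [hx.hopf_eq] using this

theorem IsSpinorMotion.lincomb {a b a' b' : ℝ → ℂ} (h : IsSpinorMotion Γ ℓ a b)
    (h' : IsSpinorMotion Γ ℓ a' b') (c c' : ℂ) :
    IsSpinorMotion Γ ℓ (fun t => c * a t + c' * a' t) (fun t => c * b t + c' * b' t) := by
  intro t
  refine ⟨(((h t).1.const_mul c).add ((h' t).1.const_mul c')).congr_deriv ?_,
    (((h t).2.const_mul c).add ((h' t).2.const_mul c')).congr_deriv ?_⟩ <;>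
  · simp only [pauliFst, pauliSnd]
    ring

/-- A spinor motion is *of Floquet type* with multiplier `m` over the period `T`. -/
structure IsFloquet (Γ : ℝ → E3) (T ℓ : ℝ) (a b : ℝ → ℂ) (m : ℂ) : Prop where
  motion : IsSpinorMotion Γ ℓ a b
  ne_zero : a 0 ≠ 0 ∨ b 0 ≠ 0
  fst : a T = m * a 0
  snd : b T = m * b 0

theorem IsFloquet.multiplier_ne_zero (hv : Continuous (deriv Γ)) {a b : ℝ → ℂ} {m : ℂ}
    (h : IsFloquet Γ T ℓ a b m) : m ≠ 0 := by
  rintro rfl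
  have := h.motion.ne_zero hv h.ne_zero T
  simp [h.fst, h.snd] at this

theorem differentiableAt_hopf_comp {a b : E3 → ℂ} {x : E3} (ha : DifferentiableAt ℝ a x)
    (hb : DifferentiableAt ℝ b x) (h0 : a x ≠ 0 ∨ b x ≠ 0) :
    DifferentiableAt ℝ (fun y => hopf (a y) (b y)) x := by
  have h1 : DifferentiableAt ℝ (fun y => (a y).re) x :=
    Complex.reCLM.differentiableAt.comp x ha
  have h2 : DifferentiableAt ℝ (fun y => (a y).im) x :=
    Complex.imCLM.differentiableAt.comp x ha
  have h3 : DifferentiableAt ℝ (fun y => (b y).re) x :=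
    Complex.reCLM.differentiableAt.comp x hb
  have h4 : DifferentiableAt ℝ (fun y => (b y).im) x :=
    Complex.imCLM.differentiableAt.comp x hb
  have hn : spinorNormSq (a x) (b x) ≠ 0 := (spinorNormSq_pos h0).ne'
  simp only [spinorNormSq] at hn
  rw [differentiableAt_euclidean]
  intro i
  fin_cases i <;>
  · simp only [hopf, spinorNormSq]
    simp
    fun_prop (disch := exact hn)

/-- A Floquet spinor motion with multiplier `m` gives a fixed point of the monodromy, with
derivative `m⁻²`: near the fixed point `x = hopf ψ` the monodromy is `y ↦ hopf (Φ (1 + y ⬝ σ) ψ)`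
with a linear map `Φ` of determinant `1` such that `Φ ψ = m ψ`. -/
theorem IsFloquet.hasSphereDeriv (hv : Continuous (deriv Γ)) {a b : ℝ → ℂ} {m : ℂ}
    (h : IsFloquet Γ T ℓ a b m) :
    HasSphereDeriv (monodromy Γ T ℓ) (hopf (a 0) (b 0)) (m ^ 2)⁻¹ := by
  obtain ⟨a₁, b₁, h₁, e₁, e₁'⟩ := exists_isSpinorMotion hv ℓ 1 0
  obtain ⟨a₂, b₂, h₂, e₂, e₂'⟩ := exists_isSpinorMotion hv ℓ 0 1
  have hm := h.multiplier_ne_zero hv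
  set x := hopf (a 0) (b 0) with hx
  have hxs : IsSpinorOf x (a 0) (b 0) := isSpinorOf_hopf h.ne_zero
  -- the projection of `ψ` to the spinors of `y`, and its image under the spinor flow
  set P : E3 → ℂ := fun y => a 0 + pauliFst y (a 0) (b 0) with hP
  set Q : E3 → ℂ := fun y => b 0 + pauliSnd y (a 0) (b 0) with hQ
  set A : E3 → ℂ := fun y => P y * a₁ T + Q y * a₂ T with hA
  set B : E3 → ℂ := fun y => P y * b₁ T + Q y * b₂ T with hB
  have hcoord : ∀ i : Fin 3, Differentiable ℝ fun y : E3 => ((y i : ℝ) : ℂ) := fun i =>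
    Complex.ofRealCLM.differentiable.comp (EuclideanSpace.proj (𝕜 := ℝ) i).differentiable
  have hPd : Differentiable ℝ P := by
    have h0 := hcoord 0
    have h1 := hcoord 1
    have h2 := hcoord 2
    simp only [hP, pauliFst]
    fun_prop
  have hQd : Differentiable ℝ Q := by
    have h0 := hcoord 0
    have h1 := hcoord 1
    have h2 := hcoord 2
    simp only [hQ, pauliSnd]
    fun_prop
  have hAd : Differentiable ℝ A := by fun_prop
  have hBd : Differentiable ℝ B := by fun_prop
  have hPx : P x = 2 * a 0 := by simp only [hP, hxs.fst]; ring
  have hQx : Q x = 2 * b 0 := by simp only [hQ, hxs.snd]; ring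
  have hflow : ∀ p q : ℂ, p ≠ 0 ∨ q ≠ 0 →
      p * a₁ T + q * a₂ T ≠ 0 ∨ p * b₁ T + q * b₂ T ≠ 0 := fun p q hpq =>
    (h₁.lincomb h₂ p q).ne_zero hv (by simpa [e₁, e₁', e₂, e₂'] using hpq) T
  have hmono : ∀ y : E3, ‖y‖ = 1 → P y ≠ 0 ∨ Q y ≠ 0 →
      monodromy Γ T ℓ y = hopf (A y) (B y) := by
    intro y hy hne
    refine monodromy_eq_hopf hv (h₁.lincomb h₂ (P y) (Q y)) ?_
    simp only [e₁, e₁', e₂, e₂', mul_one, mul_zero, add_zero, zero_add]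
    exact isSpinorOf_add_pauli hy hne
  have hPQx : P x ≠ 0 ∨ Q x ≠ 0 := by
    rw [hPx, hQx]
    simpa using h.ne_zero
  have hABx : A x ≠ 0 ∨ B x ≠ 0 := hflow _ _ hPQx
  -- the monodromy agrees with the explicit map near `x`
  have hev : ∀ᶠ y in nhdsWithin x (Metric.sphere (0 : E3) 1),
      monodromy Γ T ℓ y = hopf (A y) (B y) := by
    have hopen : ∀ᶠ y in nhds x, P y ≠ 0 ∨ Q y ≠ 0 := by
      rcases hPQx with h0 | h0
      · exact (hPd.continuous.continuousAt.eventually_ne h0).mono fun y hy => Or.inl hy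
      · exact (hQd.continuous.continuousAt.eventually_ne h0).mono fun y hy => Or.inr hy
    filter_upwards [hopen.filter_mono nhdsWithin_le_nhds, self_mem_nhdsWithin] with y h1 h2
    exact hmono y (by simpa using h2) h1
  have hfd := (differentiableAt_hopf_comp (hAd x) (hBd x) hABx).hasFDerivAt
  refine ⟨_, hfd.hasFDerivWithinAt.congr_of_eventuallyEq hev
    (hmono x (norm_hopf h.ne_zero) hPQx), fun ξ hξ => ?_⟩
  -- the differential along `ξ`, through the derivative of the Hopf map
  have hline : HasDerivAt (fun s : ℝ => x + s • ξ) ξ 0 := by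
    simpa using ((hasDerivAt_id (0 : ℝ)).smul_const ξ).const_add x
  have hPl : HasDerivAt (fun s : ℝ => P (x + s • ξ)) (pauliFst ξ (a 0) (b 0)) 0 := by
    have e : (fun s : ℝ => P (x + s • ξ)) =
        fun s : ℝ => P x + (s : ℂ) * pauliFst ξ (a 0) (b 0) := by
      funext s
      simp [hP, pauliFst]
      ring
    rw [e]
    simpa using ((Complex.ofRealCLM.hasDerivAt (x := (0 : ℝ))).mul_const
      (pauliFst ξ (a 0) (b 0))).const_add (P x)
  have hQl : HasDerivAt (fun s : ℝ => Q (x + s • ξ)) (pauliSnd ξ (a 0) (b 0)) 0 := by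
    have e : (fun s : ℝ => Q (x + s • ξ)) =
        fun s : ℝ => Q x + (s : ℂ) * pauliSnd ξ (a 0) (b 0) := by
      funext s
      simp [hQ, pauliSnd]
      ring
    rw [e]
    simpa using ((Complex.ofRealCLM.hasDerivAt (x := (0 : ℝ))).mul_const
      (pauliSnd ξ (a 0) (b 0))).const_add (Q x)
  have hx0 : x + (0 : ℝ) • ξ = x := by simp
  have hd1 := hasDerivAt_hopf ((hPl.mul_const (a₁ T)).add (hQl.mul_const (a₂ T)))
    ((hPl.mul_const (b₁ T)).add (hQl.mul_const (b₂ T))) (by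
      simp only [Pi.add_apply, hx0]
      exact hABx)
  have hd2 := hfd.comp_hasDerivAt_of_eq (0 : ℝ) hline hx0.symm
  have hval := hd2.unique hd1
  rw [hval]
  simp only [Pi.add_apply, hx0]
  -- the determinant of the spinor flow is `1`
  have hdet : spinorDet (a₁ T) (b₁ T) (a₂ T) (b₂ T) = 1 := by
    rw [h₁.spinorDet_eq h₂, e₁, e₁', e₂, e₂']; simp [spinorDet]
  have hψT : a T = a 0 * a₁ T + b 0 * a₂ T ∧ b T = a 0 * b₁ T + b 0 * b₂ T := by
    have w₁ := h.motion.spinorDet_eq h₁ T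
    have w₂ := h.motion.spinorDet_eq h₂ T
    rw [e₁, e₁'] at w₁
    rw [e₂, e₂'] at w₂
    simp only [spinorDet] at hdet w₁ w₂
    constructor
    · linear_combination -a T * hdet + a₁ T * w₂ - a₂ T * w₁
    · linear_combination -b T * hdet + b₁ T * w₂ - b₂ T * w₁
  have hAx : P x * a₁ T + Q x * a₂ T = 2 * m * a 0 := by
    rw [hPx, hQx]; linear_combination -2 * hψT.1 + 2 * h.fst
  have hBx : P x * b₁ T + Q x * b₂ T = 2 * m * b 0 := by
    rw [hPx, hQx]; linear_combination -2 * hψT.2 + 2 * h.snd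
  set W := spinorDet (a 0) (b 0) (pauliFst ξ (a 0) (b 0)) (pauliSnd ξ (a 0) (b 0)) with hW
  have hdetW : spinorDet (2 * m * a 0) (2 * m * b 0)
      (pauliFst ξ (a 0) (b 0) * a₁ T + pauliSnd ξ (a 0) (b 0) * a₂ T)
      (pauliFst ξ (a 0) (b 0) * b₁ T + pauliSnd ξ (a 0) (b 0) * b₂ T) = 2 * W := by
    rw [← hAx, ← hBx, hPx, hQx]
    simp only [hW, spinorDet] at hdet ⊢
    linear_combination 2 * (a 0 * pauliSnd ξ (a 0) (b 0) - b 0 * pauliFst ξ (a 0) (b 0)) * hdet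
  have hKW : hopfTangent (a 0) (b 0) W = spinorNormSq (a 0) (b 0) ^ 2 • ξ := by
    rw [hW, hopfTangent_pauli h.ne_zero, real_inner_comm, ← hx, hξ]
    simp
  have hn : spinorNormSq (a 0) (b 0) ≠ 0 := (spinorNormSq_pos h.ne_zero).ne'
  have hmn : Complex.normSq m ≠ 0 := (Complex.normSq_pos.2 hm).ne'
  have hnm : spinorNormSq (2 * m * a 0) (2 * m * b 0) =
      4 * Complex.normSq m * spinorNormSq (a 0) (b 0) := by
    simp [spinorNormSq, Complex.normSq_apply]; ring
  rw [hAx, hBx, hdetW, hnm, hopfTangent_mul]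
  have hμ : (starRingEnd ℂ (2 * m)) ^ 2 * (2 * W) =
      ((8 * Complex.normSq m ^ 2 : ℝ) : ℂ) * ((m ^ 2)⁻¹ * W) := by
    push_cast
    rw [← Complex.mul_conj, map_mul, Complex.conj_ofNat]
    field_simp
    ring
  have hsplit : (m ^ 2)⁻¹ * W = (((m ^ 2)⁻¹).re : ℂ) * W +
      (((m ^ 2)⁻¹).im : ℂ) * (Complex.I * W) := by
    conv_lhs => rw [← Complex.re_add_im (m ^ 2)⁻¹]
    ring
  rw [hμ, hopfTangent_ofReal_mul, hsplit, hopfTangent_add, hopfTangent_ofReal_mul,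
    hopfTangent_ofReal_mul, ← cross_hopfTangent h.ne_zero, hKW, ← hx]
  have hcs : cross x (spinorNormSq (a 0) (b 0) ^ 2 • ξ) =
      spinorNormSq (a 0) (b 0) ^ 2 • cross x ξ := by
    apply ext3 <;> simp [cross_zero, cross_one, cross_two] <;> ring
  rw [hcs]
  simp only [smul_add, smul_smul]
  congr 2 <;>
  · field_simp
    ring

/-- A fixed point of the monodromy lifts to a Floquet spinor motion. -/
theorem exists_isFloquet (hv : Continuous (deriv Γ)) {x : E3} (hx : ‖x‖ = 1)
    (hfix : monodromy Γ T ℓ x = x) :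
    ∃ a b m, IsFloquet Γ T ℓ a b m ∧ IsSpinorOf x (a 0) (b 0) := by
  obtain ⟨a₀, b₀, h0⟩ := exists_isSpinorOf hx
  obtain ⟨a, b, h, rfl, rfl⟩ := exists_isSpinorMotion hv ℓ a₀ b₀
  have hne := h.ne_zero hv h0.ne_zero T
  have hT : IsSpinorOf x (a T) (b T) := by
    rw [← hfix, monodromy_eq_hopf hv h h0]
    exact isSpinorOf_hopf hne
  obtain ⟨m, h1, h2⟩ := exists_mul_of_spinorDet_eq_zero h0.ne_zero
    (spinorDet_eq_zero_of_isSpinorOf hx h0 hT)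
  exact ⟨a, b, m, ⟨h, h0.ne_zero, h1, h2⟩, h0⟩

theorem exists_orthogonal_ne_zero {x : E3} (hx : ‖x‖ = 1) : ∃ ξ : E3, ‖ξ‖ = 1 ∧ ⟪x, ξ⟫ = 0 := by
  have hne : (ℝ ∙ x)ᗮ ≠ ⊥ := by
    intro hbot
    have h1 := Submodule.finrank_add_finrank_orthogonal (ℝ ∙ x)
    rw [hbot, finrank_span_singleton (by rintro rfl; simp at hx)] at h1
    simp at h1
  obtain ⟨ξ, hξ, h0⟩ := Submodule.exists_mem_ne_zero_of_ne_bot hne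
  have hξ' := Submodule.mem_orthogonal_singleton_iff_inner_right.1 hξ
  refine ⟨‖ξ‖⁻¹ • ξ, ?_, by rw [inner_smul_right, hξ', mul_zero]⟩
  rw [norm_smul, norm_inv, norm_norm, inv_mul_cancel₀ (norm_ne_zero_iff.2 h0)]

theorem inner_cross_right (x ξ : E3) : ⟪ξ, cross x ξ⟫ = 0 := by
  rw [inner_eq, cross_zero, cross_one, cross_two]; ring

/-- The complex derivative at a point of the sphere is unique. -/
theorem HasSphereDeriv.unique {M : E3 → E3} {x : E3} (hx : ‖x‖ = 1) {μ μ' : ℂ}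
    (h : HasSphereDeriv M x μ) (h' : HasSphereDeriv M x μ') : μ = μ' := by
  obtain ⟨ξ, hξ, hxξ⟩ := exists_orthogonal_ne_zero hx
  obtain ⟨A, hA, hAξ⟩ := h
  obtain ⟨A', hA', hAξ'⟩ := h'
  -- the great circle through `x` with velocity `ξ`
  have hγ : HasDerivAt (fun s : ℝ => Real.cos s • x + Real.sin s • ξ) ξ 0 :=
    (((Real.hasDerivAt_cos 0).smul_const x).add ((Real.hasDerivAt_sin 0).smul_const ξ)).congr_deriv
      (by simp)
  have hmem : ∀ᶠ s : ℝ in nhds 0, Real.cos s • x + Real.sin s • ξ ∈ Metric.sphere (0 : E3) 1 := by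
    refine Filter.Eventually.of_forall fun s => ?_
    rw [mem_sphere_zero_iff_norm]
    have : ‖Real.cos s • x + Real.sin s • ξ‖ ^ 2 = 1 := by
      rw [norm_add_sq_real, norm_smul, norm_smul, inner_smul_left, inner_smul_right, hxξ, hx, hξ]
      simp [Real.cos_sq_add_sin_sq]
    exact (pow_eq_one_iff_of_nonneg (norm_nonneg _) two_ne_zero).1 this
  have e0 : x = Real.cos 0 • x + Real.sin 0 • ξ := by simp
  have h1 := hA.comp_hasDerivAt_of_eq (0 : ℝ) hγ hmem e0
  have h2 := hA'.comp_hasDerivAt_of_eq (0 : ℝ) hγ hmem e0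
  have h3 := h1.unique h2
  rw [hAξ ξ hxξ, hAξ' ξ hxξ] at h3
  have hξξ : ⟪ξ, ξ⟫ = 1 := by rw [real_inner_self_eq_norm_sq, hξ, one_pow]
  have hcc : ⟪cross x ξ, cross x ξ⟫ = 1 := by
    have hxx := sq_coord_of_norm_eq_one hx
    have hξ2 := sq_coord_of_norm_eq_one hξ
    rw [inner_eq] at hxξ
    rw [inner_eq, cross_zero, cross_one, cross_two]
    linear_combination hxx * (ξ 0 ^ 2 + ξ 1 ^ 2 + ξ 2 ^ 2) + hξ2 -
      (x 0 * ξ 0 + x 1 * ξ 1 + x 2 * ξ 2) * hxξ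
  have h4 := congrArg (fun y => ⟪ξ, y⟫) h3
  have h5 := congrArg (fun y => ⟪cross x ξ, y⟫) h3
  simp only [inner_add_right, inner_smul_right, inner_cross_right, real_inner_comm ξ (cross x ξ),
    hξξ, hcc, mul_one, mul_zero, add_zero, zero_add] at h4 h5
  exact Complex.ext h4 h5

theorem IsFloquet.isUnstableFixedPoint (hv : Continuous (deriv Γ)) {a b : ℝ → ℂ} {m : ℂ}
    (h : IsFloquet Γ T ℓ a b m) (hm : 1 < ‖(m ^ 2)⁻¹‖) :
    IsUnstableFixedPoint Γ T ℓ (hopf (a 0) (b 0)) (m ^ 2)⁻¹ := by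
  refine ⟨norm_hopf h.ne_zero, ?_, h.hasSphereDeriv hv, hm⟩
  rw [monodromy_eq_hopf hv h.motion (isSpinorOf_hopf h.ne_zero), h.fst, h.snd,
    hopf_mul (h.multiplier_ne_zero hv)]

theorem IsUnstableFixedPoint.exists_isFloquet (hv : Continuous (deriv Γ)) {x : E3} {μ : ℂ}
    (h : IsUnstableFixedPoint Γ T ℓ x μ) :
    ∃ a b m, IsFloquet Γ T ℓ a b m ∧ IsSpinorOf x (a 0) (b 0) ∧ (m ^ 2)⁻¹ = μ := by
  obtain ⟨hx, hfix, hd, -⟩ := h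
  obtain ⟨a, b, m, hF, hs⟩ := Bicycle.exists_isFloquet hv hx hfix
  refine ⟨a, b, m, hF, hs, ?_⟩
  have h1 := hF.hasSphereDeriv hv
  rw [hs.hopf_eq] at h1
  exact h1.unique hx hd

/-- There is at most one unstable fixed point: the multipliers of two independent Floquet motions
are inverse to each other. -/
theorem IsUnstableFixedPoint.unique (hv : Continuous (deriv Γ)) {x x' : E3} {μ μ' : ℂ}
    (h : IsUnstableFixedPoint Γ T ℓ x μ) (h' : IsUnstableFixedPoint Γ T ℓ x' μ') :
    x = x' ∧ μ = μ' := by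
  obtain ⟨a, b, m, hF, hs, hμ⟩ := h.exists_isFloquet hv
  obtain ⟨a', b', m', hF', hs', hμ'⟩ := h'.exists_isFloquet hv
  have hW := hF.motion.spinorDet_eq hF'.motion T
  rw [hF.fst, hF.snd, hF'.fst, hF'.snd] at hW
  have hW' : (m * m' - 1) * spinorDet (a 0) (b 0) (a' 0) (b' 0) = 0 := by
    simp only [spinorDet] at hW ⊢
    linear_combination hW
  rcases mul_eq_zero.1 hW' with h1 | h1
  · exfalso
    have h2 : μ * μ' = 1 := by
      rw [← hμ, ← hμ', ← mul_inv, ← mul_pow, sub_eq_zero.1 h1]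
      simp
    have h3 := congrArg norm h2
    rw [norm_mul, norm_one] at h3
    nlinarith [h.2.2.2, h'.2.2.2]
  · have hxx : x = x' := by
      rw [← hs.hopf_eq, ← hs'.hopf_eq]
      exact (hopf_eq_of_spinorDet_eq_zero hs.ne_zero hs'.ne_zero h1).symm
    subst hxx
    exact ⟨rfl, h.2.2.1.unique h.1 h'.2.2.1⟩

/-! ### The Darboux transformation of spinor motions -/

section Darboux

variable {Γ Γ' : ℝ → E3} {T ℓ d : ℝ}

/-- The velocities of two curves in bicycle correspondence are related by the reflection in the
line of the connecting segment. -/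
theorem BicycleCorrespondence.deriv_eq (hΓ : IsClosedSmoothCurve Γ T)
    (hΓ' : IsClosedSmoothCurve Γ' T) (hd : 0 < d) (h : BicycleCorrespondence d Γ Γ') (t : ℝ) :
    deriv Γ' t = (2 * ⟪d⁻¹ • (Γ' t - Γ t), deriv Γ t⟫) • (d⁻¹ • (Γ' t - Γ t)) - deriv Γ t := by
  have h1 := hΓ.hasDerivAt t
  have h2 := hΓ'.hasDerivAt t
  have hsq : ∀ s, ⟪Γ' s - Γ s, Γ' s - Γ s⟫ = d ^ 2 := fun s => by
    rw [real_inner_self_eq_norm_sq, ← dist_eq_norm, dist_comm, (h s).1]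
  have horth : ⟪Γ' t - Γ t, deriv Γ' t - deriv Γ t⟫ = 0 := by
    have h3 := (h2.sub h1).inner ℝ (h2.sub h1)
    have h4 : HasDerivAt (fun s => ⟪(Γ' - Γ) s, (Γ' - Γ) s⟫) 0 t := by
      simp only [Pi.sub_apply, hsq]
      exact hasDerivAt_const t _
    have h5 := h3.unique h4
    simp only [Pi.sub_apply] at h5
    rw [real_inner_comm] at h5
    linarith [real_inner_comm (Γ' t - Γ t) (deriv Γ' t - deriv Γ t)]
  obtain ⟨c, hc⟩ := (h t).2
  have hmid : deriv (fun s => midpoint ℝ (Γ s) (Γ' s)) t =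
      (2 : ℝ)⁻¹ • (deriv Γ t + deriv Γ' t) := by
    have e : (fun s => midpoint ℝ (Γ s) (Γ' s)) = fun s => (2 : ℝ)⁻¹ • (Γ s + Γ' s) := by
      funext s
      rw [midpoint_eq_smul_add, invOf_eq_inv]
    rw [e]
    exact ((h1.add h2).const_smul (2 : ℝ)⁻¹).deriv
  rw [hmid] at hc
  have hsum : deriv Γ' t = (-(2 * c)) • (Γ' t - Γ t) - deriv Γ t := by
    have : deriv Γ t + deriv Γ' t = (2 : ℝ) • (c • (Γ t - Γ' t)) := by
      rw [← hc, smul_smul]; norm_num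
    rw [eq_sub_iff_add_eq, add_comm, this]
    module
  have hcval : ⟪Γ' t - Γ t, deriv Γ t⟫ = -c * d ^ 2 := by
    rw [hsum, inner_sub_right, inner_sub_right, inner_smul_right, hsq] at horth
    linarith
  rw [inner_smul_left, hcval]
  simp only [RCLike.conj_to_real, smul_smul]
  rw [hsum]
  congr 2
  field_simp

/-- The Darboux transformation `ψ ↦ (w ⬝ σ - 2ℓ / d) ψ`, where `w` is the unit direction of the
segment joining two curves in bicycle correspondence, takes Floquet motions of the one curve to
Floquet motions of the other with the same multiplier. -/
theorem IsFloquet.darboux (hΓ : IsClosedSmoothCurve Γ T)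
    (hΓ' : IsClosedSmoothCurve Γ' T) (hd : 0 < d) (h : BicycleCorrespondence d Γ Γ')
    (hℓ : 0 < ℓ) (hℓd : 2 * ℓ < d) {a b : ℝ → ℂ} {m : ℂ} (hF : IsFloquet Γ T ℓ a b m) :
    ∃ a' b', IsFloquet Γ' T ℓ a' b' m := by
  set w : ℝ → E3 := fun t => d⁻¹ • (Γ' t - Γ t) with hw
  have hwT : w T = w 0 := by
    have h1 := hΓ.periodic 0
    have h2 := hΓ'.periodic 0
    rw [zero_add] at h1 h2
    simp only [hw, h1, h2]
  have hwn : ∀ t, ‖w t‖ = 1 := fun t => by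
    rw [hw, norm_smul, ← dist_eq_norm, dist_comm, (h t).1, norm_inv, Real.norm_eq_abs,
      abs_of_pos hd, inv_mul_cancel₀ hd.ne']
  have hw1 : ∀ t, (w t 0 : ℂ) ^ 2 + (w t 1 : ℂ) ^ 2 + (w t 2 : ℂ) ^ 2 = 1 := fun t => by
    have := congrArg (fun r : ℝ => (r : ℂ)) (sq_coord_of_norm_eq_one (hwn t))
    simpa using this
  have hv : ∀ t, deriv Γ' t = (2 * ⟪w t, deriv Γ t⟫) • w t - deriv Γ t := fun t =>
    h.deriv_eq hΓ hΓ' hd t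
  have hdw : ∀ t, HasDerivAt w (d⁻¹ • (deriv Γ' t - deriv Γ t)) t := fun t =>
    ((hΓ'.hasDerivAt t).sub (hΓ.hasDerivAt t)).const_smul d⁻¹
  have hdwi : ∀ t i, HasDerivAt (fun s => ((w s i : ℝ) : ℂ))
      ((d⁻¹ * (deriv Γ' t i - deriv Γ t i) : ℝ) : ℂ) t := fun t i => by
    simpa using (hasDerivAt_coord (hdw t) i).ofReal_comp
  obtain ⟨c, hc⟩ : ∃ c : ℂ, c = 2 * ℓ / d := ⟨_, rfl⟩
  have hdc : (d : ℂ) ≠ 0 := by exact_mod_cast hd.ne'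
  have hℓc : (ℓ : ℂ) ≠ 0 := by exact_mod_cast hℓ.ne'
  have hdκ : (d : ℂ)⁻¹ = c * (2 * ℓ : ℂ)⁻¹ := by
    rw [hc]
    field_simp
  refine ⟨fun t => pauliFst (w t) (a t) (b t) - c * a t,
    fun t => pauliSnd (w t) (a t) (b t) - c * b t, ⟨fun t => ?_, ?_, ?_, ?_⟩⟩
  · have ha := (hF.motion t).1
    have hb := (hF.motion t).2
    have h0 := hdwi t 0
    have h1 := hdwi t 1
    have h2 := hdwi t 2
    have e := hw1 t
    have hv0 := congrArg (fun y : E3 => ((y 0 : ℝ) : ℂ)) (hv t)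
    have hv1 := congrArg (fun y : E3 => ((y 1 : ℝ) : ℂ)) (hv t)
    have hv2 := congrArg (fun y : E3 => ((y 2 : ℝ) : ℂ)) (hv t)
    simp only [PiLp.sub_apply, PiLp.smul_apply, smul_eq_mul, inner_eq] at hv0 hv1 hv2
    push_cast at hv0 hv1 hv2
    constructor
    · refine (((h2.mul ha).add ((h0.sub (h1.const_mul Complex.I)).mul hb)).sub
        (ha.const_mul c)).congr_deriv ?_
      simp only [pauliFst, pauliSnd, Pi.sub_apply]
      push_cast
      rw [hv0, hv1, hv2, hdκ]
      generalize ((2 : ℂ) * ℓ)⁻¹ = κ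
      linear_combination (2 * (w t 0 * deriv Γ t 0 + w t 1 * deriv Γ t 1 + w t 2 * deriv Γ t 2) *
        κ * a t) * e + (-2 * (w t 0 * deriv Γ t 0 + w t 1 * deriv Γ t 1 + w t 2 * deriv Γ t 2) *
        κ * a t * w t 1 ^ 2 + 2 * κ * a t * w t 1 * deriv Γ t 1) * Complex.I_sq
    · refine ((((h0.add (h1.const_mul Complex.I)).mul ha).sub (h2.mul hb)).sub
        (hb.const_mul c)).congr_deriv ?_
      simp only [pauliFst, pauliSnd, Pi.add_apply]
      push_cast
      rw [hv0, hv1, hv2, hdκ]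
      generalize ((2 : ℂ) * ℓ)⁻¹ = κ
      linear_combination (2 * (w t 0 * deriv Γ t 0 + w t 1 * deriv Γ t 1 + w t 2 * deriv Γ t 2) *
        κ * b t) * e + (-2 * (w t 0 * deriv Γ t 0 + w t 1 * deriv Γ t 1 + w t 2 * deriv Γ t 2) *
        κ * b t * w t 1 ^ 2 + 2 * κ * b t * w t 1 * deriv Γ t 1) * Complex.I_sq
  · -- `(w ⬝ σ) ^ 2 = 1`, so `2ℓ / d`, which is not `±1`, is not an eigenvalue
    by_contra! hcon
    have hc2 : c ^ 2 ≠ 1 := by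
      have : (2 * ℓ / d) ^ 2 < 1 := by
        rw [sq_lt_one_iff₀ (by positivity), div_lt_one hd]
        exact hℓd
      rw [hc]
      exact_mod_cast this.ne
    have e := hw1 0
    have h1 := hcon.1
    have h2 := hcon.2
    simp only [pauliFst, pauliSnd] at h1 h2
    have ha : (1 - c ^ 2) * a 0 = 0 := by
      linear_combination (-(a 0)) * e + (a 0) * (w 0 1) ^ 2 * Complex.I_sq +
        (w 0 2 + c) * h1 + (w 0 0 - Complex.I * w 0 1) * h2
    have hb : (1 - c ^ 2) * b 0 = 0 := by
      linear_combination (-(b 0)) * e + (b 0) * (w 0 1) ^ 2 * Complex.I_sq +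
        (-w 0 2 + c) * h2 + (w 0 0 + Complex.I * w 0 1) * h1
    have hc2' : 1 - c ^ 2 ≠ 0 := fun h => hc2 (sub_eq_zero.1 h).symm
    rcases hF.ne_zero with h0 | h0
    · exact (mul_ne_zero hc2' h0) ha
    · exact (mul_ne_zero hc2' h0) hb
  · simp only [hwT, hF.fst, hF.snd, pauliFst]
    ring
  · simp only [hwT, hF.fst, hF.snd, pauliSnd]
    ring

theorem IsUnstableFixedPoint.exists_of_bicycleCorrespondence (hΓ : IsClosedSmoothCurve Γ T)
    (hΓ' : IsClosedSmoothCurve Γ' T) (hd : 0 < d) (h : BicycleCorrespondence d Γ Γ')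
    (hℓ : 0 < ℓ) (hℓd : 2 * ℓ < d) {x : E3} {μ : ℂ} (hx : IsUnstableFixedPoint Γ T ℓ x μ) :
    ∃ x', IsUnstableFixedPoint Γ' T ℓ x' μ := by
  obtain ⟨a, b, m, hF, -, rfl⟩ := hx.exists_isFloquet hΓ.contDiff_deriv.continuous
  obtain ⟨a', b', hF'⟩ := hF.darboux hΓ hΓ' hd h hℓ hℓd
  exact ⟨_, hF'.isUnstableFixedPoint hΓ'.contDiff_deriv.continuous hx.2.2.2⟩

end Darboux

/-! ### Moving frames and the Riccati equation -/

section Frames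

variable {Γ : ℝ → E3} {T : ℝ}

theorem hasDerivAt_cross {x y : ℝ → E3} {x' y' : E3} {t : ℝ} (hx : HasDerivAt x x' t)
    (hy : HasDerivAt y y' t) :
    HasDerivAt (fun s => cross (x s) (y s)) (cross x' (y t) + cross (x t) y') t := by
  have hX := hasDerivAt_coord hx
  have hY := hasDerivAt_coord hy
  rw [hasDerivAt_iff_coord]
  intro i
  fin_cases i
  · refine HasDerivAt.congr_of_eventuallyEq ((((hX 1).mul (hY 2)).sub
      ((hX 2).mul (hY 1))).congr_deriv ?_) (Filter.Eventually.of_forall fun s => cross_zero _ _)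
    simp [cross_zero]; ring
  · refine HasDerivAt.congr_of_eventuallyEq ((((hX 2).mul (hY 0)).sub
      ((hX 0).mul (hY 2))).congr_deriv ?_) (Filter.Eventually.of_forall fun s => cross_one _ _)
    simp [cross_one]; ring
  · refine HasDerivAt.congr_of_eventuallyEq ((((hX 0).mul (hY 1)).sub
      ((hX 1).mul (hY 0))).congr_deriv ?_) (Filter.Eventually.of_forall fun s => cross_two _ _)
    simp [cross_two]; ring

theorem contDiff_cross {x y : ℝ → E3} (hx : ContDiff ℝ ∞ x) (hy : ContDiff ℝ ∞ y) :
    ContDiff ℝ ∞ fun s => cross (x s) (y s) := by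
  have hX := fun i => contDiff_euclidean.1 hx i
  have hY := fun i => contDiff_euclidean.1 hy i
  rw [contDiff_euclidean]
  intro i
  fin_cases i
  · simpa [cross_zero] using! ((hX 1).mul (hY 2)).sub ((hX 2).mul (hY 1))
  · simpa [cross_one] using! ((hX 2).mul (hY 0)).sub ((hX 0).mul (hY 2))
  · simpa [cross_two] using! ((hX 0).mul (hY 1)).sub ((hX 1).mul (hY 0))

theorem inner_cross_self_left (u n : E3) : ⟪u, cross u n⟫ = 0 := by
  rw [inner_eq, cross_zero, cross_one, cross_two]; ring

theorem inner_cross_self_right (u n : E3) : ⟪n, cross u n⟫ = 0 := by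
  rw [inner_eq, cross_zero, cross_one, cross_two]; ring

/-- A positively oriented orthonormal basis of space, given by its first two vectors. -/
structure IsOrthonormalPair (u n : E3) : Prop where
  norm_fst : ‖u‖ = 1
  norm_snd : ‖n‖ = 1
  orthogonal : ⟪u, n⟫ = 0

namespace IsOrthonormalPair

variable {u n : E3}

theorem coord (h : IsOrthonormalPair u n) :
    u 0 ^ 2 + u 1 ^ 2 + u 2 ^ 2 = 1 ∧ n 0 ^ 2 + n 1 ^ 2 + n 2 ^ 2 = 1 ∧
    u 0 * n 0 + u 1 * n 1 + u 2 * n 2 = 0 :=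
  ⟨sq_coord_of_norm_eq_one h.norm_fst, sq_coord_of_norm_eq_one h.norm_snd,
    by rw [← inner_eq]; exact h.orthogonal⟩

theorem cross_cross_right (h : IsOrthonormalPair u n) : cross u (cross u n) = -n := by
  obtain ⟨h1, h2, h3⟩ := h.coord
  apply ext3 <;> simp only [cross_zero, cross_one, cross_two, PiLp.neg_apply]
  · linear_combination u 0 * h3 - n 0 * h1
  · linear_combination u 1 * h3 - n 1 * h1
  · linear_combination u 2 * h3 - n 2 * h1

theorem cross_cross_left (h : IsOrthonormalPair u n) : cross (cross u n) u = n := by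
  obtain ⟨h1, h2, h3⟩ := h.coord
  apply ext3 <;> simp only [cross_zero, cross_one, cross_two]
  · linear_combination -u 0 * h3 + n 0 * h1
  · linear_combination -u 1 * h3 + n 1 * h1
  · linear_combination -u 2 * h3 + n 2 * h1

theorem cross_cross_snd (h : IsOrthonormalPair u n) : cross (cross u n) n = -u := by
  obtain ⟨h1, h2, h3⟩ := h.coord
  apply ext3 <;> simp only [cross_zero, cross_one, cross_two, PiLp.neg_apply]
  · linear_combination n 0 * h3 - u 0 * h2
  · linear_combination n 1 * h3 - u 1 * h2
  · linear_combination n 2 * h3 - u 2 * h2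

theorem norm_cross (h : IsOrthonormalPair u n) : ‖cross u n‖ = 1 := by
  obtain ⟨h1, h2, h3⟩ := h.coord
  have : ‖cross u n‖ ^ 2 = 1 := by
    rw [← real_inner_self_eq_norm_sq, inner_eq, cross_zero, cross_one, cross_two]
    linear_combination h1 * (n 0 ^ 2 + n 1 ^ 2 + n 2 ^ 2) + h2 -
      (u 0 * n 0 + u 1 * n 1 + u 2 * n 2) * h3
  exact (pow_eq_one_iff_of_nonneg (norm_nonneg _) two_ne_zero).1 this

/-- Expansion in the orthonormal basis `u, n, u × n`. -/
theorem expand (h : IsOrthonormalPair u n) (y : E3) :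
    y = ⟪u, y⟫ • u + ⟪n, y⟫ • n + ⟪cross u n, y⟫ • cross u n := by
  have hon : Orthonormal ℝ ![u, n, cross u n] := by
    rw [orthonormal_iff_ite]
    intro i j
    fin_cases i <;> fin_cases j <;>
      simp [h.norm_fst, h.norm_snd, h.norm_cross, h.orthogonal, inner_cross_self_left,
        inner_cross_self_right, real_inner_comm u n, real_inner_comm u (cross u n),
        real_inner_comm n (cross u n)]
  have hsp : ⊤ ≤ Submodule.span ℝ (Set.range ![u, n, cross u n]) :=
    (hon.linearIndependent.span_eq_top_of_card_eq_finrank' (by simp)).ge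
  have := (OrthonormalBasis.mk hon hsp).sum_repr' y
  simpa [Fin.sum_univ_three] using! this.symm

end IsOrthonormalPair

/-- `n` and `b = u × n` complete the unit tangent `u` of the closed curve to a smooth periodic
orthonormal frame. The rotation of the frame is given, with respect to the parameter of the curve,
by the complex curvature `k` and the angular velocity `ρ` about the tangent. -/
structure IsMovingFrame (Γ : ℝ → E3) (T : ℝ) (n b : ℝ → E3) (k : ℝ → ℂ) (ρ : ℝ → ℝ) : Prop where
  pair : ∀ t, IsOrthonormalPair (unitTangent Γ t) (n t)
  b_eq : ∀ t, b t = cross (unitTangent Γ t) (n t)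
  periodic_n : Periodic n T
  smooth_k : ContDiff ℝ ∞ k
  smooth_ρ : ContDiff ℝ ∞ ρ
  periodic_k : Periodic k T
  periodic_ρ : Periodic ρ T
  deriv_u : ∀ t, HasDerivAt (unitTangent Γ) ((k t).re • n t + (k t).im • b t) t
  deriv_n : ∀ t, HasDerivAt n (-(k t).re • unitTangent Γ t + ρ t • b t) t
  deriv_b : ∀ t, HasDerivAt b (-(k t).im • unitTangent Γ t - ρ t • n t) t

namespace IsClosedSmoothCurve

theorem speed_pos (hΓ : IsClosedSmoothCurve Γ T) (t : ℝ) : 0 < ‖deriv Γ t‖ :=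
  norm_pos_iff.2 (hΓ.regular t)

theorem contDiff_speed (hΓ : IsClosedSmoothCurve Γ T) : ContDiff ℝ ∞ fun t => ‖deriv Γ t‖ :=
  hΓ.contDiff_deriv.norm ℝ hΓ.regular

theorem speed_periodic (hΓ : IsClosedSmoothCurve Γ T) :
    Periodic (fun t => ‖deriv Γ t‖) T := fun t => by
  simp only [hΓ.deriv_periodic t]

theorem contDiff_unitTangent (hΓ : IsClosedSmoothCurve Γ T) : ContDiff ℝ ∞ (unitTangent Γ) :=
  (hΓ.contDiff_speed.inv fun t => (hΓ.speed_pos t).ne').smul hΓ.contDiff_deriv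

theorem unitTangent_periodic (hΓ : IsClosedSmoothCurve Γ T) :
    Periodic (unitTangent Γ) T := fun t => by
  simp only [unitTangent, hΓ.deriv_periodic t]

theorem norm_unitTangent (hΓ : IsClosedSmoothCurve Γ T) (t : ℝ) : ‖unitTangent Γ t‖ = 1 := by
  rw [unitTangent, norm_smul, norm_inv, norm_norm, inv_mul_cancel₀ (hΓ.speed_pos t).ne']

theorem deriv_eq_smul_unitTangent (hΓ : IsClosedSmoothCurve Γ T) (t : ℝ) :
    deriv Γ t = ‖deriv Γ t‖ • unitTangent Γ t := by
  rw [unitTangent, smul_smul, mul_inv_cancel₀ (hΓ.speed_pos t).ne', one_smul]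

/-- A vector that is not on the (two-dimensional) cone of the multiples of the tangents, projected to
the normal planes, gives a smooth periodic normal frame. -/
theorem exists_isMovingFrame (hΓ : IsClosedSmoothCurve Γ T) :
    ∃ n b k ρ, IsMovingFrame Γ T n b k ρ := by
  have hu := hΓ.contDiff_unitTangent
  -- the tangent cone has dense complement
  have hcone : ContDiff ℝ 1 fun q : ℝ × ℝ => q.2 • unitTangent Γ q.1 :=
    contDiff_snd.smul ((hu.of_le (by simp)).comp contDiff_fst)
  have hdense := hcone.dense_compl_range_of_finrank_lt_finrank (by simp)
  obtain ⟨c, hc⟩ := hdense.nonempty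
  set y : ℝ → E3 := fun t => c - ⟪unitTangent Γ t, c⟫ • unitTangent Γ t with hy
  have hy0 : ∀ t, y t ≠ 0 := fun t h0 =>
    hc ⟨(t, ⟪unitTangent Γ t, c⟫), (sub_eq_zero.1 h0).symm⟩
  have hys : ContDiff ℝ ∞ y := contDiff_const.sub ((hu.inner ℝ contDiff_const).smul hu)
  set n : ℝ → E3 := fun t => ‖y t‖⁻¹ • y t with hn
  have hns : ContDiff ℝ ∞ n := ((hys.norm ℝ hy0).inv fun t => norm_ne_zero_iff.2 (hy0 t)).smul hys
  have hnp : Periodic n T := fun t => by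
    simp only [hn, hy, hΓ.unitTangent_periodic t]
  have hpair : ∀ t, IsOrthonormalPair (unitTangent Γ t) (n t) := fun t => by
    refine ⟨hΓ.norm_unitTangent t, ?_, ?_⟩
    · rw [hn, norm_smul, norm_inv, norm_norm, inv_mul_cancel₀ (norm_ne_zero_iff.2 (hy0 t))]
    · rw [hn, inner_smul_right, hy, inner_sub_right, inner_smul_right, real_inner_self_eq_norm_sq,
        hΓ.norm_unitTangent]
      ring
  set b : ℝ → E3 := fun t => cross (unitTangent Γ t) (n t) with hb
  have hbs : ContDiff ℝ ∞ b := contDiff_cross hu hns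
  have hu' : ContDiff ℝ ∞ (deriv (unitTangent Γ)) := (contDiff_infty_iff_deriv.1 hu).2
  have hn' : ContDiff ℝ ∞ (deriv n) := (contDiff_infty_iff_deriv.1 hns).2
  have hud : ∀ t, HasDerivAt (unitTangent Γ) (deriv (unitTangent Γ) t) t := fun t =>
    ((contDiff_infty_iff_deriv.1 hu).1 t).hasDerivAt
  have hnd : ∀ t, HasDerivAt n (deriv n t) t := fun t =>
    ((contDiff_infty_iff_deriv.1 hns).1 t).hasDerivAt
  have hup' : Periodic (deriv (unitTangent Γ)) T := fun t => by
    rw [← deriv_comp_add_const]; congr 1; exact funext hΓ.unitTangent_periodic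
  have hnp' : Periodic (deriv n) T := fun t => by
    rw [← deriv_comp_add_const]; congr 1; exact funext hnp
  have hbp : Periodic b T := fun t => by simp only [hb, hnp t, hΓ.unitTangent_periodic t]
  set k : ℝ → ℂ := fun t => ((⟪n t, deriv (unitTangent Γ) t⟫ : ℝ) : ℂ) +
    ((⟪b t, deriv (unitTangent Γ) t⟫ : ℝ) : ℂ) * Complex.I with hk
  set ρ : ℝ → ℝ := fun t => ⟪b t, deriv n t⟫ with hρ
  have hkre : ∀ t, (k t).re = ⟪n t, deriv (unitTangent Γ) t⟫ := fun t => by simp [hk]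
  have hkim : ∀ t, (k t).im = ⟪b t, deriv (unitTangent Γ) t⟫ := fun t => by simp [hk]
  -- derivatives of the orthonormality relations
  have huu : ∀ t, ⟪unitTangent Γ t, deriv (unitTangent Γ) t⟫ = 0 := fun t => by
    have h1 := (hud t).inner ℝ (hud t)
    simp only [real_inner_self_eq_norm_sq, hΓ.norm_unitTangent] at h1
    have h2 := h1.unique (hasDerivAt_const t _)
    rw [real_inner_comm (unitTangent Γ t)] at h2
    linarith [real_inner_comm (unitTangent Γ t) (deriv (unitTangent Γ) t)]
  have hnn : ∀ t, ⟪n t, deriv n t⟫ = 0 := fun t => by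
    have h1 := (hnd t).inner ℝ (hnd t)
    simp only [real_inner_self_eq_norm_sq, (hpair _).norm_snd] at h1
    have h2 := h1.unique (hasDerivAt_const t _)
    linarith [real_inner_comm (n t) (deriv n t)]
  have hun : ∀ t, ⟪unitTangent Γ t, deriv n t⟫ = -(k t).re := fun t => by
    have h1 := (hud t).inner ℝ (hnd t)
    simp only [(hpair _).orthogonal] at h1
    have h2 := h1.unique (hasDerivAt_const t _)
    rw [hkre]
    linarith [real_inner_comm (n t) (deriv (unitTangent Γ) t)]
  have hdu : ∀ t, deriv (unitTangent Γ) t = (k t).re • n t + (k t).im • b t := fun t => by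
    conv_lhs => rw [(hpair t).expand (deriv (unitTangent Γ) t), huu]
    rw [hkre, hkim, zero_smul, zero_add]
  have hdn : ∀ t, deriv n t = -(k t).re • unitTangent Γ t + ρ t • b t := fun t => by
    conv_lhs => rw [(hpair t).expand (deriv n t), hnn, hun]
    rw [zero_smul, add_zero]
  refine ⟨n, b, k, ρ, hpair, fun t => rfl, hnp, ?_, hbs.inner ℝ hn', fun t => ?_, fun t => ?_,
    fun t => ?_, fun t => ?_, fun t => ?_⟩
  · exact (Complex.ofRealCLM.contDiff.comp (hns.inner ℝ hu')).add
      ((Complex.ofRealCLM.contDiff.comp (hbs.inner ℝ hu')).mul contDiff_const)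
  · simp only [hk, hnp t, hbp t, hup' t]
  · simp only [hρ, hbp t, hnp' t]
  · rw [← hdu]; exact hud t
  · rw [← hdn]; exact hnd t
  · refine (hasDerivAt_cross (hud t) (hnd t)).congr_deriv ?_
    have h1 := (hpair t).cross_cross_snd
    have h2 := (hpair t).cross_cross_right
    rw [hdu, hdn]
    have e : cross ((k t).re • n t + (k t).im • b t) (n t) +
        cross (unitTangent Γ t) (-(k t).re • unitTangent Γ t + ρ t • b t) =
        (k t).im • cross (b t) (n t) + ρ t • cross (unitTangent Γ t) (b t) := by
      apply ext3 <;> simp [cross_zero, cross_one, cross_two] <;> ring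
    rw [e, h1, h2]
    module

/-- A Frenet frame is a moving frame. -/
theorem isMovingFrame_of_isFrenetFrame (hΓ : IsClosedSmoothCurve Γ T) {n b : ℝ → E3} {κ τ : ℝ → ℝ}
    (h : IsFrenetFrame Γ T n b κ τ) :
    Periodic κ T ∧ Periodic τ T ∧ IsMovingFrame Γ T n b
      (fun t => ((‖deriv Γ t‖ * κ t : ℝ) : ℂ)) (fun t => ‖deriv Γ t‖ * τ t) := by
  have hu := hΓ.contDiff_unitTangent
  have hpair : ∀ t, IsOrthonormalPair (unitTangent Γ t) (n t) := fun t =>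
    ⟨hΓ.norm_unitTangent t, h.norm_n t, h.orthogonal t⟩
  have hbs : ContDiff ℝ ∞ b := by
    rw [funext h.b_eq]
    exact contDiff_cross hu h.smooth_n
  have hup' : Periodic (deriv (unitTangent Γ)) T := fun t => by
    rw [← deriv_comp_add_const]; congr 1; exact funext hΓ.unitTangent_periodic
  have hnp' : Periodic (deriv n) T := fun t => by
    rw [← deriv_comp_add_const]; congr 1; exact funext h.periodic_n
  have hbp : Periodic b T := fun t => by
    rw [h.b_eq, h.b_eq, h.periodic_n, hΓ.unitTangent_periodic]
  have hκ : ∀ t, κ t = ‖deriv Γ t‖⁻¹ * ⟪deriv (unitTangent Γ) t, n t⟫ := fun t => by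
    rw [h.deriv_v, inner_smul_left, inner_smul_left, real_inner_self_eq_norm_sq, h.norm_n]
    have := (hΓ.speed_pos t).ne'
    simp
    field_simp
  have hτ : ∀ t, τ t = ‖deriv Γ t‖⁻¹ * ⟪deriv n t, b t⟫ := fun t => by
    have h1 := inner_cross_self_left (unitTangent Γ t) (n t)
    have h2 := (hpair t).norm_cross
    rw [← h.b_eq] at h1 h2
    rw [h.deriv_n, inner_smul_left, inner_add_left, inner_smul_left, inner_smul_left, h1,
      real_inner_self_eq_norm_sq, h2]
    have := (hΓ.speed_pos t).ne'
    simp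
    field_simp
  have hκp : Periodic κ T := fun t => by
    rw [hκ, hκ t, hΓ.deriv_periodic, hup', h.periodic_n]
  have hτp : Periodic τ T := fun t => by
    rw [hτ, hτ t, hΓ.deriv_periodic, hnp', hbp]
  refine ⟨hκp, hτp, hpair, h.b_eq, h.periodic_n, ?_, hΓ.contDiff_speed.mul h.smooth_τ, fun t => ?_,
    fun t => ?_, fun t => ?_, fun t => ?_, fun t => ?_⟩
  · exact Complex.ofRealCLM.contDiff.comp (hΓ.contDiff_speed.mul h.smooth_κ)
  · simp only [hΓ.deriv_periodic t, hκp t]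
  · simp only [hΓ.deriv_periodic t, hτp t]
  · refine ((contDiff_infty_iff_deriv.1 hu).1 t).hasDerivAt.congr_deriv ?_
    rw [h.deriv_v, Complex.ofReal_re, Complex.ofReal_im]
    module
  · refine ((contDiff_infty_iff_deriv.1 h.smooth_n).1 t).hasDerivAt.congr_deriv ?_
    rw [h.deriv_n, Complex.ofReal_re]
    module
  · refine ((contDiff_infty_iff_deriv.1 hbs).1 t).hasDerivAt.congr_deriv ?_
    rw [h.deriv_b, Complex.ofReal_im]
    module

end IsClosedSmoothCurve

/-- The complex bilinear product of `x` with the null vector that is the square of the spinor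
`(a, b)`. -/
def nullPairing (x : E3) (a b : ℂ) : ℂ :=
  x 0 * (a ^ 2 - b ^ 2) + x 1 * (Complex.I * (a ^ 2 + b ^ 2)) - x 2 * (2 * a * b)

theorem IsSpinorMotion.hasDerivAt_nullPairing {ℓ : ℝ} {a b : ℝ → ℂ} (h : IsSpinorMotion Γ ℓ a b)
    {x : ℝ → E3} {x' : E3} {t : ℝ} (hx : HasDerivAt x x' t) :
    HasDerivAt (fun s => nullPairing (x s) (a s) (b s))
      (nullPairing x' (a t) (b t) -
        Complex.I * (ℓ : ℂ)⁻¹ * nullPairing (cross (x t) (deriv Γ t)) (a t) (b t)) t := by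
  have hX := fun i => (hasDerivAt_coord hx i).ofReal_comp
  have ha := (h t).1
  have hb := (h t).2
  refine ((((hX 0).mul ((ha.pow 2).sub (hb.pow 2))).add
    ((hX 1).mul (((ha.pow 2).add (hb.pow 2)).const_mul Complex.I))).sub
    ((hX 2).mul ((ha.const_mul 2).mul hb))).congr_deriv ?_
  simp only [pauliFst, pauliSnd, nullPairing, cross_zero, cross_one, cross_two, Pi.sub_apply,
    Pi.add_apply, Pi.mul_apply, Pi.pow_apply, mul_inv]
  push_cast
  generalize (ℓ : ℂ)⁻¹ = κ
  have hI := Complex.I_sq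
  grind

/-- Every null vector of complex three-space is the square of a spinor. -/
theorem exists_spinor_sq_eq {N₀ N₁ N₂ : ℂ} (h : N₀ ^ 2 + N₁ ^ 2 + N₂ ^ 2 = 0) :
    ∃ a b : ℂ, a ^ 2 - b ^ 2 = N₀ ∧ Complex.I * (a ^ 2 + b ^ 2) = N₁ ∧ -(2 * a * b) = N₂ := by
  obtain ⟨a, ha⟩ := IsAlgClosed.exists_pow_nat_eq ((N₀ - Complex.I * N₁) / 2) (n := 2) (by norm_num)
  by_cases h0 : a = 0
  · obtain ⟨b, hb⟩ := IsAlgClosed.exists_pow_nat_eq (-(N₀ + Complex.I * N₁) / 2) (n := 2)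
      (by norm_num)
    subst h0
    have h1 : N₀ = Complex.I * N₁ := by linear_combination -2 * ha
    have h2 : N₂ = 0 := by
      rw [h1] at h
      have : N₂ ^ 2 = 0 := by linear_combination h - N₁ ^ 2 * Complex.I_sq
      exact pow_eq_zero_iff two_ne_zero |>.1 this
    refine ⟨0, b, ?_, ?_, ?_⟩
    · linear_combination -hb - h1 / 2
    · linear_combination Complex.I * hb - Complex.I / 2 * h1 - N₁ * Complex.I_sq
    · rw [h2]; ring
  · have hb : (-N₂ / (2 * a)) ^ 2 = -(N₀ + Complex.I * N₁) / 2 := by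
      rw [div_pow, div_eq_iff (pow_ne_zero 2 (mul_ne_zero two_ne_zero h0))]
      linear_combination 2 * (N₀ + Complex.I * N₁) * ha + h - N₁ ^ 2 * Complex.I_sq
    refine ⟨a, -N₂ / (2 * a), ?_, ?_, ?_⟩
    · linear_combination ha - hb
    · linear_combination Complex.I * (ha + hb) - N₁ * Complex.I_sq
    · field_simp

/-- A periodic solution `z` of the Riccati equation, which is the bicycle equation in the
stereographic coordinate `z` of a moving frame, gives a Floquet spinor motion; the derivative of the
monodromy at the fixed point is that of the Riccati equation. The spinor `ψ` is the one whose square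
is the null vector `(1 - z²) n + i (1 + z²) b - 2 z u`; the pairing of this vector with the square
of a spinor motion `φ` is a multiple of `det(ψ, φ) ^ 2` and satisfies a scalar linear equation. -/
theorem IsMovingFrame.exists_isFloquet (hΓ : IsClosedSmoothCurve Γ T) {n b : ℝ → E3} {k : ℝ → ℂ}
    {ρ : ℝ → ℝ} (hf : IsMovingFrame Γ T n b k ρ) {ℓ : ℝ} {z : ℝ → ℂ} (hzT : Periodic z T)
    (hz : ∀ t, HasDerivAt z ((‖deriv Γ t‖ : ℂ) / ℓ * z t -
      (k t / 2 + Complex.I * ρ t * z t + starRingEnd ℂ (k t) / 2 * z t ^ 2)) t) :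
    ∃ α β m, IsFloquet Γ T ℓ α β m ∧ (m ^ 2)⁻¹ = Complex.exp (∫ t in (0 : ℝ)..T,
      ((‖deriv Γ t‖ : ℂ) / ℓ - Complex.I * ρ t - starRingEnd ℂ (k t) * z t)) := by
  have hv : Continuous (deriv Γ) := hΓ.contDiff_deriv.continuous
  set g : (ℝ → ℂ) → (ℝ → ℂ) → ℝ → ℂ := fun α β t =>
    nullPairing (n t) (α t) (β t) + Complex.I * nullPairing (b t) (α t) (β t) -
      2 * z t * nullPairing (unitTangent Γ t) (α t) (β t) -
      z t ^ 2 * (nullPairing (n t) (α t) (β t) - Complex.I * nullPairing (b t) (α t) (β t)) with hg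
  set q : ℝ → ℂ := fun t =>
    (‖deriv Γ t‖ : ℂ) / ℓ - Complex.I * ρ t - starRingEnd ℂ (k t) * z t with hq
  have hqc : Continuous q := by
    have h1 : Continuous z := continuous_iff_continuousAt.2 fun t => (hz t).continuousAt
    have h2 := hf.smooth_k.continuous
    have h3 := hf.smooth_ρ.continuous
    have h4 : Continuous fun t => (starRingEnd ℂ) (k t) := Complex.continuous_conj.comp h2
    have h5 : Continuous fun t => ((‖deriv Γ t‖ : ℝ) : ℂ) :=
      Complex.continuous_ofReal.comp hv.norm
    have h6 : Continuous fun t => ((ρ t : ℝ) : ℂ) := Complex.continuous_ofReal.comp h3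
    exact ((h5.div_const _).sub (continuous_const.mul h6)).sub (h4.mul h1)
  have hgd : ∀ α β, IsSpinorMotion Γ ℓ α β → ∀ t, HasDerivAt (g α β) (q t * g α β t) t := by
    intro α β hm t
    have hn := hm.hasDerivAt_nullPairing (hf.deriv_n t)
    have hb := hm.hasDerivAt_nullPairing (hf.deriv_b t)
    have hu := hm.hasDerivAt_nullPairing (hf.deriv_u t)
    have hvu := hΓ.deriv_eq_smul_unitTangent t
    have c1 : cross (n t) (deriv Γ t) = -‖deriv Γ t‖ • b t := by
      conv_lhs => rw [hvu]
      rw [hf.b_eq]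
      apply ext3 <;> simp [cross_zero, cross_one, cross_two] <;> ring
    have c2 : cross (b t) (deriv Γ t) = ‖deriv Γ t‖ • n t := by
      conv_lhs => rw [hvu]
      rw [← (hf.pair t).cross_cross_left, ← hf.b_eq]
      apply ext3 <;> simp [cross_zero, cross_one, cross_two] <;> ring
    have c3 : cross (unitTangent Γ t) (deriv Γ t) = 0 := by
      conv_lhs => rw [hvu]
      apply ext3 <;> simp [cross_zero, cross_one, cross_two] <;> ring
    have l : ∀ (r s : ℝ) (x y : E3) (A B : ℂ), nullPairing (r • x + s • y) A B =
        r * nullPairing x A B + s * nullPairing y A B := fun r s x y A B => by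
      simp [nullPairing]; ring
    have l1 : ∀ (r : ℝ) (x : E3) (A B : ℂ), nullPairing (r • x) A B =
        r * nullPairing x A B := fun r x A B => by
      simp [nullPairing]; ring
    have l0 : ∀ A B : ℂ, nullPairing 0 A B = 0 := fun A B => by simp [nullPairing]
    rw [c1, l, l1] at hn
    rw [c2, sub_eq_add_neg (-(k t).im • unitTangent Γ t), ← neg_smul, l, l1] at hb
    rw [c3, l, l0] at hu
    refine (((hn.add (hb.const_mul Complex.I)).sub (((hz t).const_mul 2).mul hu)).sub
      (((hz t).pow 2).mul (hn.sub (hb.const_mul Complex.I)))).congr_deriv ?_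
    have hk1 : k t = (k t).re + (k t).im * Complex.I := (Complex.re_add_im _).symm
    have hk2 : starRingEnd ℂ (k t) = (k t).re - (k t).im * Complex.I := by
      apply Complex.ext <;> simp
    simp only [hq, hg, hk2, Pi.sub_apply, Pi.pow_apply]
    rw [show k t / 2 = ((k t).re + (k t).im * Complex.I) / 2 by rw [← hk1]]
    push_cast
    generalize nullPairing (n t) (α t) (β t) = Y
    generalize nullPairing (b t) (α t) (β t) = Z
    generalize nullPairing (unitTangent Γ t) (α t) (β t) = X
    simp only [div_eq_mul_inv (‖deriv Γ t‖ : ℂ)]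
    have hI := Complex.I_sq
    grind
  have hgT : ∀ α β, IsSpinorMotion Γ ℓ α β →
      g α β T = g α β 0 * Complex.exp (∫ t in (0 : ℝ)..T, q t) := fun α β hm =>
    eq_mul_exp_of_hasDerivAt hqc (hgd α β hm) T
  -- at the times `0` and `T`, the function `g` is the same quadratic form in the spinor
  obtain ⟨a₀, b₀, h0, hsq⟩ : ∃ a₀ b₀ : ℂ, (a₀ ≠ 0 ∨ b₀ ≠ 0) ∧ ∀ α β : ℝ → ℂ,
      g α β 0 = -2 * spinorDet a₀ b₀ (α 0) (β 0) ^ 2 ∧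
      g α β T = -2 * spinorDet a₀ b₀ (α T) (β T) ^ 2 := by
    have hp := hf.pair 0
    obtain ⟨c1, c2, c3⟩ := hp.coord
    have c4 := sq_coord_of_norm_eq_one hp.norm_cross
    have c5 := inner_cross_self_left (unitTangent Γ 0) (n 0)
    have c6 := inner_cross_self_right (unitTangent Γ 0) (n 0)
    rw [← hf.b_eq] at c4 c5 c6
    rw [inner_eq] at c5 c6
    have hT : z T = z 0 ∧ n T = n 0 ∧ b T = b 0 ∧ unitTangent Γ T = unitTangent Γ 0 := by
      have h1 := hzT 0
      have h2 := hf.periodic_n 0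
      have h3 := hΓ.unitTangent_periodic 0
      rw [zero_add] at h1 h2 h3
      exact ⟨h1, h2, by rw [hf.b_eq, hf.b_eq, h2, h3], h3⟩
    have c1' := congrArg (fun r : ℝ => (r : ℂ)) c1
    have c2' := congrArg (fun r : ℝ => (r : ℂ)) c2
    have c3' := congrArg (fun r : ℝ => (r : ℂ)) c3
    have c4' := congrArg (fun r : ℝ => (r : ℂ)) c4
    have c5' := congrArg (fun r : ℝ => (r : ℂ)) c5
    have c6' := congrArg (fun r : ℝ => (r : ℂ)) c6
    push_cast at c1' c2' c3' c4' c5' c6'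
    set N : Fin 3 → ℂ := fun i => (1 - z 0 ^ 2) * n 0 i + Complex.I * (1 + z 0 ^ 2) * b 0 i -
      2 * z 0 * unitTangent Γ 0 i with hN
    have hnull : N 0 ^ 2 + N 1 ^ 2 + N 2 ^ 2 = 0 := by
      simp only [hN]
      linear_combination (1 - z 0 ^ 2) ^ 2 * c2' + (Complex.I * (1 + z 0 ^ 2)) ^ 2 * c4' +
        (2 * z 0) ^ 2 * c1' + 2 * ((1 - z 0 ^ 2) * (Complex.I * (1 + z 0 ^ 2))) * c6' -
        2 * ((1 - z 0 ^ 2) * (2 * z 0)) * c3' -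
        2 * ((Complex.I * (1 + z 0 ^ 2)) * (2 * z 0)) * c5' +
        (1 + z 0 ^ 2) ^ 2 * Complex.I_sq
    obtain ⟨a₀, b₀, e0, e1, e2⟩ := exists_spinor_sq_eq hnull
    have key : ∀ A B : ℂ, N 0 * (A ^ 2 - B ^ 2) + N 1 * (Complex.I * (A ^ 2 + B ^ 2)) -
        N 2 * (2 * A * B) = -2 * spinorDet a₀ b₀ A B ^ 2 := fun A B => by
      rw [← e0, ← e1, ← e2]
      simp only [spinorDet]
      linear_combination (a₀ ^ 2 + b₀ ^ 2) * (A ^ 2 + B ^ 2) * Complex.I_sq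
    refine ⟨a₀, b₀, ?_, fun α β => ⟨?_, ?_⟩⟩
    · -- the null vector is not zero
      by_contra! hcon
      rw [hcon.1, hcon.2] at e0 e1 e2
      have n0 : N 0 = 0 := by rw [← e0]; ring
      have n1 : N 1 = 0 := by rw [← e1]; ring
      have n2 : N 2 = 0 := by rw [← e2]; ring
      have hn1 : 1 - z 0 ^ 2 = 0 := by
        have : N 0 * n 0 0 + N 1 * n 0 1 + N 2 * n 0 2 = 0 := by rw [n0, n1, n2]; ring
        simp only [hN] at this
        linear_combination this - (1 - z 0 ^ 2) * c2' - Complex.I * (1 + z 0 ^ 2) * c6' +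
          2 * z 0 * c3'
      have hn2 : Complex.I * (1 + z 0 ^ 2) = 0 := by
        have : N 0 * b 0 0 + N 1 * b 0 1 + N 2 * b 0 2 = 0 := by rw [n0, n1, n2]; ring
        simp only [hN] at this
        linear_combination this - (1 - z 0 ^ 2) * c6' - Complex.I * (1 + z 0 ^ 2) * c4' +
          2 * z 0 * c5'
      have hn3 := (mul_eq_zero.1 hn2).resolve_left Complex.I_ne_zero
      have : (2 : ℂ) = 0 := by linear_combination hn1 + hn3
      norm_num at this
    · rw [← key]
      simp only [hg, hN, nullPairing]
      ring
    · rw [← key]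
      simp only [hg, hN, nullPairing, hT.1, hT.2.1, hT.2.2.1, hT.2.2.2]
      ring
  obtain ⟨α, β, hm, rfl, rfl⟩ := exists_isSpinorMotion hv ℓ a₀ b₀
  have h1 : spinorDet (α 0) (β 0) (α T) (β T) = 0 := by
    have h2 := hgT α β hm
    rw [(hsq α β).1, (hsq α β).2] at h2
    have h3 : spinorDet (α 0) (β 0) (α 0) (β 0) = 0 := by simp only [spinorDet]; ring
    rw [h3] at h2
    simpa using h2
  obtain ⟨m, hm1, hm2⟩ := exists_mul_of_spinorDet_eq_zero h0 h1
  have hF : IsFloquet Γ T ℓ α β m := ⟨hm, h0, hm1, hm2⟩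
  have hm0 := hF.multiplier_ne_zero hv
  refine ⟨α, β, m, hF, ?_⟩
  -- comparison with an independent motion
  obtain ⟨α', β', hm', e1, e2⟩ := exists_isSpinorMotion hv ℓ
    (-(starRingEnd ℂ (β 0))) (starRingEnd ℂ (α 0))
  have hW0 : spinorDet (α 0) (β 0) (α' 0) (β' 0) ≠ 0 := by
    rw [e1, e2]
    have : spinorDet (α 0) (β 0) (-(starRingEnd ℂ (β 0))) (starRingEnd ℂ (α 0)) =
        (spinorNormSq (α 0) (β 0) : ℂ) := by
      simp only [spinorDet, mul_neg, sub_neg_eq_add, Complex.mul_conj, Complex.normSq_apply,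
        spinorNormSq]
      push_cast
      ring
    rw [this]
    exact_mod_cast (spinorNormSq_pos h0).ne'
  have h2 := hgT α' β' hm'
  rw [(hsq α' β').1, (hsq α' β').2] at h2
  have h3 := hm.spinorDet_eq hm' T
  rw [hm1, hm2] at h3
  have h4 : m * spinorDet (α 0) (β 0) (α' T) (β' T) = spinorDet (α 0) (β 0) (α' 0) (β' 0) := by
    rw [← h3]; simp only [spinorDet]; ring
  have h5 : spinorDet (α 0) (β 0) (α' 0) (β' 0) ^ 2 *
      (1 - m ^ 2 * Complex.exp (∫ t in (0 : ℝ)..T, q t)) = 0 := by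
    rw [← h4] at h2 ⊢
    linear_combination -m ^ 2 / 2 * h2
  have h6 := (mul_eq_zero.1 h5).resolve_left (pow_ne_zero 2 hW0)
  exact inv_eq_of_mul_eq_one_right (sub_eq_zero.1 h6).symm

end Frames

/-! ### Periodic solutions of scalar equations -/

theorem exists_norm_le_of_periodic {f : ℝ → ℂ} {T : ℝ} (hT : 0 < T) (hf : Continuous f)
    (hp : Periodic f T) : ∃ B, ∀ t, ‖f t‖ ≤ B := by
  obtain ⟨B, hB⟩ := isCompact_Icc.exists_bound_of_continuousOn (s := Icc 0 T) hf.continuousOn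
  refine ⟨B, fun t => ?_⟩
  obtain ⟨s, hs, e⟩ := hp.exists_mem_Ico₀ hT t
  rw [e]
  exact hB s (Ico_subset_Icc_self hs)

/-- A maximum principle: at a maximum of the modulus of a periodic solution of `w' = q w - g`, the
growth rate `Re q` has to be balanced by `g`. -/
theorem norm_le_of_periodic {T c B : ℝ} {w q g : ℝ → ℂ} (hT : 0 < T) (hc : 0 < c)
    (hw : Periodic w T) (hd : ∀ t, HasDerivAt w (q t * w t - g t) t) (hq : ∀ t, c ≤ (q t).re)
    (hg : ∀ t, ‖g t‖ ≤ B) (t : ℝ) : ‖w t‖ ≤ B / c := by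
  have hwc : Continuous w := continuous_iff_continuousAt.2 fun t => (hd t).continuousAt
  obtain ⟨t₀, -, hmax⟩ := isCompact_Icc.exists_isMaxOn (s := Icc 0 T) ⟨0, ⟨le_rfl, hT.le⟩⟩
    (f := fun t => (w t).re ^ 2 + (w t).im ^ 2) (by fun_prop)
  have hglob : ∀ s, (w s).re ^ 2 + (w s).im ^ 2 ≤ (w t₀).re ^ 2 + (w t₀).im ^ 2 := fun s => by
    obtain ⟨r, hr, e⟩ := hw.exists_mem_Ico₀ hT s
    rw [e]
    exact hmax (Ico_subset_Icc_self hr)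
  have hd0 := ((hasDerivAt_re (hd t₀)).pow 2).add ((hasDerivAt_im (hd t₀)).pow 2)
  have hz := IsLocalMax.hasDerivAt_eq_zero (Filter.Eventually.of_forall hglob) hd0
  have hnorm : ∀ x : ℂ, ‖x‖ ^ 2 = x.re ^ 2 + x.im ^ 2 := fun x => by
    rw [Complex.sq_norm, Complex.normSq_apply]; ring
  have hle : ‖w t‖ ≤ ‖w t₀‖ := by
    refine le_of_sq_le_sq ?_ (norm_nonneg _)
    rw [hnorm, hnorm]; exact hglob t
  refine hle.trans ?_
  have hB : 0 ≤ B := (norm_nonneg _).trans (hg 0)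
  rw [le_div_iff₀ hc]
  rcases eq_or_lt_of_le (norm_nonneg (w t₀)) with h0 | h0
  · rw [← h0]; simpa using hB
  -- the vanishing of the derivative of the squared modulus
  have h1 : (q t₀).re * ‖w t₀‖ ^ 2 = (starRingEnd ℂ (w t₀) * g t₀).re := by
    rw [hnorm]
    simp at hz ⊢
    linarith
  have h2 : (starRingEnd ℂ (w t₀) * g t₀).re ≤ ‖w t₀‖ * B := by
    refine (Complex.re_le_norm _).trans ?_
    rw [norm_mul, Complex.norm_conj]
    exact mul_le_mul_of_nonneg_left (hg t₀) h0.le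
  have h3 : c * ‖w t₀‖ ^ 2 ≤ ‖w t₀‖ * B :=
    (mul_le_mul_of_nonneg_right (hq t₀) (by positivity)).trans (h1.le.trans h2)
  nlinarith

/-- Existence of a periodic solution of an inhomogeneous linear equation with growth rate bounded
away from zero. -/
theorem exists_periodic_solution {T c : ℝ} {q g : ℝ → ℂ} (hT : 0 < T) (hc : 0 < c)
    (hqc : Continuous q) (hgc : Continuous g) (hqT : Periodic q T) (hgT : Periodic g T)
    (hq : ∀ t, c ≤ (q t).re) :
    ∃ w : ℝ → ℂ, Periodic w T ∧ ∀ t, HasDerivAt w (q t * w t - g t) t := by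
  set Q : ℝ → ℂ := fun t => ∫ s in (0 : ℝ)..t, q s with hQ
  have hQd : ∀ t, HasDerivAt Q (q t) t := fun t =>
    intervalIntegral.integral_hasDerivAt_right (hqc.intervalIntegrable _ _)
      (hqc.stronglyMeasurableAtFilter _ _) hqc.continuousAt
  have hQc : Continuous Q := continuous_iff_continuousAt.2 fun t => (hQd t).continuousAt
  have hQ0 : Q 0 = 0 := by simp [hQ]
  have hGc : Continuous fun s => Complex.exp (-Q s) * g s := by fun_prop
  set G : ℝ → ℂ := fun t => ∫ s in (0 : ℝ)..t, Complex.exp (-Q s) * g s with hG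
  have hGd : ∀ t, HasDerivAt G (Complex.exp (-Q t) * g t) t := fun t =>
    intervalIntegral.integral_hasDerivAt_right (hGc.intervalIntegrable _ _)
      (hGc.stronglyMeasurableAtFilter _ _) hGc.continuousAt
  have hEd : ∀ t, HasDerivAt (fun t => Complex.exp (Q t)) (q t * Complex.exp (Q t)) t := fun t => by
    refine (hQd t).cexp.congr_deriv ?_
    ring
  -- the homogeneous equation has no periodic solutions
  have hE : Complex.exp (Q T) - 1 ≠ 0 := by
    intro h0
    have hper : Periodic (fun t => Complex.exp (Q t)) T := fun t => by
      have h1 := eq_mul_exp_of_hasDerivAt (y := fun t => Complex.exp (Q (t + T))) hqc (fun t => by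
        have := (hEd (t + T)).comp_add_const t T
        rwa [hqT] at this) t
      simp only [zero_add] at h1
      change Complex.exp (Q (t + T)) = Complex.exp (Q t)
      rw [h1, sub_eq_zero.1 h0, one_mul]
    have h1 := norm_le_of_periodic (g := 0) (B := 0) hT hc hper
      (fun t => by simpa using hEd t) hq (by simp) 0
    simp [hQ0] at h1
    exact absurd h1 (by norm_num)
  set A : ℂ := Complex.exp (Q T) * G T / (Complex.exp (Q T) - 1) with hA
  set w : ℝ → ℂ := fun t => Complex.exp (Q t) * (A - G t) with hw
  have hwd : ∀ t, HasDerivAt w (q t * w t - g t) t := fun t => by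
    refine ((hEd t).mul ((hGd t).const_sub A)).congr_deriv ?_
    have : Complex.exp (Q t) * Complex.exp (-Q t) = 1 := by
      rw [← Complex.exp_add]; simp
    simp only [hw]
    linear_combination -g t * this
  refine ⟨w, fun t => ?_, hwd⟩
  have hG0 : G 0 = 0 := by simp [hG]
  have h0 : w T - w 0 = 0 := by
    simp only [hw, hQ0, hG0, Complex.exp_zero]
    rw [hA]
    field_simp
    ring
  have h1 := eq_mul_exp_of_hasDerivAt (y := fun t => w (t + T) - w t) hqc (fun t => by
    refine (((hwd (t + T)).comp_add_const t T).sub (hwd t)).congr_deriv ?_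
    rw [hqT, hgT]
    ring) t
  simp only [zero_add, h0, zero_mul] at h1
  exact sub_eq_zero.1 h1

/-! ### Periodic solutions of the Riccati equation with a large parameter -/

/-- The coefficients of the Riccati equation `z' = η p z - (c₀ + c₁ z + c₂ z²)` with a complex
parameter `η`: smooth periodic functions, `p` being real and positive. -/
structure RiccatiData where
  /-- The period. -/
  T : ℝ
  /-- The coefficient of the parameter. -/
  p : ℝ → ℝ
  /-- The constant coefficient. -/
  c₀ : ℝ → ℂ
  /-- The linear coefficient. -/
  c₁ : ℝ → ℂ
  /-- The quadratic coefficient. -/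
  c₂ : ℝ → ℂ
  T_pos : 0 < T
  p_pos : ∀ t, 0 < p t
  smooth_p : ContDiff ℝ ∞ p
  smooth_c₀ : ContDiff ℝ ∞ c₀
  smooth_c₁ : ContDiff ℝ ∞ c₁
  smooth_c₂ : ContDiff ℝ ∞ c₂
  periodic_p : Periodic p T
  periodic_c₀ : Periodic c₀ T
  periodic_c₁ : Periodic c₁ T
  periodic_c₂ : Periodic c₂ T

namespace RiccatiData

variable (D : RiccatiData)

/-- `z` is a periodic solution of the Riccati equation in the unit disc. -/
structure IsSol (η : ℂ) (z : ℝ → ℂ) : Prop where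
  periodic : Periodic z D.T
  norm_le : ∀ t, ‖z t‖ ≤ 1
  hasDerivAt : ∀ t, HasDerivAt z
    (D.p t * η * z t - (D.c₀ t + D.c₁ t * z t + D.c₂ t * z t ^ 2)) t

theorem IsSol.continuous {D : RiccatiData} {η : ℂ} {z : ℝ → ℂ} (h : D.IsSol η z) : Continuous z :=
  continuous_iff_continuousAt.2 fun t => (h.hasDerivAt t).continuousAt

theorem continuous_ofReal_p : Continuous fun t => (D.p t : ℂ) :=
  Complex.continuous_ofReal.comp D.smooth_p.continuous

theorem periodic_ofReal_p : Periodic (fun t => (D.p t : ℂ)) D.T := fun t => by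
  simp only [D.periodic_p t]

/-- Bounds for the coefficients. -/
structure IsBound (p₀ K : ℝ) : Prop where
  p₀_pos : 0 < p₀
  K_pos : 0 < K
  le_p : ∀ t, p₀ ≤ D.p t
  norm_p_le : ∀ t, ‖(D.p t : ℂ)‖ ≤ K
  norm_c₀_le : ∀ t, ‖D.c₀ t‖ ≤ K
  norm_c₁_le : ∀ t, ‖D.c₁ t‖ ≤ K
  norm_c₂_le : ∀ t, ‖D.c₂ t‖ ≤ K

theorem exists_isBound : ∃ p₀ K, D.IsBound p₀ K := by
  obtain ⟨B, hB⟩ := exists_norm_le_of_periodic D.T_pos D.continuous_ofReal_p D.periodic_ofReal_p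
  obtain ⟨B', hB'⟩ := exists_norm_le_of_periodic (f := fun t => (D.p t : ℂ)⁻¹) D.T_pos
    (D.continuous_ofReal_p.inv₀ fun t => by exact_mod_cast (D.p_pos t).ne')
    (fun t => by simp only [D.periodic_p t])
  obtain ⟨K₀, h₀⟩ := exists_norm_le_of_periodic D.T_pos D.smooth_c₀.continuous D.periodic_c₀
  obtain ⟨K₁, h₁⟩ := exists_norm_le_of_periodic D.T_pos D.smooth_c₁.continuous D.periodic_c₁
  obtain ⟨K₂, h₂⟩ := exists_norm_le_of_periodic D.T_pos D.smooth_c₂.continuous D.periodic_c₂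
  have hpn : ∀ t, ‖(D.p t : ℂ)‖ = D.p t := fun t => by
    rw [Complex.norm_real, Real.norm_of_nonneg (D.p_pos t).le]
  have hBp : 0 < B := (D.p_pos 0).trans_le ((hpn 0).symm.le.trans (hB 0))
  have hB'p : 0 < B' := (inv_pos.2 (D.p_pos 0)).trans_le
    (by simpa only [norm_inv, hpn] using hB' 0)
  have p0 := (norm_nonneg _).trans (h₀ 0)
  have p1 := (norm_nonneg _).trans (h₁ 0)
  have p2 := (norm_nonneg _).trans (h₂ 0)
  refine ⟨B'⁻¹, B + K₀ + K₁ + K₂, inv_pos.2 hB'p, by positivity, fun t => ?_, fun t => ?_,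
    fun t => ?_, fun t => ?_, fun t => ?_⟩
  · have := hB' t
    rw [norm_inv, hpn] at this
    rw [inv_le_comm₀ hB'p (D.p_pos t)]
    exact this
  · linarith [hB t]
  · linarith [h₀ t]
  · linarith [h₁ t]
  · linarith [h₂ t]

variable {D} {p₀ K : ℝ}

/-- For parameters with a large real part, a lower bound for the linearized growth rate along a
function in the disc of radius two. -/
theorem IsBound.le_re (hb : D.IsBound p₀ K) {η : ℂ} (hη : 6 * K / p₀ ≤ η.re) {s : ℂ} (hs : ‖s‖ ≤ 2)
    (t : ℝ) : 3 * K ≤ (D.p t * η - D.c₁ t - D.c₂ t * s).re := by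
  have h1 : 6 * K ≤ D.p t * η.re := by
    have h2 : 6 * K ≤ η.re * p₀ := (div_le_iff₀ hb.p₀_pos).1 hη
    have h3 : 0 ≤ η.re := (div_nonneg (by linarith [hb.K_pos]) hb.p₀_pos.le).trans hη
    nlinarith [hb.le_p t]
  have h2 : (D.c₁ t).re ≤ K := (Complex.re_le_norm _).trans (hb.norm_c₁_le t)
  have h3 : (D.c₂ t * s).re ≤ K * 2 := by
    refine (Complex.re_le_norm _).trans ?_
    rw [norm_mul]
    exact mul_le_mul (hb.norm_c₂_le t) hs (norm_nonneg _) hb.K_pos.le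
  simp only [Complex.sub_re, Complex.re_ofReal_mul]
  linarith

/-- Existence of a periodic solution for parameters with a large real part, as the fixed point of a
contraction. -/
theorem IsBound.exists_isSol (hb : D.IsBound p₀ K) {η : ℂ} (hη : 6 * K / p₀ ≤ η.re) :
    ∃ z, D.IsSol η z := by
  have hK := hb.K_pos
  have hq : ∀ t, 6 * K ≤ ((D.p t : ℂ) * η).re := fun t => by
    have h2 : 6 * K ≤ η.re * p₀ := (div_le_iff₀ hb.p₀_pos).1 hη
    have h3 : 0 ≤ η.re := (div_nonneg (by linarith [hb.K_pos]) hb.p₀_pos.le).trans hη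
    rw [Complex.re_ofReal_mul]
    nlinarith [hb.le_p t]
  have hc₀ := D.smooth_c₀.continuous
  have hc₁ := D.smooth_c₁.continuous
  have hc₂ := D.smooth_c₂.continuous
  have hpc := D.continuous_ofReal_p
  set S : Set (BoundedContinuousFunction ℝ ℂ) :=
    {f | (∀ t, f (t + D.T) = f t) ∧ ∀ t, ‖f t‖ ≤ 1} with hS
  have hSclosed : IsClosed S := by
    have e : S = (⋂ t, {f | f (t + D.T) = f t}) ∩ ⋂ t, {f | ‖f t‖ ≤ 1} := by
      ext f; simp [hS]
    rw [e]
    refine (isClosed_iInter fun t => ?_).inter (isClosed_iInter fun t => ?_)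
    · exact isClosed_eq (continuous_eval_const _) (continuous_eval_const _)
    · exact isClosed_le (continuous_eval_const _).norm continuous_const
  -- the map given by the linear equation with the nonlinear terms frozen
  have hmap : ∀ f : BoundedContinuousFunction ℝ ℂ, ∃ w : BoundedContinuousFunction ℝ ℂ, f ∈ S →
      w ∈ S ∧ ∀ t, HasDerivAt w
        (D.p t * η * w t - (D.c₀ t + D.c₁ t * f t + D.c₂ t * f t ^ 2)) t := by
    intro f
    by_cases hf : f ∈ S
    · have hgc : Continuous fun t => D.c₀ t + D.c₁ t * f t + D.c₂ t * f t ^ 2 := by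
        have := f.continuous
        fun_prop
      obtain ⟨w, hwT, hw⟩ := exists_periodic_solution (c := 6 * K) D.T_pos (by positivity)
        (hpc.mul_const η) hgc
        (fun t => by simp only [D.periodic_p t])
        (fun t => by
          simp only [D.periodic_c₀ t, D.periodic_c₁ t, D.periodic_c₂ t, hf.1 t]) hq
      have hbound : ∀ t, ‖D.c₀ t + D.c₁ t * f t + D.c₂ t * f t ^ 2‖ ≤ 3 * K := fun t => by
        have h1 := hf.2 t
        have h2 := hb.norm_c₀_le t
        have h3 : ‖D.c₁ t * f t‖ ≤ K * 1 := by
          rw [norm_mul]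
          exact mul_le_mul (hb.norm_c₁_le t) h1 (norm_nonneg _) hK.le
        have h4 : ‖D.c₂ t * f t ^ 2‖ ≤ K * 1 := by
          rw [norm_mul, norm_pow]
          exact mul_le_mul (hb.norm_c₂_le t) (pow_le_one₀ (norm_nonneg _) h1) (by positivity) hK.le
        refine (norm_add₃_le).trans ?_
        linarith
      have hw1 : ∀ t, ‖w t‖ ≤ 1 := fun t => by
        refine (norm_le_of_periodic D.T_pos (by positivity) hwT hw hq hbound t).trans ?_
        rw [div_le_one (by positivity)]
        linarith
      have hwc : Continuous w := continuous_iff_continuousAt.2 fun t => (hw t).continuousAt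
      exact ⟨BoundedContinuousFunction.ofNormedAddCommGroup w hwc 1 hw1,
        fun _ => ⟨⟨hwT, hw1⟩, hw⟩⟩
    · exact ⟨0, fun h => absurd h hf⟩
  choose Φ hΦ using hmap
  have hmaps : MapsTo Φ S S := fun f hf => (hΦ f hf).1
  have hcontr : ContractingWith (1 / 2) (hmaps.restrict Φ S S) := by
    refine ⟨by norm_num, LipschitzWith.of_dist_le_mul fun f g => ?_⟩
    rw [Subtype.dist_eq, Subtype.dist_eq, MapsTo.val_restrict_apply, MapsTo.val_restrict_apply,
      BoundedContinuousFunction.dist_le (by positivity)]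
    intro t
    obtain ⟨f, hf⟩ := f
    obtain ⟨g, hg⟩ := g
    have hd : ∀ t, HasDerivAt (fun t => Φ f t - Φ g t) (D.p t * η * (Φ f t - Φ g t) -
        (D.c₁ t + D.c₂ t * (f t + g t)) * (f t - g t)) t := fun t => by
      refine (((hΦ f hf).2 t).sub ((hΦ g hg).2 t)).congr_deriv ?_
      ring
    have hper : Periodic (fun t => Φ f t - Φ g t) D.T := fun t => by
      simp only [(hmaps hf).1 t, (hmaps hg).1 t]
    have hbound : ∀ t, ‖(D.c₁ t + D.c₂ t * (f t + g t)) * (f t - g t)‖ ≤ 3 * K * dist f g :=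
      fun t => by
        rw [norm_mul]
        refine mul_le_mul ?_ ?_ (norm_nonneg _) (by positivity)
        · have h1 : ‖f t + g t‖ ≤ 2 := (norm_add_le _ _).trans (by linarith [hf.2 t, hg.2 t])
          have h2 : ‖D.c₂ t * (f t + g t)‖ ≤ K * 2 := by
            rw [norm_mul]
            exact mul_le_mul (hb.norm_c₂_le t) h1 (norm_nonneg _) hK.le
          refine (norm_add_le _ _).trans ?_
          linarith [hb.norm_c₁_le t]
        · rw [← dist_eq_norm]
          exact BoundedContinuousFunction.dist_coe_le_dist t
    have := norm_le_of_periodic D.T_pos (by positivity) hper hd hq hbound t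
    rw [dist_eq_norm]
    refine this.trans (le_of_eq ?_)
    simp only [NNReal.coe_div, NNReal.coe_one, NNReal.coe_ofNat]
    field_simp
    ring
  obtain ⟨z, hz, hfix, -⟩ := hcontr.exists_fixedPoint' hSclosed.isComplete hmaps
    (x := 0) ⟨fun t => rfl, fun t => by simp⟩ (edist_ne_top _ _)
  refine ⟨z, hz.1, hz.2, fun t => ?_⟩
  have := (hΦ z hz).2 t
  rwa [hfix] at this

theorem hasDerivAt_of_norm_le_sq {f : ℂ → ℂ} {f' x : ℂ} {C : ℝ}
    (h : ∀ᶠ y in nhds x, ‖f y - f x - (y - x) * f'‖ ≤ C * ‖y - x‖ ^ 2) : HasDerivAt f f' x := by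
  rw [hasDerivAt_iff_isLittleO]
  have h1 : (fun y => f y - f x - (y - x) • f') =O[nhds x] fun y => (y - x) ^ 2 :=
    Asymptotics.IsBigO.of_bound C (by simpa [norm_pow] using h)
  refine h1.trans_isLittleO ?_
  have h2 : (fun y : ℂ => (y - x) ^ 2) =o[nhds x] fun y => y - x := by
    have := Asymptotics.isLittleO_pow_sub_sub x (m := 2) (by norm_num)
    exact (Asymptotics.isLittleO_norm_left.1 (by simpa [norm_pow] using this))
  exact h2

/-- The periodic solutions depend holomorphically on the parameter; the estimates for the difference
quotients come from the maximum principle. -/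
theorem IsBound.exists_hasDerivAt_integral (hb : D.IsBound p₀ K) {z : ℂ → ℝ → ℂ}
    (hz : ∀ η : ℂ, 6 * K / p₀ ≤ η.re → D.IsSol η (z η)) {η₀ : ℂ} (hη₀ : 6 * K / p₀ < η₀.re) :
    ∃ J', HasDerivAt (fun η => ∫ t in (0 : ℝ)..D.T, D.c₂ t * z η t) J' η₀ := by
  have hK := hb.K_pos
  have hz0 := hz η₀ hη₀.le
  have hc₁ := D.smooth_c₁.continuous
  have hc₂ := D.smooth_c₂.continuous
  have hpc := D.continuous_ofReal_p
  have hz0c := hz0.continuous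
  have hQ : ∀ t, 3 * K ≤ (D.p t * η₀ - D.c₁ t - D.c₂ t * (2 * z η₀ t)).re := fun t =>
    hb.le_re hη₀.le (by rw [norm_mul]; simpa using hz0.norm_le t) t
  -- the derivative of the solution with respect to the parameter
  obtain ⟨w, hwT, hw⟩ := exists_periodic_solution (g := fun t => -(D.p t * z η₀ t))
    (q := fun t => D.p t * η₀ - D.c₁ t - D.c₂ t * (2 * z η₀ t)) (c := 3 * K) D.T_pos
    (by positivity) (by fun_prop) (by fun_prop)
    (fun t => by simp only [D.periodic_p t, D.periodic_c₁ t, D.periodic_c₂ t, hz0.periodic t])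
    (fun t => by simp only [D.periodic_p t, hz0.periodic t]) hQ
  have hwc : Continuous w := continuous_iff_continuousAt.2 fun t => (hw t).continuousAt
  refine ⟨∫ t in (0 : ℝ)..D.T, D.c₂ t * w t,
    hasDerivAt_of_norm_le_sq (C := K / 3 * |D.T - 0|) ?_⟩
  have hev : ∀ᶠ η : ℂ in nhds η₀, 6 * K / p₀ < η.re :=
    Complex.continuous_re.continuousAt.eventually_const_lt hη₀
  filter_upwards [hev] with η hη
  have hz1 := hz η hη.le
  have hz1c := hz1.continuous
  set h := η - η₀ with hh
  have hpz : ∀ t x, ‖x‖ ≤ 1 → ‖(D.p t : ℂ) * x‖ ≤ K := fun t x hx => by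
    rw [norm_mul]
    simpa using mul_le_mul (hb.norm_p_le t) hx (norm_nonneg _) hK.le
  have hδ : ∀ t, ‖z η t - z η₀ t‖ ≤ ‖h‖ / 3 := fun t => by
    have := norm_le_of_periodic (w := fun t => z η t - z η₀ t)
      (q := fun t => D.p t * η₀ - D.c₁ t - D.c₂ t * (z η t + z η₀ t))
      (g := fun t => -h * (D.p t * z η t)) (c := 3 * K) (B := ‖h‖ * K) D.T_pos
      (by positivity) (fun t => by simp only [hz0.periodic t, hz1.periodic t])
      (fun t => by
        refine ((hz1.hasDerivAt t).sub (hz0.hasDerivAt t)).congr_deriv ?_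
        rw [hh]
        ring)
      (fun t => hb.le_re hη₀.le
        ((norm_add_le _ _).trans (by linarith [hz0.norm_le t, hz1.norm_le t])) t)
      (fun t => by
        rw [norm_mul, norm_neg]
        exact mul_le_mul_of_nonneg_left (hpz t _ (hz1.norm_le t)) (norm_nonneg _)) t
    refine this.trans (le_of_eq ?_)
    field_simp
  have he : ∀ t, ‖z η t - z η₀ t - h * w t‖ ≤ ‖h‖ ^ 2 / 3 := fun t => by
    have := norm_le_of_periodic (w := fun t => z η t - z η₀ t - h * w t)
      (q := fun t => D.p t * η₀ - D.c₁ t - D.c₂ t * (2 * z η₀ t))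
      (g := fun t => D.c₂ t * (z η t - z η₀ t) ^ 2 - h * (D.p t * (z η t - z η₀ t)))
      (c := 3 * K) (B := K * ‖h‖ ^ 2) D.T_pos
      (by positivity)
      (fun t => by simp only [hz0.periodic t, hz1.periodic t, hwT t])
      (fun t => by
        refine (((hz1.hasDerivAt t).sub (hz0.hasDerivAt t)).sub
          ((hw t).const_mul h)).congr_deriv ?_
        rw [hh]
        ring)
      hQ
      (fun t => by
        have h1 : ‖D.c₂ t * (z η t - z η₀ t) ^ 2‖ ≤ K * (‖h‖ / 3) ^ 2 := by
          rw [norm_mul, norm_pow]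
          exact mul_le_mul (hb.norm_c₂_le t) (pow_le_pow_left₀ (norm_nonneg _) (hδ t) 2)
            (by positivity) hK.le
        have h2 : ‖h * (D.p t * (z η t - z η₀ t))‖ ≤ ‖h‖ * (K * (‖h‖ / 3)) := by
          rw [norm_mul, norm_mul]
          gcongr
          · exact hb.norm_p_le t
          · exact hδ t
        refine (norm_sub_le _ _).trans ?_
        nlinarith [mul_nonneg hK.le (sq_nonneg ‖h‖)]) t
    refine this.trans (le_of_eq ?_)
    field_simp
  have hint : ∀ f : ℝ → ℂ, Continuous f →
      IntervalIntegrable (fun t => D.c₂ t * f t) MeasureTheory.volume 0 D.T := fun f hf =>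
    (hc₂.mul hf).intervalIntegrable _ _
  have e : (∫ t in (0 : ℝ)..D.T, D.c₂ t * z η t) - (∫ t in (0 : ℝ)..D.T, D.c₂ t * z η₀ t) -
      h * (∫ t in (0 : ℝ)..D.T, D.c₂ t * w t) =
      ∫ t in (0 : ℝ)..D.T, D.c₂ t * (z η t - z η₀ t - h * w t) := by
    rw [← intervalIntegral.integral_const_mul, ← intervalIntegral.integral_sub (hint _ hz1c)
      (hint _ hz0c), ← intervalIntegral.integral_sub ((hint _ hz1c).sub (hint _ hz0c))
      ((hint _ hwc).const_mul h)]
    congr 1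
    funext t
    ring
  rw [e]
  refine (intervalIntegral.norm_integral_le_of_norm_le_const (C := K * (‖h‖ ^ 2 / 3))
    fun t _ => ?_).trans (le_of_eq (by ring))
  rw [norm_mul]
  exact mul_le_mul (hb.norm_c₂_le t) (he t) (norm_nonneg _) hK.le

end RiccatiData

/-! ### Asymptotic expansion of the periodic solutions -/

/-- The quadratic part of a Cauchy product of truncated power series, beyond the order of the
truncation. -/
theorem norm_sq_sum_sub_le (Z : ℕ → ℂ) (N : ℕ) {ζ : ℂ} (hζ : ‖ζ‖ ≤ 1) {B : ℝ}
    (hB : ∀ n ≤ N, ‖Z n‖ ≤ B) :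
    ‖(∑ n ∈ Finset.range (N + 1), Z n * ζ ^ n) ^ 2 -
      ∑ n ∈ Finset.range N, (∑ j ∈ Finset.range (n + 1), Z j * Z (n - j)) * ζ ^ n‖ ≤
      (N + 1) ^ 2 * B ^ 2 * ‖ζ‖ ^ N := by
  set s := Finset.range (N + 1) ×ˢ Finset.range (N + 1) with hs
  have h1 : (∑ n ∈ Finset.range (N + 1), Z n * ζ ^ n) ^ 2 =
      ∑ q ∈ s, Z q.1 * Z q.2 * ζ ^ (q.1 + q.2) := by
    rw [sq, Finset.sum_mul_sum, hs, Finset.sum_product]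
    refine Finset.sum_congr rfl fun i _ => Finset.sum_congr rfl fun j _ => ?_
    ring
  have h2 : ∑ n ∈ Finset.range N, (∑ j ∈ Finset.range (n + 1), Z j * Z (n - j)) * ζ ^ n =
      ∑ q ∈ s with q.1 + q.2 < N, Z q.1 * Z q.2 * ζ ^ (q.1 + q.2) := by
    have hmaps : ∀ q ∈ s.filter (fun q => q.1 + q.2 < N), q.1 + q.2 ∈ Finset.range N :=
      fun q hq => Finset.mem_range.2 (Finset.mem_filter.1 hq).2
    rw [← Finset.sum_fiberwise_of_maps_to hmaps]
    refine Finset.sum_congr rfl fun n hn => ?_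
    rw [Finset.sum_mul]
    have hn' := Finset.mem_range.1 hn
    refine Finset.sum_bij' (fun j _ => (j, n - j)) (fun q _ => q.1) ?_ ?_ ?_ ?_ ?_
    · intro j hj
      have := Finset.mem_range.1 hj
      simp only [hs, Finset.mem_filter, Finset.mem_product, Finset.mem_range]
      omega
    · intro q hq
      simp only [hs, Finset.mem_filter, Finset.mem_product, Finset.mem_range] at hq ⊢
      omega
    · intro j hj
      rfl
    · intro q hq
      simp only [hs, Finset.mem_filter, Finset.mem_product, Finset.mem_range] at hq
      ext
      · rfl
      · simp only
        omega
    · intro j hj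
      have := Finset.mem_range.1 hj
      simp only
      rw [show j + (n - j) = n by omega]
  have h3 := Finset.sum_filter_add_sum_filter_not s (fun q : ℕ × ℕ => q.1 + q.2 < N)
    fun q => Z q.1 * Z q.2 * ζ ^ (q.1 + q.2)
  rw [h1, h2, ← h3, add_sub_cancel_left]
  have hB0 : 0 ≤ B := (norm_nonneg _).trans (hB 0 (Nat.zero_le _))
  have hcard : ((s.filter fun q : ℕ × ℕ => ¬q.1 + q.2 < N).card : ℝ) ≤ (N + 1) ^ 2 := by
    have := Finset.card_filter_le s fun q : ℕ × ℕ => ¬q.1 + q.2 < N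
    have h4 : s.card = (N + 1) ^ 2 := by rw [hs, Finset.card_product, Finset.card_range, sq]
    rw [h4] at this
    exact_mod_cast this
  calc _ ≤ ∑ q ∈ s with ¬q.1 + q.2 < N, B ^ 2 * ‖ζ‖ ^ N := by
        refine norm_sum_le_of_le _ fun q hq => ?_
        simp only [hs, Finset.mem_filter, Finset.mem_product, Finset.mem_range] at hq
        rw [norm_mul, norm_mul, norm_pow, sq]
        have e1 := hB q.1 (by omega)
        have e2 := hB q.2 (by omega)
        have e3 : ‖ζ‖ ^ (q.1 + q.2) ≤ ‖ζ‖ ^ N :=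
          pow_le_pow_of_le_one (norm_nonneg _) hζ (by omega)
        gcongr
    _ = (s.filter fun q : ℕ × ℕ => ¬q.1 + q.2 < N).card * (B ^ 2 * ‖ζ‖ ^ N) := by
        rw [Finset.sum_const, nsmul_eq_mul]
    _ ≤ (N + 1) ^ 2 * (B ^ 2 * ‖ζ‖ ^ N) := by gcongr
    _ = _ := by ring

namespace RiccatiData

variable {D : RiccatiData} {p₀ K : ℝ}

/-- The coefficients of a formal power series solution of the Riccati equation in powers of
`η⁻¹`. -/
structure IsFormalSol (D : RiccatiData) (Z : ℕ → ℝ → ℂ) : Prop where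
  zero : ∀ t, Z 0 t = 0
  smooth : ∀ n, ContDiff ℝ ∞ (Z n)
  periodic : ∀ n, Periodic (Z n) D.T
  succ : ∀ n t, D.p t * Z (n + 1) t = deriv (Z n) t + D.c₁ t * Z n t +
    (if n = 0 then D.c₀ t else 0) + D.c₂ t * ∑ j ∈ Finset.range (n + 1), Z j t * Z (n - j) t

/-- A formal power series solution is the asymptotic expansion of the periodic solutions in the
sector `|η| ≤ 2 Re η`. -/
theorem IsFormalSol.exists_norm_sub_le (hb : D.IsBound p₀ K) {Z : ℕ → ℝ → ℂ}
    (hZ : D.IsFormalSol Z) {N : ℕ} (hN : N ≠ 0) :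
    ∃ C R : ℝ, 0 ≤ C ∧ ∀ (η : ℂ) (z : ℝ → ℂ), R ≤ ‖η‖ → ‖η‖ ≤ 2 * η.re → D.IsSol η z →
      ∀ t, ‖z t - ∑ n ∈ Finset.range (N + 1), Z n t * η⁻¹ ^ n‖ ≤ C * ‖η⁻¹‖ ^ (N + 1) := by
  have hK := hb.K_pos
  have hp₀ := hb.p₀_pos
  have hZc : ∀ n, Continuous (Z n) := fun n => (hZ.smooth n).continuous
  have hZd : ∀ n t, HasDerivAt (Z n) (deriv (Z n) t) t := fun n t =>
    ((contDiff_infty_iff_deriv.1 (hZ.smooth n)).1 t).hasDerivAt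
  -- bounds for the coefficients
  obtain ⟨B, hB0, hB⟩ : ∃ B : ℝ, 0 ≤ B ∧ ∀ n ≤ N, ∀ t, ‖Z n t‖ ≤ B := by
    choose b hb using fun n => exists_norm_le_of_periodic D.T_pos (hZc n) (hZ.periodic n)
    have hb0 : ∀ n, 0 ≤ b n := fun n => (norm_nonneg _).trans (hb n 0)
    refine ⟨∑ n ∈ Finset.range (N + 1), b n, Finset.sum_nonneg fun n _ => hb0 n,
      fun n hn t => (hb n t).trans ?_⟩
    exact Finset.single_le_sum (fun n _ => hb0 n) (Finset.mem_range.2 (by omega))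
  obtain ⟨B', hB'⟩ : ∃ B' : ℝ, ∀ t, ‖deriv (Z N) t + D.c₁ t * Z N t‖ ≤ B' := by
    refine exists_norm_le_of_periodic D.T_pos ?_ fun t => ?_
    · have h1 := (contDiff_infty_iff_deriv.1 (hZ.smooth N)).2.continuous
      have h2 := D.smooth_c₁.continuous
      have h3 := hZc N
      fun_prop
    · have h1 : deriv (Z N) (t + D.T) = deriv (Z N) t := by
        rw [← deriv_comp_add_const]; congr 1; exact funext (hZ.periodic N)
      simp only [h1, D.periodic_c₁ t, hZ.periodic N t]
  have hB'0 : 0 ≤ B' := (norm_nonneg _).trans (hB' 0)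
  set M : ℝ := (N + 1) * B with hM
  have hM0 : 0 ≤ M := by positivity
  set C' : ℝ := B' + K * ((N + 1) ^ 2 * B ^ 2) with hC'
  have hC'0 : 0 ≤ C' := by positivity
  refine ⟨4 * C' / p₀, 1 + 4 * K * (2 + M) / p₀, by positivity, fun η z hη hηs hz => ?_⟩
  have hη1 : 1 ≤ ‖η‖ := le_trans (by linarith [show 0 ≤ 4 * K * (2 + M) / p₀ by positivity]) hη
  have hη0 : η ≠ 0 := by
    rintro rfl
    norm_num at hη1
  have hη2 : K * (2 + M) ≤ p₀ * ‖η‖ / 4 := by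
    have : 4 * K * (2 + M) / p₀ ≤ ‖η‖ := by linarith
    rw [div_le_iff₀ hp₀] at this
    linarith
  set ζ := η⁻¹ with hζ
  have hζη : η * ζ = 1 := mul_inv_cancel₀ hη0
  have hζ1 : ‖ζ‖ ≤ 1 := by
    rw [hζ, norm_inv]
    exact inv_le_one_of_one_le₀ hη1
  set P : ℝ → ℂ := fun t => ∑ n ∈ Finset.range (N + 1), Z n t * ζ ^ n with hP
  have hPd : ∀ t, HasDerivAt P (∑ n ∈ Finset.range (N + 1), deriv (Z n) t * ζ ^ n) t := fun t =>
    HasDerivAt.fun_sum fun n _ => (hZd n t).mul_const _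
  have hPT : Periodic P D.T := fun t => by
    simp only [hP, hZ.periodic _ t]
  have hPn : ∀ t, ‖P t‖ ≤ M := fun t => by
    refine (norm_sum_le_of_le (f := fun n => Z n t * ζ ^ n) (n := fun _ => B) _
      fun n hn => ?_).trans ?_
    · rw [norm_mul, norm_pow]
      have := hB n (by have := Finset.mem_range.1 hn; omega) t
      calc ‖Z n t‖ * ‖ζ‖ ^ n ≤ B * 1 :=
            mul_le_mul this (pow_le_one₀ (norm_nonneg _) hζ1) (by positivity) hB0
        _ = B := mul_one _
    · simp [hM]
  -- the residual of the truncated series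
  set Rem : ℝ → ℂ := fun t => (deriv (Z N) t + D.c₁ t * Z N t) * ζ ^ N +
    D.c₂ t * (P t ^ 2 - ∑ n ∈ Finset.range N,
      (∑ j ∈ Finset.range (n + 1), Z j t * Z (n - j) t) * ζ ^ n) with hRem
  have hRemn : ∀ t, ‖Rem t‖ ≤ C' * ‖ζ‖ ^ N := fun t => by
    have h1 : ‖(deriv (Z N) t + D.c₁ t * Z N t) * ζ ^ N‖ ≤ B' * ‖ζ‖ ^ N := by
      rw [norm_mul, norm_pow]
      exact mul_le_mul_of_nonneg_right (hB' t) (by positivity)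
    have h2 : ‖D.c₂ t * (P t ^ 2 - ∑ n ∈ Finset.range N,
        (∑ j ∈ Finset.range (n + 1), Z j t * Z (n - j) t) * ζ ^ n)‖ ≤
        K * ((N + 1) ^ 2 * B ^ 2 * ‖ζ‖ ^ N) := by
      rw [norm_mul]
      exact mul_le_mul (hb.norm_c₂_le t)
        (norm_sq_sum_sub_le (fun n => Z n t) N hζ1 fun n hn => hB n hn t) (norm_nonneg _) hK.le
    refine (norm_add_le _ _).trans ((add_le_add h1 h2).trans (le_of_eq ?_))
    rw [hC']
    ring
  have hPeq : ∀ t, ∑ n ∈ Finset.range (N + 1), deriv (Z n) t * ζ ^ n =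
      D.p t * η * P t - (D.c₀ t + D.c₁ t * P t + D.c₂ t * P t ^ 2) + Rem t := fun t => by
    have e1 : D.p t * η * P t = ∑ n ∈ Finset.range N, (D.p t * Z (n + 1) t) * ζ ^ n := by
      simp only [hP]
      rw [Finset.sum_range_succ', hZ.zero, zero_mul, add_zero, Finset.mul_sum]
      refine Finset.sum_congr rfl fun n _ => ?_
      rw [pow_succ]
      linear_combination D.p t * Z (n + 1) t * ζ ^ n * hζη
    have e2 : ∑ n ∈ Finset.range N, (if n = 0 then D.c₀ t else 0) * ζ ^ n = D.c₀ t := by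
      rw [Finset.sum_eq_single 0]
      · simp
      · intro n _ hn
        simp [hn]
      · intro h
        exact absurd (Finset.mem_range.2 (Nat.pos_of_ne_zero hN)) h
    have e3 : D.c₁ t * P t = (∑ n ∈ Finset.range N, D.c₁ t * Z n t * ζ ^ n) +
        D.c₁ t * Z N t * ζ ^ N := by
      simp only [hP]
      rw [Finset.mul_sum, Finset.sum_range_succ]
      congr 1
      · exact Finset.sum_congr rfl fun n _ => by ring
      · ring
    have e4 : D.c₂ t * ∑ n ∈ Finset.range N,
        (∑ j ∈ Finset.range (n + 1), Z j t * Z (n - j) t) * ζ ^ n =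
        ∑ n ∈ Finset.range N,
          (D.c₂ t * ∑ j ∈ Finset.range (n + 1), Z j t * Z (n - j) t) * ζ ^ n := by
      rw [Finset.mul_sum]
      exact Finset.sum_congr rfl fun n _ => by ring
    have e5 : D.p t * η * P t = (∑ n ∈ Finset.range N, deriv (Z n) t * ζ ^ n) +
        (∑ n ∈ Finset.range N, D.c₁ t * Z n t * ζ ^ n) + D.c₀ t +
        D.c₂ t * ∑ n ∈ Finset.range N,
          (∑ j ∈ Finset.range (n + 1), Z j t * Z (n - j) t) * ζ ^ n := by
      rw [e1, e4, ← e2, ← Finset.sum_add_distrib, ← Finset.sum_add_distrib,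
        ← Finset.sum_add_distrib]
      refine Finset.sum_congr rfl fun n _ => ?_
      rw [hZ.succ]
      ring
    rw [Finset.sum_range_succ, e5, e3]
    simp only [hRem]
    ring
  intro t
  have hre : ∀ t, p₀ * ‖η‖ / 4 ≤ (D.p t * η - D.c₁ t - D.c₂ t * (z t + P t)).re := fun t => by
    have h1 : p₀ * ‖η‖ / 2 ≤ D.p t * η.re := by
      have : 0 ≤ η.re := by linarith
      nlinarith [hb.le_p t]
    have h2 : (D.c₁ t).re ≤ K := (Complex.re_le_norm _).trans (hb.norm_c₁_le t)
    have h3 : (D.c₂ t * (z t + P t)).re ≤ K * (1 + M) := by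
      refine (Complex.re_le_norm _).trans ?_
      rw [norm_mul]
      exact mul_le_mul (hb.norm_c₂_le t)
        ((norm_add_le _ _).trans (add_le_add (hz.norm_le t) (hPn t))) (norm_nonneg _) hK.le
    simp only [Complex.sub_re, Complex.re_ofReal_mul]
    linarith
  have := norm_le_of_periodic (w := fun t => z t - P t)
    (q := fun t => D.p t * η - D.c₁ t - D.c₂ t * (z t + P t)) (g := Rem) D.T_pos
    (by positivity) (fun t => by simp only [hz.periodic t, hPT t])
    (fun t => by
      refine ((hz.hasDerivAt t).sub (hPd t)).congr_deriv ?_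
      rw [hPeq]
      ring) hre hRemn t
  refine this.trans (le_of_eq ?_)
  rw [pow_succ]
  have hn : ‖ζ‖ = ‖η‖⁻¹ := by rw [hζ, norm_inv]
  rw [hn]
  field_simp

/-- The asymptotic expansion, including the crude bound of order zero. -/
theorem IsFormalSol.exists_norm_sub_le' (hb : D.IsBound p₀ K) {Z : ℕ → ℝ → ℂ}
    (hZ : D.IsFormalSol Z) (N : ℕ) :
    ∃ C R : ℝ, ∀ (η : ℂ) (z : ℝ → ℂ), R ≤ ‖η‖ → ‖η‖ ≤ 2 * η.re → D.IsSol η z →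
      ∀ t, ‖z t - ∑ n ∈ Finset.range (N + 1), Z n t * η⁻¹ ^ n‖ ≤ C * ‖η⁻¹‖ ^ (N + 1) := by
  by_cases hN : N = 0
  · subst hN
    obtain ⟨C, R, hC, h⟩ := hZ.exists_norm_sub_le hb one_ne_zero
    obtain ⟨B, hB⟩ := exists_norm_le_of_periodic D.T_pos (hZ.smooth 1).continuous (hZ.periodic 1)
    refine ⟨C + B, max R 1, fun η z hη hηs hz t => ?_⟩
    have h1 := h η z ((le_max_left _ _).trans hη) hηs hz t
    have h2 : ‖η⁻¹‖ ≤ 1 := by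
      rw [norm_inv]
      exact inv_le_one_of_one_le₀ ((le_max_right _ _).trans hη)
    rw [Finset.sum_range_succ, Finset.sum_range_one, hZ.zero, zero_mul, zero_add, pow_one] at h1
    rw [zero_add, Finset.sum_range_one, hZ.zero, zero_mul, sub_zero, pow_one]
    have h3 : ‖Z 1 t * η⁻¹‖ ≤ B * ‖η⁻¹‖ := by
      rw [norm_mul]
      exact mul_le_mul_of_nonneg_right (hB t) (norm_nonneg _)
    have h4 := norm_add_le (z t - Z 1 t * η⁻¹) (Z 1 t * η⁻¹)
    rw [sub_add_cancel] at h4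
    have h5 : ‖η⁻¹‖ ^ (1 + 1) ≤ ‖η⁻¹‖ := by
      rw [pow_succ, pow_one]
      exact mul_le_of_le_one_left (norm_nonneg _) h2
    have h6 := mul_le_mul_of_nonneg_left h5 hC
    linarith
  · obtain ⟨C, R, -, h⟩ := hZ.exists_norm_sub_le hb hN
    exact ⟨C, R, h⟩

end RiccatiData

/-! ### Smoothness from asymptotic expansions in a sector -/

/-- The sector with vertex `0` about the positive half axis, of radius `ε`. -/
def sector (ε : ℝ) : Set ℂ := {ζ | ‖ζ‖ < ε ∧ ‖ζ‖ < 2 * ζ.re}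

theorem isOpen_sector (ε : ℝ) : IsOpen (sector ε) :=
  (isOpen_lt continuous_norm continuous_const).inter
    (isOpen_lt continuous_norm (continuous_const.mul Complex.continuous_re))

theorem closedBall_subset_sector {ε ℓ : ℝ} (hℓ : 0 < ℓ) (h : 2 * ℓ < ε) :
    Metric.closedBall (ℓ : ℂ) (ℓ / 4) ⊆ sector ε := by
  intro ζ hζ
  rw [mem_closedBall_iff_norm] at hζ
  have h1 : ‖ζ‖ ≤ ℓ / 4 + ℓ := by
    have := norm_add_le (ζ - ℓ) (ℓ : ℂ)
    rw [sub_add_cancel, Complex.norm_real, Real.norm_of_nonneg hℓ.le] at this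
    linarith
  have h2 : |(ζ - ℓ).re| ≤ ℓ / 4 := (Complex.abs_re_le_norm _).trans hζ
  rw [Complex.sub_re, Complex.ofReal_re, abs_le] at h2
  exact ⟨by linarith, by linarith [h2.1]⟩

/-- The derivative of order `n` of a polynomial of degree `n + 1`. -/
theorem iteratedDeriv_sum_range (I : ℕ → ℂ) (n : ℕ) (x : ℂ) :
    iteratedDeriv n (fun ζ : ℂ => ∑ k ∈ Finset.range (n + 2), I k * ζ ^ k) x =
      n.factorial * I n + (n + 1).factorial * I (n + 1) * x := by
  rw [iteratedDeriv_fun_sum fun k _ => by fun_prop]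
  simp only [iteratedDeriv_const_mul_field, iteratedDeriv_pow]
  rw [Finset.sum_range_succ, Finset.sum_range_succ, Finset.sum_eq_zero]
  · have h1 : (n + 1).descFactorial n = (n + 1).factorial := by
      have := Nat.factorial_mul_descFactorial (n := n + 1) (k := n) (Nat.le_succ n)
      simpa using this
    rw [h1, Nat.descFactorial_self]
    simp
    ring
  · intro k hk
    rw [Nat.descFactorial_eq_zero_iff_lt.2 (Finset.mem_range.1 hk)]
    simp

theorem contDiffOn_of_hasDerivWithinAt {s : Set ℝ} (hs : UniqueDiffOn ℝ s) {g : ℕ → ℝ → ℂ}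
    (hg : ∀ n, ∀ x ∈ s, HasDerivWithinAt (g n) (g (n + 1) x) s x) :
    ContDiffOn ℝ ∞ (g 0) s ∧ ∀ n, ∀ x ∈ s, iteratedDerivWithin n (g 0) s x = g n x := by
  have hit : ∀ n, ∀ x ∈ s, iteratedDerivWithin n (g 0) s x = g n x := by
    intro n
    induction n with
    | zero => intro x _; simp
    | succ n ih =>
      intro x hx
      rw [iteratedDerivWithin_succ, derivWithin_congr ih (ih x hx)]
      exact (hg n x hx).derivWithin (hs x hx)
  refine ⟨?_, hit⟩
  refine contDiffOn_of_differentiableOn_deriv fun m _ => ?_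
  exact DifferentiableOn.congr (fun x hx => (hg m x hx).differentiableWithinAt) (hit m)

/-- A holomorphic function in a sector that has an asymptotic power series in the sector is smooth
on the positive half axis up to the vertex, and the asymptotic series is its Taylor series: Cauchy's
estimates allow differentiating the asymptotic series. -/
theorem contDiffOn_of_asymptotic {F : ℂ → ℂ} {ε : ℝ} (hε : 0 < ε)
    (hF : DifferentiableOn ℂ F (sector ε)) {I : ℕ → ℂ}
    (hI : ∀ N, ∃ C r : ℝ, 0 < r ∧ ∀ ζ ∈ sector ε, ‖ζ‖ < r →
      ‖F ζ - ∑ n ∈ Finset.range (N + 2), I n * ζ ^ n‖ ≤ C * ‖ζ‖ ^ (N + 2))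
    {f : ℝ → ℂ} (hf0 : f 0 = I 0) (hf : ∀ ℓ, 0 < ℓ → f ℓ = F ℓ) :
    ContDiffOn ℝ ∞ f (Ico 0 (ε / 2)) ∧ ∀ n, taylorCoeff (ε / 2) f n = I n := by
  set g : ℕ → ℝ → ℂ := fun n ℓ => if ℓ = 0 then n.factorial * I n else iteratedDeriv n F ℓ with hg
  have hsec : ∀ ℓ : ℝ, 0 < ℓ → ℓ < ε / 2 → (ℓ : ℂ) ∈ sector ε := fun ℓ h1 h2 =>
    closedBall_subset_sector h1 (by linarith) (Metric.mem_closedBall_self (by linarith))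
  have hF' : ∀ ζ ∈ sector ε, AnalyticAt ℂ F ζ := fun ζ hζ =>
    hF.analyticAt ((isOpen_sector ε).mem_nhds hζ)
  have hFa : ∀ ζ ∈ sector ε, ∀ n, AnalyticAt ℂ (iteratedDeriv n F) ζ := fun ζ hζ n => by
    rw [iteratedDeriv_eq_iterate]
    exact (hF' ζ hζ).iterated_deriv n
  have hder : ∀ n, ∀ ℓ ∈ Ico 0 (ε / 2), HasDerivWithinAt (g n) (g (n + 1) ℓ) (Ico 0 (ε / 2)) ℓ := by
    intro n ℓ hℓ
    rcases eq_or_lt_of_le hℓ.1 with h0 | h0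
    · subst h0
      obtain ⟨C, r, hr, hC⟩ := hI n
      set P : ℂ → ℂ := fun ζ => ∑ k ∈ Finset.range (n + 2), I k * ζ ^ k with hP
      have hPd : Differentiable ℂ P := by fun_prop
      have hC0 : 0 ≤ |C| := abs_nonneg C
      -- Cauchy's estimate on the circle of radius `x / 4` about `x`
      have hest : ∀ x : ℝ, 0 < x → x < ε / 2 → 2 * x < r →
          ‖g n x - g n 0 - x • g (n + 1) 0‖ ≤ n.factorial * |C| * 2 ^ (n + 2) * 4 ^ n * x ^ 2 := by
        intro x hx hxε hxr
        have hsub := closedBall_subset_sector hx (show 2 * x < ε by linarith)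
        have hcl : DiffContOnCl ℂ (F - P) (Metric.ball (x : ℂ) (x / 4)) := by
          refine DifferentiableOn.diffContOnCl ?_
          rw [closure_ball _ (by positivity)]
          exact (hF.mono hsub).sub hPd.differentiableOn
        have hcau := Complex.norm_iteratedDeriv_le_of_forall_mem_sphere_norm_le
          (C := |C| * (2 * x) ^ (n + 2)) n (by positivity) hcl (fun ζ hζ => by
            have hζ' := Metric.sphere_subset_closedBall hζ
            have h1 : ‖ζ‖ ≤ 2 * x := by
              have h2 := norm_add_le (ζ - x) (x : ℂ)
              rw [sub_add_cancel, Complex.norm_real, Real.norm_of_nonneg hx.le,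
                mem_sphere_iff_norm.1 hζ] at h2
              linarith
            have h2 := hC ζ (hsub hζ') (by linarith)
            calc ‖(F - P) ζ‖ ≤ C * ‖ζ‖ ^ (n + 2) := h2
              _ ≤ |C| * ‖ζ‖ ^ (n + 2) := mul_le_mul_of_nonneg_right (le_abs_self C) (by positivity)
              _ ≤ |C| * (2 * x) ^ (n + 2) := by gcongr)
        rw [iteratedDeriv_sub (hF' _ (hsec x hx hxε)).contDiffAt hPd.contDiff.contDiffAt, hP,
          iteratedDeriv_sum_range] at hcau
        have e : g n x - g n 0 - x • g (n + 1) 0 = iteratedDeriv n F x -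
            (n.factorial * I n + (n + 1).factorial * I (n + 1) * x) := by
          simp only [hg, if_neg hx.ne', if_true, Complex.real_smul]
          ring
        rw [e]
        refine hcau.trans (le_of_eq ?_)
        rw [div_pow, pow_add (2 * x), mul_pow, mul_pow, pow_add 2]
        field_simp
      rw [hasDerivWithinAt_iff_isLittleO]
      have hO : (fun x : ℝ => g n x - g n 0 - (x - 0) • g (n + 1) 0) =O[nhdsWithin 0 (Ico 0 (ε / 2))]
          fun x : ℝ => x ^ 2 := by
        refine Asymptotics.IsBigO.of_bound (n.factorial * |C| * 2 ^ (n + 2) * 4 ^ n) ?_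
        have hlt : ∀ᶠ x : ℝ in nhdsWithin 0 (Ico 0 (ε / 2)), x < r / 2 :=
          (eventually_lt_nhds (by linarith)).filter_mono nhdsWithin_le_nhds
        filter_upwards [hlt, self_mem_nhdsWithin] with x hx1 hx2
        rw [sub_zero, Real.norm_of_nonneg (sq_nonneg x)]
        rcases eq_or_lt_of_le hx2.1 with h0 | h0
        · rw [← h0]
          simp
        · exact hest x h0 hx2.2 (by linarith)
      refine hO.trans_isLittleO ?_
      have h2 := (Asymptotics.isLittleO_pow_sub_sub (0 : ℝ) (m := 2) (by norm_num)).mono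
        (nhdsWithin_le_nhds (s := Ico 0 (ε / 2)))
      exact Asymptotics.isLittleO_norm_left.1 (by simpa [norm_pow] using h2)
    · have h1 : HasDerivAt (iteratedDeriv n F) (iteratedDeriv (n + 1) F ℓ) (ℓ : ℂ) := by
        have hd : DifferentiableAt ℂ (iteratedDeriv n F) (ℓ : ℂ) :=
          (hFa _ (hsec ℓ h0 hℓ.2) n).differentiableAt
        rw [iteratedDeriv_succ]
        exact hd.hasDerivAt
      have h2 := h1.comp_ofReal
      have h3 : g (n + 1) ℓ = iteratedDeriv (n + 1) F ℓ := by simp [hg, h0.ne']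
      rw [h3]
      refine (h2.congr_of_eventuallyEq ?_).hasDerivWithinAt
      filter_upwards [eventually_ne_nhds h0.ne'] with x hx
      simp [hg, hx]
  have hfg : EqOn f (g 0) (Ico 0 (ε / 2)) := by
    intro ℓ hℓ
    rcases eq_or_lt_of_le hℓ.1 with h0 | h0
    · subst h0
      simp [hg, hf0]
    · simp [hg, h0.ne', hf ℓ h0]
  have hmem : (0 : ℝ) ∈ Ico 0 (ε / 2) := ⟨le_rfl, by linarith⟩
  obtain ⟨h1, h2⟩ := contDiffOn_of_hasDerivWithinAt (uniqueDiffOn_Ico 0 (ε / 2)) hder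
  refine ⟨h1.congr hfg, fun n => ?_⟩
  rw [taylorCoeff, iteratedDerivWithin_congr hfg hmem, h2 n 0 hmem]
  have : (n.factorial : ℂ) ≠ 0 := by exact_mod_cast n.factorial_ne_zero
  simp [hg]
  field_simp

/-! ### The logarithm of the multiplier -/

namespace RiccatiData

variable (D : RiccatiData)

/-- The coefficients of the asymptotic series of `ℓ ln λ(ℓ)`, where `λ` is the multiplier of the
periodic solution of the Riccati equation with `η = ℓ⁻¹`. -/
noncomputable def logCoeff (Z : ℕ → ℝ → ℂ) : ℕ → ℂ
  | 0 => ∫ t in (0 : ℝ)..D.T, (D.p t : ℂ)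
  | n + 1 => -∫ t in (0 : ℝ)..D.T, ((if n = 0 then D.c₁ t else 0) + 2 * (D.c₂ t * Z n t))

/-- The periodic solutions of the Riccati equation for small `ℓ = η⁻¹ > 0`; the function
`ℓ ln λ(ℓ)` is smooth up to `ℓ = 0`. -/
theorem exists_smooth_log {Z : ℕ → ℝ → ℂ} (hZ : D.IsFormalSol Z) :
    ∃ (ℓ₀ : ℝ) (z : ℝ → ℝ → ℂ) (f : ℝ → ℂ), 0 < ℓ₀ ∧ ContDiffOn ℝ ∞ f (Ico 0 ℓ₀) ∧
      (∀ n, taylorCoeff ℓ₀ f n = D.logCoeff Z n) ∧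
      ∀ ℓ ∈ Ioo 0 ℓ₀, D.IsSol (ℓ : ℂ)⁻¹ (z ℓ) ∧
        (∀ t, 0 < (D.p t / ℓ - D.c₁ t - 2 * D.c₂ t * z ℓ t).re) ∧
        f ℓ / ℓ = ∫ t in (0 : ℝ)..D.T, (D.p t / ℓ - D.c₁ t - 2 * D.c₂ t * z ℓ t) := by
  obtain ⟨p₀, K, hb⟩ := D.exists_isBound
  have hK := hb.K_pos
  have hp₀ := hb.p₀_pos
  have hc₁ := D.smooth_c₁.continuous
  have hc₂ := D.smooth_c₂.continuous
  have hpc := D.continuous_ofReal_p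
  have hex : ∀ η : ℂ, ∃ z, 6 * K / p₀ ≤ η.re → D.IsSol η z := fun η => by
    by_cases h : 6 * K / p₀ ≤ η.re
    · obtain ⟨z, hz⟩ := hb.exists_isSol h
      exact ⟨z, fun _ => hz⟩
    · exact ⟨0, fun h' => absurd h' h⟩
  choose z hz using hex
  set ε : ℝ := p₀ / (12 * K) with hε
  have hε0 : 0 < ε := by positivity
  have hsec : ∀ ζ ∈ sector ε, ζ ≠ 0 ∧ ‖ζ⁻¹‖ ≤ 2 * ζ⁻¹.re ∧ 6 * K / p₀ < ζ⁻¹.re := by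
    rintro ζ ⟨h1, h2⟩
    have hn : 0 < ‖ζ‖ := by
      rcases eq_or_lt_of_le (norm_nonneg ζ) with h0 | h0
      · have : ζ = 0 := norm_eq_zero.1 h0.symm
        rw [this] at h2
        simp at h2
      · exact h0
    have hre : ζ⁻¹.re = ζ.re / ‖ζ‖ ^ 2 := by rw [Complex.inv_re, Complex.sq_norm]
    have h3 : ‖ζ⁻¹‖ ≤ 2 * ζ⁻¹.re := by
      rw [norm_inv, hre, ← mul_div_assoc, le_div_iff₀ (by positivity)]
      calc ‖ζ‖⁻¹ * ‖ζ‖ ^ 2 = ‖ζ‖ := by field_simp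
        _ ≤ 2 * ζ.re := h2.le
    refine ⟨norm_pos_iff.1 hn, h3, ?_⟩
    have h4 : 12 * K / p₀ < ‖ζ⁻¹‖ := by
      rw [norm_inv, lt_inv_comm₀ (by positivity) hn, inv_div]
      exact h1
    have h5 : 12 * K / p₀ = 2 * (6 * K / p₀) := by ring
    linarith
  set J : ℂ → ℂ := fun η => ∫ t in (0 : ℝ)..D.T, D.c₂ t * z η t with hJ
  set F : ℂ → ℂ := fun ζ => (∫ t in (0 : ℝ)..D.T, (D.p t : ℂ)) -
    ζ * ((∫ t in (0 : ℝ)..D.T, D.c₁ t) + 2 * J ζ⁻¹) with hF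
  have hFd : DifferentiableOn ℂ F (sector ε) := by
    intro ζ hζ
    obtain ⟨h0, -, h1⟩ := hsec ζ hζ
    obtain ⟨J', hJ'⟩ := hb.exists_hasDerivAt_integral hz h1
    have h2 : DifferentiableAt ℂ (fun ζ => J ζ⁻¹) ζ :=
      hJ'.differentiableAt.comp ζ (differentiableAt_inv h0)
    exact ((differentiableAt_const _).sub (differentiableAt_id.mul
      ((differentiableAt_const _).add (h2.const_mul 2)))).differentiableWithinAt
  have hasym : ∀ N, ∃ C r : ℝ, 0 < r ∧ ∀ ζ ∈ sector ε, ‖ζ‖ < r →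
      ‖F ζ - ∑ n ∈ Finset.range (N + 2), D.logCoeff Z n * ζ ^ n‖ ≤ C * ‖ζ‖ ^ (N + 2) := by
    intro N
    obtain ⟨C, R, hC⟩ := hZ.exists_norm_sub_le' hb N
    refine ⟨2 * (K * C * D.T), (max R 1)⁻¹, by positivity, fun ζ hζ hζr => ?_⟩
    obtain ⟨h0, h1, h2⟩ := hsec ζ hζ
    have hsol := hz ζ⁻¹ h2.le
    have hR : R ≤ ‖ζ⁻¹‖ := by
      rw [norm_inv]
      refine (le_max_left R 1).trans ?_
      rw [le_inv_comm₀ (by positivity) (norm_pos_iff.2 h0)]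
      exact hζr.le
    have hbd := hC ζ⁻¹ (z ζ⁻¹) hR h1 hsol
    simp only [inv_inv] at hbd
    have hZc : ∀ n, Continuous (Z n) := fun n => (hZ.smooth n).continuous
    have hzc := hsol.continuous
    have hint : ∀ g : ℝ → ℂ, Continuous g →
        IntervalIntegrable g MeasureTheory.volume 0 D.T := fun g hg => hg.intervalIntegrable _ _
    have e1 : ∑ n ∈ Finset.range (N + 2), D.logCoeff Z n * ζ ^ n =
        (∫ t in (0 : ℝ)..D.T, (D.p t : ℂ)) - ζ * ((∫ t in (0 : ℝ)..D.T, D.c₁ t) +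
          2 * ∫ t in (0 : ℝ)..D.T, D.c₂ t * ∑ n ∈ Finset.range (N + 1), Z n t * ζ ^ n) := by
      have e2 : ∀ n, D.logCoeff Z (n + 1) = -((if n = 0 then ∫ t in (0 : ℝ)..D.T, D.c₁ t else 0) +
          2 * ∫ t in (0 : ℝ)..D.T, D.c₂ t * Z n t) := fun n => by
        have hn := hZc n
        simp only [logCoeff]
        split_ifs
        · rw [intervalIntegral.integral_add (hint _ hc₁) (hint _ (by fun_prop)),
            intervalIntegral.integral_const_mul]
        · simp only [zero_add, intervalIntegral.integral_const_mul]
      have e3 : ∫ t in (0 : ℝ)..D.T, D.c₂ t * ∑ n ∈ Finset.range (N + 1), Z n t * ζ ^ n =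
          ∑ n ∈ Finset.range (N + 1), (∫ t in (0 : ℝ)..D.T, D.c₂ t * Z n t) * ζ ^ n := by
        simp only [← intervalIntegral.integral_mul_const]
        rw [← intervalIntegral.integral_finsetSum fun n _ => hint _ (by
          have := hZc n
          fun_prop)]
        congr 1
        funext t
        rw [Finset.mul_sum]
        exact Finset.sum_congr rfl fun n _ => by ring
      rw [Finset.sum_range_succ', e3]
      simp only [e2]
      have e4 : ∑ n ∈ Finset.range (N + 1),
          (if n = 0 then ∫ t in (0 : ℝ)..D.T, D.c₁ t else 0) * ζ ^ n =
          ∫ t in (0 : ℝ)..D.T, D.c₁ t := by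
        rw [Finset.sum_eq_single 0 (fun n _ hn => by simp [hn]) (by simp)]
        simp
      have e5 : ∑ n ∈ Finset.range (N + 1),
          -((if n = 0 then ∫ t in (0 : ℝ)..D.T, D.c₁ t else 0) +
            2 * ∫ t in (0 : ℝ)..D.T, D.c₂ t * Z n t) * ζ ^ (n + 1) =
          -ζ * (∑ n ∈ Finset.range (N + 1),
            (if n = 0 then ∫ t in (0 : ℝ)..D.T, D.c₁ t else 0) * ζ ^ n +
            2 * ∑ n ∈ Finset.range (N + 1), (∫ t in (0 : ℝ)..D.T, D.c₂ t * Z n t) * ζ ^ n) := by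
        rw [Finset.mul_sum (Finset.range (N + 1)) _ (2 : ℂ), ← Finset.sum_add_distrib,
          Finset.mul_sum]
        refine Finset.sum_congr rfl fun n _ => ?_
        ring
      rw [e5, e4]
      simp only [logCoeff]
      ring
    have e6 : F ζ - ∑ n ∈ Finset.range (N + 2), D.logCoeff Z n * ζ ^ n = -(2 * ζ) *
        ∫ t in (0 : ℝ)..D.T,
          D.c₂ t * (z ζ⁻¹ t - ∑ n ∈ Finset.range (N + 1), Z n t * ζ ^ n) := by
      simp only [mul_sub]
      rw [e1, intervalIntegral.integral_sub (hint _ (by fun_prop)) (hint _ (by fun_prop))]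
      simp only [hF, hJ]
      ring
    have e7 : ‖∫ t in (0 : ℝ)..D.T,
        D.c₂ t * (z ζ⁻¹ t - ∑ n ∈ Finset.range (N + 1), Z n t * ζ ^ n)‖ ≤
        K * (C * ‖ζ‖ ^ (N + 1)) * |D.T - 0| := by
      refine intervalIntegral.norm_integral_le_of_norm_le_const fun t _ => ?_
      rw [norm_mul]
      exact mul_le_mul (hb.norm_c₂_le t) (hbd t) (norm_nonneg _) hK.le
    rw [e6, norm_mul, norm_neg, norm_mul]
    refine (mul_le_mul_of_nonneg_left e7 (by positivity)).trans (le_of_eq ?_)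
    rw [sub_zero, abs_of_pos D.T_pos]
    simp only [Complex.norm_ofNat]
    ring
  set f : ℝ → ℂ := fun ℓ => F ℓ with hf
  obtain ⟨hs, ht⟩ := contDiffOn_of_asymptotic (f := f) hε0 hFd hasym
    (by simp [hf, hF, logCoeff]) (fun ℓ _ => rfl)
  refine ⟨ε / 2, fun ℓ => z (ℓ : ℂ)⁻¹, f, by positivity, hs, ht, fun ℓ hℓ => ?_⟩
  have hm : (ℓ : ℂ) ∈ sector ε :=
    closedBall_subset_sector hℓ.1 (by linarith [hℓ.2])
      (Metric.mem_closedBall_self (by linarith [hℓ.1]))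
  obtain ⟨h0, h1, h2⟩ := hsec _ hm
  have hsol := hz _ h2.le
  have hzc := hsol.continuous
  refine ⟨hsol, fun t => ?_, ?_⟩
  · have := hb.le_re h2.le (s := 2 * z (ℓ : ℂ)⁻¹ t)
      (by rw [norm_mul]; simpa using hsol.norm_le t) t
    have e : D.p t / ℓ - D.c₁ t - 2 * D.c₂ t * z (ℓ : ℂ)⁻¹ t =
        D.p t * (ℓ : ℂ)⁻¹ - D.c₁ t - D.c₂ t * (2 * z (ℓ : ℂ)⁻¹ t) := by ring
    rw [e]
    linarith
  · have hint : ∀ g : ℝ → ℂ, Continuous g →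
        IntervalIntegrable g MeasureTheory.volume 0 D.T := fun g hg => hg.intervalIntegrable _ _
    simp only [mul_assoc]
    rw [intervalIntegral.integral_sub (hint _ (by fun_prop)) (hint _ (by fun_prop)),
      intervalIntegral.integral_sub (hint _ (by fun_prop)) (hint _ (by fun_prop)),
      intervalIntegral.integral_div, intervalIntegral.integral_const_mul]
    simp only [hf, hF, hJ]
    field_simp
    ring

/-- The formal power series solution of the Riccati equation. -/
noncomputable def formalSol : ℕ → ℝ → ℂ
  | 0 => 0
  | n + 1 => fun t => (D.p t : ℂ)⁻¹ * (deriv (formalSol n) t + D.c₁ t * formalSol n t +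
      (if n = 0 then D.c₀ t else 0) + D.c₂ t * ∑ j : Fin (n + 1), formalSol j t *
        formalSol (n - j) t)

theorem isFormalSol_formalSol : D.IsFormalSol D.formalSol := by
  have hp : ∀ t, (D.p t : ℂ) ≠ 0 := fun t => by exact_mod_cast (D.p_pos t).ne'
  have hboth : ∀ n, ContDiff ℝ ∞ (D.formalSol n) ∧ Periodic (D.formalSol n) D.T := by
    intro n
    induction n using Nat.strong_induction_on with
    | _ n ih =>
      cases n with
      | zero =>
        rw [formalSol]
        exact ⟨contDiff_const, fun t => rfl⟩
      | succ n =>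
        have h1 := ih n (Nat.lt_succ_self n)
        have h2 : ContDiff ℝ ∞ (deriv (D.formalSol n)) := (contDiff_infty_iff_deriv.1 h1.1).2
        have h3 : ∀ t, deriv (D.formalSol n) (t + D.T) = deriv (D.formalSol n) t := fun t => by
          rw [← deriv_comp_add_const]; congr 1; exact funext h1.2
        rw [formalSol]
        constructor
        · have hps : ContDiff ℝ ∞ fun t => (D.p t : ℂ)⁻¹ :=
            (Complex.ofRealCLM.contDiff.comp D.smooth_p).inv hp
          refine hps.mul (((h2.add (D.smooth_c₁.mul h1.1)).add ?_).add (D.smooth_c₂.mul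
            (ContDiff.sum fun j _ => ((ih j ?_).1.mul (ih (n - j) ?_).1))))
          · split_ifs
            · exact D.smooth_c₀
            · exact contDiff_const
          · exact j.2
          · omega
        · intro t
          simp only [D.periodic_p t, D.periodic_c₀ t, D.periodic_c₁ t, D.periodic_c₂ t, h3, h1.2 t]
          congr 3
          refine Finset.sum_congr rfl fun j _ => ?_
          rw [(ih j j.2).2 t, (ih (n - j) (by omega)).2 t]
  refine ⟨fun t => by rw [formalSol]; rfl, fun n => (hboth n).1, fun n => (hboth n).2,
    fun n t => ?_⟩
  rw [formalSol, mul_inv_cancel_left₀ (hp t), Finset.sum_range]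

end RiccatiData

section Curve

variable {Γ : ℝ → E3} {T : ℝ}

/-- The Riccati equation of a moving frame: the bicycle equation in the stereographic coordinate
of the sphere with pole at the negative tangent. -/
noncomputable def IsMovingFrame.riccatiData (hΓ : IsClosedSmoothCurve Γ T) {n b : ℝ → E3}
    {k : ℝ → ℂ} {ρ : ℝ → ℝ} (hf : IsMovingFrame Γ T n b k ρ) : RiccatiData where
  T := T
  p := fun t => ‖deriv Γ t‖
  c₀ := fun t => k t / 2
  c₁ := fun t => Complex.I * ρ t
  c₂ := fun t => starRingEnd ℂ (k t) / 2
  T_pos := hΓ.period_pos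
  p_pos := hΓ.speed_pos
  smooth_p := hΓ.contDiff_speed
  smooth_c₀ := hf.smooth_k.div_const 2
  smooth_c₁ := contDiff_const.mul (Complex.ofRealCLM.contDiff.comp hf.smooth_ρ)
  smooth_c₂ := (Complex.conjCLE.contDiff.comp hf.smooth_k).div_const 2
  periodic_p := hΓ.speed_periodic
  periodic_c₀ := fun t => by simp only [hf.periodic_k t]
  periodic_c₁ := fun t => by simp only [hf.periodic_ρ t]
  periodic_c₂ := fun t => by simp only [hf.periodic_k t]

theorem IsMovingFrame.exists_isSmoothLog (hΓ : IsClosedSmoothCurve Γ T) {n b : ℝ → E3}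
    {k : ℝ → ℂ} {ρ : ℝ → ℝ} (hf : IsMovingFrame Γ T n b k ρ) {Z : ℕ → ℝ → ℂ}
    (hZ : (hf.riccatiData hΓ).IsFormalSol Z) :
    ∃ ℓ₀ F, IsSmoothLog Γ T ℓ₀ F ∧
      ∀ m, taylorCoeff ℓ₀ F m = (hf.riccatiData hΓ).logCoeff Z m := by
  obtain ⟨ℓ₀, z, F, h0, hs, ht, hsol⟩ := (hf.riccatiData hΓ).exists_smooth_log hZ
  refine ⟨ℓ₀, F, ⟨h0, hs, fun ℓ hℓ => ?_⟩, ht⟩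
  obtain ⟨h1, h2, h3⟩ := hsol ℓ hℓ
  obtain ⟨α, β, m, hF, hm⟩ := hf.exists_isFloquet hΓ (ℓ := ℓ) (z := z ℓ) h1.periodic fun t => by
    refine (h1.hasDerivAt t).congr_deriv ?_
    simp only [IsMovingFrame.riccatiData]
    ring
  have hint : (∫ t in (0 : ℝ)..T,
      ((‖deriv Γ t‖ : ℂ) / ℓ - Complex.I * ρ t - starRingEnd ℂ (k t) * z ℓ t)) = F ℓ / ℓ := by
    rw [h3]
    simp only [IsMovingFrame.riccatiData]
    congr 1
    funext t
    ring
  rw [hint] at hm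
  refine ⟨_, hm ▸ hF.isUnstableFixedPoint hΓ.contDiff_deriv.continuous ?_⟩
  rw [hm, Complex.norm_exp, Real.one_lt_exp_iff, h3]
  -- the growth rate of the linearized equation is positive
  set D := hf.riccatiData hΓ with hD
  have hc : Continuous fun t => D.p t / ℓ - D.c₁ t - 2 * D.c₂ t * z ℓ t := by
    have e1 := D.smooth_c₁.continuous
    have e2 := D.smooth_c₂.continuous
    have e3 := D.continuous_ofReal_p
    have e4 := h1.continuous
    fun_prop
  have hre := Complex.reCLM.intervalIntegral_comp_comm (hc.intervalIntegrable (μ :=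
    MeasureTheory.volume) 0 D.T)
  simp only [Complex.reCLM_apply] at hre
  rw [← hre]
  exact intervalIntegral.intervalIntegral_pos_of_pos
    ((Complex.continuous_re.comp hc).intervalIntegrable _ _) h2 D.T_pos

/-! ### Uniqueness of the Taylor coefficients -/

theorem iteratedDerivWithin_Ico_eq {F : ℝ → ℂ} {ε ℓ₀ : ℝ} (hε : 0 < ε) (h : ε ≤ ℓ₀) (n : ℕ) :
    iteratedDerivWithin n F (Ico 0 ℓ₀) 0 = iteratedDerivWithin n F (Ico 0 ε) 0 := by
  have hev : (Ico 0 ℓ₀ : Set ℝ) =ᶠ[nhds 0] Ico 0 ε := by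
    filter_upwards [Iio_mem_nhds hε] with x hx
    refine propext ⟨fun h' => ⟨h'.1, hx⟩, fun h' => ⟨h'.1, h'.2.trans_le h⟩⟩
  simp only [iteratedDerivWithin_eq_iteratedFDerivWithin, iteratedFDerivWithin_congr_set hev]

/-- Branches of the logarithm of the same function differ by a constant multiple of `2πi`. -/
theorem sameTaylor_of_exp_eq {ℓ₁ ℓ₂ ε : ℝ} {F₁ F₂ : ℝ → ℂ} (hε : 0 < ε) (h1 : ε ≤ ℓ₁) (h2 : ε ≤ ℓ₂)
    (hs1 : ContDiffOn ℝ ∞ F₁ (Ico 0 ℓ₁)) (hs2 : ContDiffOn ℝ ∞ F₂ (Ico 0 ℓ₂))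
    (hexp : ∀ ℓ ∈ Ioo 0 ε, Complex.exp (F₁ ℓ / ℓ) = Complex.exp (F₂ ℓ / ℓ)) :
    SameTaylor ℓ₁ F₁ ℓ₂ F₂ := by
  have hs1' : ContDiffOn ℝ ∞ F₁ (Ico 0 ε) := hs1.mono (Ico_subset_Ico_right h1)
  have hs2' : ContDiffOn ℝ ∞ F₂ (Ico 0 ε) := hs2.mono (Ico_subset_Ico_right h2)
  have hpi : (2 * Real.pi * Complex.I : ℂ) ≠ 0 := Complex.two_pi_I_ne_zero
  have hint : ∀ ℓ ∈ Ioo 0 ε, ∃ k : ℤ, F₁ ℓ / ℓ = F₂ ℓ / ℓ + k * (2 * Real.pi * Complex.I) :=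
    fun ℓ hℓ => Complex.exp_eq_exp_iff_exists_int.1 (hexp ℓ hℓ)
  -- the integer is a continuous function of `ℓ`
  set G : ℝ → ℝ := fun ℓ => ((F₁ ℓ - F₂ ℓ) / ℓ / (2 * Real.pi * Complex.I)).re with hG
  have hGk : ∀ ℓ ∈ Ioo 0 ε, ∀ k : ℤ, F₁ ℓ / ℓ = F₂ ℓ / ℓ + k * (2 * Real.pi * Complex.I) →
      G ℓ = k := fun ℓ hℓ k hk => by
    have : (F₁ ℓ - F₂ ℓ) / ℓ / (2 * Real.pi * Complex.I) = ((k : ℝ) : ℂ) := by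
      rw [div_eq_iff hpi, sub_div, hk]
      push_cast
      ring
    simp only [hG, this, Complex.ofReal_re]
  have hGc : ContinuousOn G (Ioo 0 ε) := by
    refine Complex.continuous_re.comp_continuousOn (ContinuousOn.div_const (ContinuousOn.div
      ((hs1'.continuousOn.mono Ioo_subset_Ico_self).sub
        (hs2'.continuousOn.mono Ioo_subset_Ico_self)) Complex.continuous_ofReal.continuousOn
      fun ℓ hℓ => ?_) _)
    exact_mod_cast hℓ.1.ne'
  obtain ⟨k, hk⟩ := hint (ε / 2) ⟨by linarith, by linarith⟩
  have hconst : ∀ ℓ ∈ Ioo 0 ε, F₁ ℓ / ℓ = F₂ ℓ / ℓ + k * (2 * Real.pi * Complex.I) := by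
    intro ℓ hℓ
    obtain ⟨j, hj⟩ := hint ℓ hℓ
    have e1 := hGk _ hℓ j hj
    have hmid : ε / 2 ∈ Ioo 0 ε := ⟨by linarith, by linarith⟩
    have e2 := hGk _ hmid k hk
    have hno : ∀ a b : ℤ, ∀ x ∈ Ioo 0 ε, ∀ y ∈ Ioo 0 ε, G x = a → G y = b → ¬ a < b := by
      intro a b x hx y hy hxa hyb hab
      have hivt := isPreconnected_Ioo.intermediate_value hx hy hGc
      rw [hxa, hyb] at hivt
      have hab' : (a : ℝ) + 1 ≤ b := by exact_mod_cast hab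
      obtain ⟨s, hs, hs2⟩ := hivt (show (a : ℝ) + 1 / 2 ∈ Icc (a : ℝ) b from
        ⟨by linarith, by linarith⟩)
      obtain ⟨i, hi⟩ := hint s hs
      have e3 := hGk s hs i hi
      rw [hs2] at e3
      have h3 : (a : ℝ) < i := by linarith
      have h4 : (i : ℝ) < a + 1 := by linarith
      have h5 : a < i := by exact_mod_cast h3
      have h6 : i < a + 1 := by exact_mod_cast h4
      omega
    have hjk : j = k := le_antisymm (not_lt.1 (hno k j _ hmid _ hℓ e2 e1))
      (not_lt.1 (hno j k _ hℓ _ hmid e1 e2))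
    rw [hj, hjk]
  set c : ℂ := 2 * Real.pi * Complex.I * k with hc
  have hlin : ∀ ℓ ∈ Ioo 0 ε, F₁ ℓ = F₂ ℓ + c * ℓ := fun ℓ hℓ => by
    have h3 := hconst ℓ hℓ
    have h4 : (ℓ : ℂ) ≠ 0 := by exact_mod_cast hℓ.1.ne'
    field_simp at h3
    rw [h3, hc]
    ring
  have h0m : (0 : ℝ) ∈ Ico 0 ε := ⟨le_rfl, hε⟩
  have hlin0 : F₁ 0 = F₂ 0 + c * (0 : ℝ) := by
    have hne : (nhdsWithin (0 : ℝ) (Ioo 0 ε)).NeBot := by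
      rw [← mem_closure_iff_nhdsWithin_neBot, closure_Ioo hε.ne]
      exact ⟨le_rfl, hε.le⟩
    have t1 := (hs1'.continuousOn 0 h0m).mono Ioo_subset_Ico_self
    have t2 : ContinuousWithinAt (fun ℓ : ℝ => F₂ ℓ + c * ℓ) (Ioo 0 ε) 0 :=
      ((hs2'.continuousOn 0 h0m).mono Ioo_subset_Ico_self).add
        (by fun_prop)
    refine tendsto_nhds_unique (t1 : Filter.Tendsto _ _ _) (Filter.Tendsto.congr' ?_ t2)
    filter_upwards [self_mem_nhdsWithin] with ℓ hℓ
    exact (hlin ℓ hℓ).symm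
  have hEq : EqOn F₁ (fun ℓ => F₂ ℓ + c * ℓ) (Ico 0 ε) := fun ℓ hℓ => by
    rcases eq_or_lt_of_le hℓ.1 with h3 | h3
    · rw [← h3]; exact hlin0
    · exact hlin ℓ ⟨h3, hℓ.2⟩
  -- derivatives of the linear function
  set g : ℕ → ℝ → ℂ := fun n ℓ => if n = 0 then c * ℓ else if n = 1 then c else 0 with hg
  have hgd : ∀ n, ∀ x ∈ Ico 0 ε, HasDerivWithinAt (g n) (g (n + 1) x) (Ico 0 ε) x := by
    intro n x _
    match n with
    | 0 =>
      have := (Complex.ofRealCLM.hasDerivAt (x := x)).const_mul c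
      simpa [hg] using this.hasDerivWithinAt
    | 1 => simpa [hg] using hasDerivWithinAt_const x (Ico 0 ε) c
    | n + 2 => simpa [hg] using hasDerivWithinAt_const x (Ico 0 ε) (0 : ℂ)
  obtain ⟨hgs, hgi⟩ := contDiffOn_of_hasDerivWithinAt (uniqueDiffOn_Ico 0 ε) hgd
  have hcoeff : ∀ n, taylorCoeff ℓ₁ F₁ n = taylorCoeff ℓ₂ F₂ n + g n 0 / n.factorial := by
    intro n
    rw [taylorCoeff, taylorCoeff, iteratedDerivWithin_Ico_eq hε h1,
      iteratedDerivWithin_Ico_eq hε h2, ← add_div, ← hgi n 0 h0m,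
      iteratedDerivWithin_congr hEq h0m]
    congr 1
    exact iteratedDerivWithin_fun_add h0m (uniqueDiffOn_Ico 0 ε)
      ((hs2' 0 h0m).of_le (by exact_mod_cast le_top))
      ((hgs 0 h0m).of_le (by exact_mod_cast le_top))
  refine ⟨fun n hn => ?_, k, ?_⟩
  · rw [hcoeff]
    rcases Nat.eq_zero_or_pos n with h3 | h3
    · simp [hg, h3]
    · simp [hg, hn, h3.ne']
  · rw [hcoeff]
    simp [hg, hc]

end Curve

/-! ### Differential polynomials in curvature and torsion -/

section DiffPoly

variable {Γ : ℝ → E3} {T : ℝ} {κ τ f : ℝ → ℝ}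

theorem IsClosedSmoothCurve.contDiff_iterate_arcDeriv (hΓ : IsClosedSmoothCurve Γ T)
    (hf : ContDiff ℝ ∞ f) (j : ℕ) : ContDiff ℝ ∞ ((arcDeriv Γ)^[j] f) := by
  induction j with
  | zero => exact hf
  | succ j ih =>
    rw [iterate_succ_apply']
    exact (hΓ.contDiff_speed.inv fun t => (hΓ.speed_pos t).ne').mul (contDiff_infty_iff_deriv.1 ih).2

theorem IsClosedSmoothCurve.periodic_iterate_arcDeriv (hΓ : IsClosedSmoothCurve Γ T)
    (hf : Periodic f T) (j : ℕ) : Periodic ((arcDeriv Γ)^[j] f) T := by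
  induction j with
  | zero => exact hf
  | succ j ih =>
    rw [iterate_succ_apply']
    intro t
    rw [arcDeriv, arcDeriv, hΓ.deriv_periodic t, ← deriv_comp_add_const, funext ih]

theorem IsClosedSmoothCurve.hasDerivAt_iterate_arcDeriv (hΓ : IsClosedSmoothCurve Γ T)
    (hf : ContDiff ℝ ∞ f) (j : ℕ) (t : ℝ) :
    HasDerivAt (fun t => (((arcDeriv Γ)^[j] f t : ℝ) : ℂ))
      (‖deriv Γ t‖ * (((arcDeriv Γ)^[j + 1] f t : ℝ) : ℂ)) t := by
  have h := ((contDiff_infty_iff_deriv.1 (hΓ.contDiff_iterate_arcDeriv hf j)).1 t).hasDerivAt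
  refine h.ofReal_comp.congr_deriv ?_
  rw [iterate_succ_apply', arcDeriv, ← Complex.ofReal_mul,
    mul_inv_cancel_left₀ (hΓ.speed_pos t).ne']

theorem evalAlong_periodic (hΓ : IsClosedSmoothCurve Γ T) (hκ : Periodic κ T) (hτ : Periodic τ T)
    (P : DiffPoly) : Periodic (evalAlong Γ κ τ P) T := fun t => by
  have h1 := fun j => hΓ.periodic_iterate_arcDeriv hκ j t
  have h2 := fun j => hΓ.periodic_iterate_arcDeriv hτ j t
  simp only [evalAlong, h1, h2]

theorem evalAlong_C (c : ℂ) : evalAlong Γ κ τ (MvPolynomial.C c) = fun _ => c := by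
  funext t
  exact MvPolynomial.aeval_C _ c

theorem evalAlong_add (P Q : DiffPoly) :
    evalAlong Γ κ τ (P + Q) = evalAlong Γ κ τ P + evalAlong Γ κ τ Q := by
  funext t
  exact map_add _ P Q

theorem evalAlong_mul (P Q : DiffPoly) :
    evalAlong Γ κ τ (P * Q) = evalAlong Γ κ τ P * evalAlong Γ κ τ Q := by
  funext t
  exact map_mul _ P Q

theorem evalAlong_symK (j : ℕ) :
    evalAlong Γ κ τ (symK j) = fun t => (((arcDeriv Γ)^[j] κ t : ℝ) : ℂ) := by
  funext t
  exact MvPolynomial.aeval_X _ _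

theorem evalAlong_symT (j : ℕ) :
    evalAlong Γ κ τ (symT j) = fun t => (((arcDeriv Γ)^[j] τ t : ℝ) : ℂ) := by
  funext t
  exact MvPolynomial.aeval_X _ _

theorem contDiff_evalAlong (hΓ : IsClosedSmoothCurve Γ T) (hκ : ContDiff ℝ ∞ κ)
    (hτ : ContDiff ℝ ∞ τ) (P : DiffPoly) : ContDiff ℝ ∞ (evalAlong Γ κ τ P) := by
  induction P using MvPolynomial.induction_on with
  | C a =>
    rw [evalAlong_C]
    exact contDiff_const
  | add P Q hP hQ =>
    rw [evalAlong_add]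
    exact hP.add hQ
  | mul_X P i hP =>
    rw [evalAlong_mul]
    refine hP.mul ?_
    rcases i with j | j
    · rw [← symK, evalAlong_symK]
      exact Complex.ofRealCLM.contDiff.comp (hΓ.contDiff_iterate_arcDeriv hκ j)
    · rw [← symT, evalAlong_symT]
      exact Complex.ofRealCLM.contDiff.comp (hΓ.contDiff_iterate_arcDeriv hτ j)

/-- The total derivative is the derivative with respect to arc length. -/
theorem hasDerivAt_evalAlong (hΓ : IsClosedSmoothCurve Γ T) (hκ : ContDiff ℝ ∞ κ)
    (hτ : ContDiff ℝ ∞ τ) (P : DiffPoly) (t : ℝ) :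
    HasDerivAt (evalAlong Γ κ τ P) (‖deriv Γ t‖ * evalAlong Γ κ τ (totalDeriv P) t) t := by
  induction P using MvPolynomial.induction_on with
  | C a =>
    have h : totalDeriv (MvPolynomial.C a) = MvPolynomial.C 0 := by
      rw [map_zero]
      exact totalDeriv.map_algebraMap a
    rw [h, evalAlong_C, evalAlong_C, mul_zero]
    exact hasDerivAt_const t a
  | add P Q hP hQ =>
    rw [map_add, evalAlong_add, evalAlong_add, Pi.add_apply, mul_add]
    exact hP.add hQ
  | mul_X P i hP =>
    have hX : HasDerivAt (evalAlong Γ κ τ (MvPolynomial.X i))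
        (‖deriv Γ t‖ * evalAlong Γ κ τ (totalDeriv (MvPolynomial.X i)) t) t := by
      rw [totalDeriv, MvPolynomial.mkDerivation_X]
      rcases i with j | j
      · rw [← symK, evalAlong_symK, Sum.elim_inl, evalAlong_symK]
        exact hΓ.hasDerivAt_iterate_arcDeriv hκ j t
      · rw [← symT, evalAlong_symT, Sum.elim_inr, evalAlong_symT]
        exact hΓ.hasDerivAt_iterate_arcDeriv hτ j t
    rw [evalAlong_mul]
    refine (hP.mul hX).congr_deriv ?_
    simp only [Derivation.leibniz, smul_eq_mul, evalAlong_add, evalAlong_mul, Pi.add_apply,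
      Pi.mul_apply]
    ring

/-- The recursion for the polynomials `Zₙ` solves the Riccati equation of the Frenet frame as a
formal power series in `ℓ`. -/
theorem isFormalSol_zPoly (hΓ : IsClosedSmoothCurve Γ T) {n b : ℝ → E3}
    (h : IsFrenetFrame Γ T n b κ τ) :
    ((hΓ.isMovingFrame_of_isFrenetFrame h).2.2.riccatiData hΓ).IsFormalSol
      fun m => evalAlong Γ κ τ (zPoly m) where
  zero t := by simp only [evalAlong, zPoly, map_zero]
  smooth m := contDiff_evalAlong hΓ h.smooth_κ h.smooth_τ _
  periodic m := by
    obtain ⟨hκ, hτ, -⟩ := hΓ.isMovingFrame_of_isFrenetFrame h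
    exact evalAlong_periodic hΓ hκ hτ _
  succ m t := by
    have hsum : ∑ j ∈ Finset.range (m + 1),
        evalAlong Γ κ τ (zPoly j) t * evalAlong Γ κ τ (zPoly (m - j)) t =
        evalAlong Γ κ τ (∑ j : Fin (m + 1), zPoly j * zPoly (m - j)) t := by
      simp only [evalAlong, map_sum, map_mul]
      exact Finset.sum_range fun j => evalAlong Γ κ τ (zPoly j) t * evalAlong Γ κ τ (zPoly (m - j)) t
    rw [hsum, (hasDerivAt_evalAlong hΓ h.smooth_κ h.smooth_τ (zPoly m) t).deriv]
    simp only [IsMovingFrame.riccatiData, Complex.conj_ofReal]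
    rw [zPoly]
    simp only [evalAlong, symK, symT, map_add, map_mul, MvPolynomial.aeval_X, MvPolynomial.aeval_C,
      Sum.elim_inl, Sum.elim_inr, iterate_zero, id, Algebra.algebraMap_self, RingHom.id_apply]
    split_ifs <;> push_cast <;> simp only [map_one, map_zero] <;> ring

theorem logCoeff_zPoly (hΓ : IsClosedSmoothCurve Γ T) {n b : ℝ → E3}
    (h : IsFrenetFrame Γ T n b κ τ) (m : ℕ) :
    ((hΓ.isMovingFrame_of_isFrenetFrame h).2.2.riccatiData hΓ).logCoeff
      (fun m => evalAlong Γ κ τ (zPoly m)) m =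
    integralAlong Γ T (evalAlong Γ κ τ (density m)) := by
  match m with
  | 0 => simp only [RiccatiData.logCoeff, IsMovingFrame.riccatiData, integralAlong, evalAlong,
      density, map_one, mul_one]
  | 1 =>
    rw [RiccatiData.logCoeff, ← intervalIntegral.integral_neg]
    simp only [IsMovingFrame.riccatiData, integralAlong, evalAlong, density, zPoly, symT,
      map_neg, map_mul, map_zero, MvPolynomial.aeval_X, MvPolynomial.aeval_C, Sum.elim_inr,
      iterate_zero, id, Algebra.algebraMap_self, RingHom.id_apply, if_true]
    congr 1
    funext t
    push_cast
    ring
  | m + 2 =>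
    rw [RiccatiData.logCoeff, ← intervalIntegral.integral_neg]
    simp only [IsMovingFrame.riccatiData, integralAlong, evalAlong, density, symK,
      map_neg, map_mul, MvPolynomial.aeval_X, Sum.elim_inl, iterate_zero, id,
      Complex.conj_ofReal, Nat.succ_ne_zero, if_false]
    congr 1
    funext t
    push_cast
    ring

end DiffPoly

/-- Unstable fixed points with the same multiplier for small `ℓ` give the same Taylor
coefficients. -/
theorem IsSmoothLog.sameTaylor {Γ Γ' : ℝ → E3} {T ε ℓ₁ ℓ₂ : ℝ} {F₁ F₂ : ℝ → ℂ}
    (hΓ' : IsClosedSmoothCurve Γ' T) (h1 : IsSmoothLog Γ T ℓ₁ F₁) (h2 : IsSmoothLog Γ' T ℓ₂ F₂)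
    (hε : 0 < ε) (h : ∀ ℓ ∈ Ioo 0 ε, ∀ x μ, IsUnstableFixedPoint Γ T ℓ x μ →
      ∃ x', IsUnstableFixedPoint Γ' T ℓ x' μ) : SameTaylor ℓ₁ F₁ ℓ₂ F₂ := by
  refine sameTaylor_of_exp_eq (ε := min ε (min ℓ₁ ℓ₂)) (lt_min hε (lt_min h1.pos h2.pos))
    ((min_le_right _ _).trans (min_le_left _ _)) ((min_le_right _ _).trans (min_le_right _ _))
    h1.smooth h2.smooth fun ℓ hℓ => ?_
  obtain ⟨hℓε, hℓ12⟩ := lt_min_iff.1 hℓ.2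
  obtain ⟨hℓ1, hℓ2⟩ := lt_min_iff.1 hℓ12
  obtain ⟨x, hx⟩ := h1.exp_eq ℓ ⟨hℓ.1, hℓ1⟩
  obtain ⟨x', hx'⟩ := h ℓ ⟨hℓ.1, hℓε⟩ x _ hx
  obtain ⟨y, hy⟩ := h2.exp_eq ℓ ⟨hℓ.1, hℓ2⟩
  exact (IsUnstableFixedPoint.unique hΓ'.contDiff_deriv.continuous hx' hy).2

end Bicycle

theorem theorem3p12 (Γ : ℝ → Bicycle.E3) (T : ℝ) (hΓ : Bicycle.IsClosedSmoothCurve Γ T) :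
    -- for small `ℓ` there is exactly one unstable fixed point, and `ℓ ln λ(ℓ)` extends smoothly
    (∃ (ℓ₀ : ℝ) (F : ℝ → ℂ), Bicycle.IsSmoothLog Γ T ℓ₀ F ∧
      ∀ ℓ ∈ Set.Ioo 0 ℓ₀, ∃! p : Bicycle.E3 × ℂ, Bicycle.IsUnstableFixedPoint Γ T ℓ p.1 p.2) ∧
    -- the Taylor coefficients depend only on `Γ`
    (∀ (ℓ₁ ℓ₂ : ℝ) (F₁ F₂ : ℝ → ℂ), Bicycle.IsSmoothLog Γ T ℓ₁ F₁ →
      Bicycle.IsSmoothLog Γ T ℓ₂ F₂ → Bicycle.SameTaylor ℓ₁ F₁ ℓ₂ F₂) ∧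
    -- they are invariants of the bicycle correspondence
    (∀ (Γ' : ℝ → Bicycle.E3) (d : ℝ), Bicycle.IsClosedSmoothCurve Γ' T → 0 < d →
      Bicycle.BicycleCorrespondence d Γ Γ' →
      ∀ (ℓ₁ ℓ₂ : ℝ) (F₁ F₂ : ℝ → ℂ), Bicycle.IsSmoothLog Γ T ℓ₁ F₁ →
        Bicycle.IsSmoothLog Γ' T ℓ₂ F₂ → Bicycle.SameTaylor ℓ₁ F₁ ℓ₂ F₂) ∧
    -- they are integrals of recursively determined polynomials in `κ`, `τ` and their derivatives
    (∀ (n b : ℝ → Bicycle.E3) (κ τ : ℝ → ℝ), Bicycle.IsFrenetFrame Γ T n b κ τ →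
      ∃ (ℓ₀ : ℝ) (F : ℝ → ℂ), Bicycle.IsSmoothLog Γ T ℓ₀ F ∧
        ∀ k : ℕ, Bicycle.taylorCoeff ℓ₀ F k =
          Bicycle.integralAlong Γ T (Bicycle.evalAlong Γ κ τ (Bicycle.density k))) := by
  refine ⟨?_, fun ℓ₁ ℓ₂ F₁ F₂ h1 h2 => ?_, fun Γ' d hΓ' hd h ℓ₁ ℓ₂ F₁ F₂ h1 h2 => ?_,
    fun n b κ τ h => ?_⟩
  · obtain ⟨n, b, k, ρ, hf⟩ := hΓ.exists_isMovingFrame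
    obtain ⟨ℓ₀, F, hF, -⟩ := hf.exists_isSmoothLog hΓ (hf.riccatiData hΓ).isFormalSol_formalSol
    refine ⟨ℓ₀, F, hF, fun ℓ hℓ => ?_⟩
    obtain ⟨x, hx⟩ := hF.exp_eq ℓ hℓ
    refine ⟨(x, _), hx, fun p hp => ?_⟩
    obtain ⟨e1, e2⟩ := Bicycle.IsUnstableFixedPoint.unique hΓ.contDiff_deriv.continuous hp hx
    exact Prod.ext e1 e2
  · exact h1.sameTaylor hΓ h2 one_pos fun ℓ _ x μ hx => ⟨x, hx⟩
  · exact h1.sameTaylor hΓ' h2 (half_pos hd) fun ℓ hℓ x μ hx =>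
      hx.exists_of_bicycleCorrespondence hΓ hΓ' hd h hℓ.1 (by linarith [hℓ.2])
  · obtain ⟨ℓ₀, F, hF, ht⟩ := ((hΓ.isMovingFrame_of_isFrenetFrame h).2.2).exists_isSmoothLog hΓ
      (Bicycle.isFormalSol_zPoly hΓ h)
    exact ⟨ℓ₀, F, hF, fun k => (ht k).trans (Bicycle.logCoeff_zPoly hΓ h k)⟩
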